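/- Let $\mathcal C$ be a class of geometric objects (a family of subsets of some space; two objects intersect if they have a common point). Let $\mathcal{DS}_0$ be a dynamic data structure that stores objects of $\mathcal C$ together with their handles, supports insertions and deletions of objects, and, given a query object of $\mathcal C$, reports the handle of a stored object that intersects the query object, if one exists. Suppose that, for every $n\ge 1$, its query and update time is $O(\tau_0(n))$ (at least amortized, starting from the empty structure) as long as at most $n$ objects are stored; every operation takes at least one time unit. Then, for every constant $c$, there is a dynamic data structure for two sets $A,B$ of objects of $\mathcal C$, both initially empty, with the following properties. It is a program of a random access machine (registers, arrays, addition, subtraction, comparison, indirect addressing at unit cost) that accesses objects only through operations on instances of $\mathcal{DS}_0$, which are charged with their time. The program does not depend on the parameter $\varepsilon\in(0,1]$, which it is given in the form $\lceil 1/\varepsilon\rceil$. It supports insertions of objects into $A$ and into $B$ and deletions of objects. After each update it explicitly holds a matching $M$ in the bipartite intersection graph of $A$ and $B$ (the vertices are the objects of $A$ and of $B$, and $a\in A$, $b\in B$ are adjacent if and only if $a\cap b\neq\emptyset$), as an array that gives the partner of every object, such that $$\mathrm{OPT}\le(1+O(\varepsilon))\,|M|,$$ where $\mathrm{OPT}$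 is the maximum cardinality of a matching in this graph. The amortized update time is $\widetilde O\big(\tau_0(n)/\varepsilon^{3}\big)$: there are constants $K,k$, independent of $\varepsilon$ and $n$, such that every sequence of $m$ updates during which both sets have at most $cn$ objects at any time is processed in total time at most $$K\cdot\frac{1}{\varepsilon^{3}}\,\log^{k}(n+2)\;\tau_0(n)\cdot m .$$ -/

import Mathlib

universe u v

namespace DynMatching

/-! ### Black-box dynamic intersection searching -/

/-- The requests to a dynamic structure for objects of type `Ω`. A stored object comes with a
handle (its address), by which it is deleted and by which a search reports it. -/
inductive DSOp (Ω : Type u) : Type u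
  | insert (h : ℕ) (x : Ω)
  | erase (h : ℕ)
  | find (x : Ω)

/-- The stored objects: a partial map from handles to objects. -/
abbrev Store (Ω : Type u) : Type u := ℕ → Option Ω

/-- The number of handles in use. -/
noncomputable def Store.size {Ω : Type u} (S : Store Ω) : ℕ := {h | S h ≠ none}.ncard

/-- The effect of a request on the stored objects. -/
def DSOp.act {Ω : Type u} : DSOp Ω → Store Ω → Store Ω
  | .insert h x, S => Function.update S h (some x)
  | .erase h, S => Function.update S h none
  | .find _, S => S

/-- Legal requests: an insertion uses a free handle and an object that is not stored yet, a deletion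
names a stored object; searches are always legal. -/
def DSOp.Legal {Ω : Type u} : DSOp Ω → Store Ω → Prop
  | .insert h x, S => S h = none ∧ ∀ h', S h' ≠ some x
  | .erase h, S => S h ≠ none
  | .find _, _ => True

/-- A (deterministic) black-box data structure: internal states, and for every state and request the
next state, the answer, and the number of elementary steps, at least one, that are spent. -/
structure BlackBox (Ω : Type u) where
  State : Type v
  start : State
  next : State → DSOp Ω → State
  answer : State → DSOp Ω → Option ℕ
  time : State → DSOp Ω → ℕ
  time_pos : ∀ q op, 0 < time q op

/-- `D.Reach n q S m t`: starting empty, some `m` legal requests, with at most `n` objects stored at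
any time, take `t` steps in total and lead to state `q` with stored objects `S`. -/
inductive BlackBox.Reach {Ω : Type u} (D : BlackBox.{u, v} Ω) (n : ℕ) :
    D.State → Store Ω → ℕ → ℕ → Prop
  | start : D.Reach n D.start (fun _ => none) 0 0
  | step {q : D.State} {S : Store Ω} {m t : ℕ} (op : DSOp Ω) :
      D.Reach n q S m t → op.Legal S → (op.act S).size ≤ n →
      D.Reach n (D.next q op) (op.act S) (m + 1) (t + D.time q op)

/-- `D` is a dynamic intersection searching structure for the class `C` of objects: a search for `x`
reports the handle of a stored object that intersects `x`, if there is one, and nothing otherwise. -/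
def BlackBox.FindsIntersecting {X : Type u} {C : Set (Set X)} (D : BlackBox.{u, v} C) : Prop :=
  ∀ (n : ℕ) (q : D.State) (S : Store C) (m t : ℕ), D.Reach n q S m t → ∀ x : C,
    (∀ h, D.answer q (.find x) = some h →
      ∃ y : C, S h = some y ∧ ((x : Set X) ∩ (y : Set X)).Nonempty) ∧
    (D.answer q (.find x) = none →
      ∀ h (y : C), S h = some y → ¬ ((x : Set X) ∩ (y : Set X)).Nonempty)

/-- With at most `n ≥ 1` objects stored, requests take `O(τ n)` time. Only the amortized bound is
asked for, which worst-case bounds imply. -/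
def BlackBox.HasTime {Ω : Type u} (D : BlackBox.{u, v} Ω) (τ : ℕ → ℝ) : Prop :=
  ∃ A : ℝ, 0 < A ∧ ∀ (n : ℕ), 1 ≤ n → ∀ (q : D.State) (S : Store Ω) (m t : ℕ),
    D.Reach n q S m t → (t : ℝ) ≤ A * τ n * m

/-! ### A random access machine with black-box instances -/

/-- Programs of a random access machine with registers, finitely many arrays, and arbitrarily many
instances of the black box. The arguments are numbers of registers, except that `const r k` has the
constant `k`, and that the first argument of `store`, the second of `load`, is the number of
an array. -/
inductive Prog : Type
  | skip
  /-- `r := k` -/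
  | const (r k : ℕ)
  /-- `r := a + b` -/
  | add (r a b : ℕ)
  /-- `r := max (a - b) 0` -/
  | sub (r a b : ℕ)
  /-- `r := array k at index a` -/
  | load (r k a : ℕ)
  /-- `array k at index a := b` -/
  | store (k a b : ℕ)
  /-- insert the object with handle `h` into instance `i` -/
  | dsInsert (i h : ℕ)
  /-- delete the object with handle `h` from instance `i` -/
  | dsErase (i h : ℕ)
  /-- search instance `i` with the object with handle `h`; `r` becomes `0` if nothing is
  reported, and `j + 1` if handle `j` is -/
  | dsFind (r i h : ℕ)
  | seq (p p' : Prog)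
  /-- if `a < b` then `p` else `p'` -/
  | ite (a b : ℕ) (p p' : Prog)
  /-- while `a < b` do `p` -/
  | loop (a b : ℕ) (p : Prog)

/-- Configurations: registers, arrays, and the states of the instances of the black box. -/
structure Config {Ω : Type u} (D : BlackBox.{u, v} Ω) where
  reg : ℕ → ℕ
  mem : ℕ → ℕ → ℕ
  inst : ℕ → D.State

variable {Ω : Type u} {D : BlackBox.{u, v} Ω}

/-- Assign a value to a register. -/
def Config.setReg (σ : Config D) (r k : ℕ) : Config D :=
  { σ with reg := Function.update σ.reg r k }

/-- Assign a value to an array entry. -/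
def Config.setMem (σ : Config D) (k a b : ℕ) : Config D :=
  { σ with mem := Function.update σ.mem k (Function.update (σ.mem k) a b) }

/-- Instance `i` of the black box processes a request. -/
def Config.request (σ : Config D) (i : ℕ) (op : DSOp Ω) : Config D :=
  { σ with inst := Function.update σ.inst i (D.next (σ.inst i) op) }

/-- `Exec objs p σ σ' t`: program `p`, started in `σ`, halts in `σ'` after `t` steps. Every
elementary instruction and every test is one step, a request to the black box takes in addition the
time that the black box spends on it. `objs` holds the objects present, by handle; it is accessible
only through requests to the black box. -/
inductive Exec (objs : Store Ω) : Prog → Config D → Config D → ℕ → Prop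
  | skip (σ : Config D) : Exec objs .skip σ σ 1
  | const (σ : Config D) (r k : ℕ) : Exec objs (.const r k) σ (σ.setReg r k) 1
  | add (σ : Config D) (r a b : ℕ) :
      Exec objs (.add r a b) σ (σ.setReg r (σ.reg a + σ.reg b)) 1
  | sub (σ : Config D) (r a b : ℕ) :
      Exec objs (.sub r a b) σ (σ.setReg r (σ.reg a - σ.reg b)) 1
  | load (σ : Config D) (r k a : ℕ) :
      Exec objs (.load r k a) σ (σ.setReg r (σ.mem k (σ.reg a))) 1
  | store (σ : Config D) (k a b : ℕ) :
      Exec objs (.store k a b) σ (σ.setMem k (σ.reg a) (σ.reg b)) 1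
  | dsInsert (σ : Config D) (i h : ℕ) (x : Ω) : objs (σ.reg h) = some x →
      Exec objs (.dsInsert i h) σ (σ.request (σ.reg i) (.insert (σ.reg h) x))
        (1 + D.time (σ.inst (σ.reg i)) (.insert (σ.reg h) x))
  | dsErase (σ : Config D) (i h : ℕ) :
      Exec objs (.dsErase i h) σ (σ.request (σ.reg i) (.erase (σ.reg h)))
        (1 + D.time (σ.inst (σ.reg i)) (.erase (σ.reg h)))
  | dsFind (σ : Config D) (r i h : ℕ) (x : Ω) : objs (σ.reg h) = some x →
      Exec objs (.dsFind r i h) σ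
        ((σ.request (σ.reg i) (.find x)).setReg r
          ((D.answer (σ.inst (σ.reg i)) (.find x)).elim 0 (fun j => j + 1)))
        (1 + D.time (σ.inst (σ.reg i)) (.find x))
  | seq {p p' : Prog} {σ σ₁ σ₂ : Config D} {t₁ t₂ : ℕ} :
      Exec objs p σ σ₁ t₁ → Exec objs p' σ₁ σ₂ t₂ → Exec objs (.seq p p') σ σ₂ (t₁ + t₂)
  | iteTrue {a b : ℕ} {p p' : Prog} {σ σ₁ : Config D} {t : ℕ} : σ.reg a < σ.reg b →
      Exec objs p σ σ₁ t → Exec objs (.ite a b p p') σ σ₁ (1 + t)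
  | iteFalse {a b : ℕ} {p p' : Prog} {σ σ₁ : Config D} {t : ℕ} : ¬ σ.reg a < σ.reg b →
      Exec objs p' σ σ₁ t → Exec objs (.ite a b p p') σ σ₁ (1 + t)
  | loopDone {a b : ℕ} {p : Prog} {σ : Config D} : ¬ σ.reg a < σ.reg b →
      Exec objs (.loop a b p) σ σ 1
  | loopStep {a b : ℕ} {p : Prog} {σ σ₁ σ₂ : Config D} {t₁ t₂ : ℕ} : σ.reg a < σ.reg b →
      Exec objs p σ σ₁ t₁ → Exec objs (.loop a b p) σ₁ σ₂ t₂ →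
      Exec objs (.loop a b p) σ σ₂ (1 + t₁ + t₂)

/-! ### Two dynamic sets of objects and their intersection graph -/

/-- Two finite sets of objects, told apart by a `Bool`: a partial map from handles to pairs
(set, object). -/
abbrev TwoSets (Ω : Type u) : Type u := ℕ → Option (Bool × Ω)

/-- The number of objects in one of the two sets. -/
noncomputable def TwoSets.size (V : TwoSets Ω) (s : Bool) : ℕ :=
  {h | ∃ x, V h = some (s, x)}.ncard

/-- The objects of both sets, by handle. -/
def TwoSets.objs (V : TwoSets Ω) : Store Ω := fun h => (V h).map Prod.snd

/-- Insert an object into set `s`, under handle `h`, or delete the object with handle `h`. -/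
inductive Update (Ω : Type u) : Type u
  | insert (s : Bool) (h : ℕ) (x : Ω)
  | delete (h : ℕ)

/-- The effect of an update. -/
def Update.act : Update Ω → TwoSets Ω → TwoSets Ω
  | .insert s h x, V => Function.update V h (some (s, x))
  | .delete h, V => Function.update V h none

/-- Legal updates: an insertion uses a free handle and an object not yet in that set, a deletion
names an object that is present. -/
def Update.Legal : Update Ω → TwoSets Ω → Prop
  | .insert s h x, V => V h = none ∧ ∀ h', V h' ≠ some (s, x)
  | .delete h, V => V h ≠ none

/-- The two sets after a sequence of updates of the empty sets. -/
def setsAfter (us : List (Update Ω)) : TwoSets Ω :=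
  us.foldl (fun V w => w.act V) (fun _ => none)

/-- Every update of the sequence is legal when it arrives. -/
def LegalSeq (us : List (Update Ω)) : Prop :=
  ∀ (vs : List (Update Ω)) (w : Update Ω), vs ++ [w] <+: us → w.Legal (setsAfter vs)

/-- The bipartite intersection graph, on the handles: two handles are adjacent if their objects
are in different sets and intersect. -/
def bipGraph {X : Type u} {C : Set (Set X)} (V : TwoSets C) : SimpleGraph ℕ where
  Adj h h' := ∃ (s : Bool) (x y : C), V h = some (s, x) ∧ V h' = some (!s, y) ∧
    ((x : Set X) ∩ (y : Set X)).Nonempty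
  symm := ⟨by
    rintro h h' ⟨s, x, y, hx, hy, hxy⟩
    exact ⟨!s, y, x, hy, by simpa using hx, by rwa [Set.inter_comm]⟩⟩
  loopless := ⟨by
    rintro h ⟨s, x, y, hx, hy, -⟩
    rw [hx] at hy
    simp at hy⟩

/-! ### Programs that process sequences of updates -/

/-- The initial configuration with parameter `E`: the parameter is in register 2, everything else is
zero, and all instances of the black box are empty. -/
def Config.initial (D : BlackBox.{u, v} Ω) (E : ℕ) : Config D where
  reg := Function.update (fun _ => 0) 2 E
  mem := fun _ _ => 0
  inst := fun _ => D.start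

/-- An update is communicated through register 0 (`0`: deletion, `1` and `2`: insertion into the
first and the second set) and register 1 (the handle). -/
def Config.feed (σ : Config D) : Update Ω → Config D
  | .insert s h _ => (σ.setReg 0 (if s then 2 else 1)).setReg 1 h
  | .delete h => (σ.setReg 0 0).setReg 1 h

/-- `Serves p E us σ t`: with parameter `E`, running `p` once for each of the updates `us` takes `t`
steps in total and ends in `σ`. While `p` runs, it has access to the objects that are present after
the current update, and to none that arrive later. -/
inductive Serves (p : Prog) (E : ℕ) : List (Update Ω) → Config D → ℕ → Prop
  | nil : Serves p E [] (Config.initial D E) 0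
  | snoc {us : List (Update Ω)} {σ σ' : Config D} {t t' : ℕ} (w : Update Ω) :
      Serves p E us σ t → Exec (setsAfter (us ++ [w])).objs p (σ.feed w) σ' t' →
      Serves p E (us ++ [w]) σ' (t + t')

/-- Execution is deterministic. -/
theorem Exec.det {objs : Store Ω} {p : Prog}
    {σ σ₁ σ₂ : Config D} {t₁ t₂ : ℕ}
    (h₁ : Exec objs p σ σ₁ t₁) (h₂ : Exec objs p σ σ₂ t₂) : σ₁ = σ₂ ∧ t₁ = t₂ := by
  induction h₁ generalizing σ₂ t₂ with
  | seq _ _ ih ih' => cases h₂ with | seq a b => grind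
  | iteTrue => cases h₂ <;> grind
  | iteFalse => cases h₂ <;> grind
  | loopDone => cases h₂ <;> grind
  | loopStep => cases h₂ <;> grind
  | _ => cases h₂ <;> grind

/-- The outcome of serving a sequence of updates is unique; as `Serves` works through the sequence
update by update, what is shown of all sequences holds after every single update of a long one. -/
theorem Serves.det {p : Prog} {E : ℕ} {us : List (Update Ω)}
    {σ σ' : Config D} {t t' : ℕ} (h : Serves p E us σ t) (h' : Serves p E us σ' t') :
    σ = σ' ∧ t = t' := by
  induction h generalizing σ' t' with
  | nil =>
    generalize hl : ([] : List (Update Ω)) = l at h'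
    cases h' <;> simp_all
  | @snoc us σ₁ σ₂ t₁ t₂ w _ hx ih =>
    generalize hl : us ++ [w] = l at h'
    cases h' with
    | nil => simp at hl
    | snoc w' hs hx' =>
      obtain ⟨rfl, hw⟩ := List.append_inj' hl rfl
      cases hw
      obtain ⟨rfl, rfl⟩ := ih hs
      obtain ⟨rfl, rfl⟩ := hx.det hx'
      exact ⟨rfl, rfl⟩

/-- The output array `out` lists the matching `M`: the entry of an object that is present is `0` if
the object is unmatched, and `h' + 1` if it is matched to the object with handle `h'`. -/
def Lists {X : Type u} {C : Set (Set X)} {V : TwoSets C} (out : ℕ → ℕ)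
    (M : (bipGraph V).Subgraph) : Prop :=
  ∀ h, V h ≠ none → ∀ h', out h = h' + 1 ↔ M.Adj h h'

end DynMatching

namespace DynMatching

/-! The matching is kept maximal at all times and is improved now and then by an auction. Let E =
⌈1/ε⌉. The first set consists of bidders, the second of items. An item in family l ≥ 2 has price l -
2, between 0 and E; the free bidders form family 1.

The auction starts from the current maximal matching, with price 1 for matched items and 0 for free
ones. The bidder whose turn it is takes a cheapest item that it meets, provided the price is below
E, raises the price by one and displaces the previous partner, which bids next. A matched bidder
thus always holds an item at most one dearer than any other item it meets, and in the end a free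
bidder meets only items of price E. Give a matched bidder E + 1 minus the price of its item, and a
free one 0: every edge is then covered by at least E, while a matched pair contributes exactly E +
1. Weak duality (`IsPairing.mul_card_le`) yields E·OPT ≤ (E + 1)·|M| (`Auction.opt`).

The cost has to depend on OPT, not on the number of objects. Every successful bid raises the total
price by at least one, and this total is at most E·OPT because only matched items have positive
prices. One bid needs O(E) searches. Free bidders are never enumerated: by maximality they meet only
matched items, so searching family 1 with the listed items finds the relevant ones. Hence a
rebuilding takes O(E²·OPT) work, apart from reading the list (`vc_auctionLoop`, `vc_rebuild`).

If a rebuilding leaves m₀ edges, the next one happens as soon as 2Ej ≥ m₀ after j updates. One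
update raises OPT by at most one (`OptLe.update`) and lowers |M| by at most one, so the ratio stays
1 + O(1/E) (`Good.approx`), and the rebuilding is paid by O(E³) per update (`rebuild_cost`). No
logarithm arises.

The objects are split into 2c + 1 balanced parts with instances of their own, so that no instance
exceeds n objects (`Core`). The program does not know n, and nothing is assumed about the growth of
τ₀.

Programs are verified by weakest preconditions (`vc`, `vc_sound`) over states that show only what
each instance stores; a search may give any correct answer. `Refines.time_le` turns work into time.
-/

/-! ### Verification conditions for programs -/

/-- A configuration in which the instances of the black box are replaced by what they store. -/
structure AState (Ω : Type u) where
  reg : ℕ → ℕ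
  mem : ℕ → ℕ → ℕ
  st : ℕ → Store Ω

/-- Two handles carry intersecting objects. -/
def Meets {X : Type u} {C : Set (Set X)} (x y : C) : Prop :=
  ((x : Set X) ∩ (y : Set X)).Nonempty

/-- The condition on `a` that guarantees that `p`, started in `a`, halts in a state `a'` after work
`w` such that `Q a' w`. Work counts elementary instructions, tests and requests. Loops come with an
invariant that is indexed by the work that is still available. -/
def vc {X : Type u} {C : Set (Set X)} (objs : Store C) (n : ℕ) :
    Prog → AState C → (AState C → ℕ → Prop) → Prop
  | .skip, a, Q => Q a 1
  | .const r k, a, Q => Q ⟨Function.update a.reg r k, a.mem, a.st⟩ 1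
  | .add r x y, a, Q => Q ⟨Function.update a.reg r (a.reg x + a.reg y), a.mem, a.st⟩ 1
  | .sub r x y, a, Q => Q ⟨Function.update a.reg r (a.reg x - a.reg y), a.mem, a.st⟩ 1
  | .load r k x, a, Q => Q ⟨Function.update a.reg r (a.mem k (a.reg x)), a.mem, a.st⟩ 1
  | .store k x y, a, Q =>
      Q ⟨a.reg, Function.update a.mem k (Function.update (a.mem k) (a.reg x) (a.reg y)), a.st⟩ 1
  | .dsInsert i h, a, Q => ∃ x, objs (a.reg h) = some x ∧
      (DSOp.insert (a.reg h) x).Legal (a.st (a.reg i)) ∧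
      ((DSOp.insert (a.reg h) x).act (a.st (a.reg i))).size ≤ n ∧
      Q ⟨a.reg, a.mem, Function.update a.st (a.reg i)
        ((DSOp.insert (a.reg h) x).act (a.st (a.reg i)))⟩ 1
  | .dsErase i h, a, Q =>
      (DSOp.erase (a.reg h)).Legal (a.st (a.reg i)) ∧
      ((DSOp.erase (a.reg h)).act (a.st (a.reg i))).size ≤ n ∧
      Q ⟨a.reg, a.mem, Function.update a.st (a.reg i)
        ((DSOp.erase (a.reg h)).act (a.st (a.reg i)))⟩ 1
  | .dsFind r i h, a, Q => ∃ x, objs (a.reg h) = some x ∧ (a.st (a.reg i)).size ≤ n ∧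
      ∀ z, (z = 0 → ∀ g y, a.st (a.reg i) g = some y → ¬ Meets x y) →
        (∀ g, z = g + 1 → ∃ y, a.st (a.reg i) g = some y ∧ Meets x y) →
        Q ⟨Function.update a.reg r z, a.mem, a.st⟩ 1
  | .seq p p', a, Q =>
      vc objs n p a (fun a₁ w₁ => vc objs n p' a₁ (fun a₂ w₂ => Q a₂ (w₁ + w₂)))
  | .ite x y p p', a, Q =>
      (a.reg x < a.reg y → vc objs n p a (fun a' w => Q a' (1 + w))) ∧
      (¬ a.reg x < a.reg y → vc objs n p' a (fun a' w => Q a' (1 + w)))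
  | .loop x y p, a, Q => ∃ (I : ℕ → AState C → Prop) (k : ℕ), I k a ∧
      (∀ k a, I k a → a.reg x < a.reg y →
        vc objs n p a (fun a' w => ∃ k', k' + w + 1 ≤ k ∧ I k' a')) ∧
      (∀ k' a' w, I k' a' → ¬ a'.reg x < a'.reg y → w + k' ≤ k + 1 → Q a' w)

/-- `σ` is described by `a`, and so far `T` steps were made, of which all but `w` were spent by the
black box on at most `w` requests. -/
def Refines {Ω : Type u} {D : BlackBox.{u, v} Ω} (n : ℕ) (a : AState Ω) (σ : Config D)
    (T w : ℕ) : Prop :=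
  σ.reg = a.reg ∧ σ.mem = a.mem ∧ ∃ mf tf : ℕ →₀ ℕ,
    (∀ i, D.Reach n (σ.inst i) (a.st i) (mf i) (tf i)) ∧
    (mf.sum fun _ m => m) ≤ w ∧ T ≤ w + tf.sum fun _ t => t

section
variable {X : Type u} {C : Set (Set X)} {D : BlackBox.{u, v} C}

theorem Refines.tick {n : ℕ} {a : AState C} {σ : Config D} {T w : ℕ} (h : Refines n a σ T w) :
    Refines n a σ (T + 1) (w + 1) := by
  obtain ⟨h1, h2, mf, tf, h3, h4, h5⟩ := h
  exact ⟨h1, h2, mf, tf, h3, by omega, by omega⟩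

/-- One unit of work pays for the instruction and at the same time counts the additional request;
the time of the black box goes into `tf i`. -/
theorem Refines.request {n : ℕ} {a : AState C} {σ : Config D} {T w : ℕ} (h : Refines n a σ T w)
    (i : ℕ) (op : DSOp C) (hl : op.Legal (a.st i)) (hs : (op.act (a.st i)).size ≤ n) :
    Refines n ⟨a.reg, a.mem, Function.update a.st i (op.act (a.st i))⟩ (σ.request i op)
      (T + (1 + D.time (σ.inst i) op)) (w + 1) := by
  obtain ⟨h1, h2, mf, tf, h3, h4, h5⟩ := h
  refine ⟨h1, h2, mf + Finsupp.single i 1, tf + Finsupp.single i (D.time (σ.inst i) op), ?_, ?_, ?_⟩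
  · intro k
    by_cases hk : k = i
    · subst hk
      simpa [Config.request] using BlackBox.Reach.step op (h3 k) hl hs
    · simpa [Config.request, hk, Finsupp.single_apply, Ne.symm hk] using h3 k
  · rw [Finsupp.sum_add_index' (by simp) (by simp)]
    simp; omega
  · rw [Finsupp.sum_add_index' (by simp) (by simp)]
    simp; omega

/-- Structural induction on the program. At a search, the arbitrary answer in `vc` is specialized to
that of the black box, which is correct because `Refines` keeps every instance reachable. -/
theorem vc_sound (hD : D.FindsIntersecting) (objs : Store C) (n : ℕ) (p : Prog) (a : AState C)
    (Q : AState C → ℕ → Prop) (h : vc objs n p a Q) (σ : Config D) (T w : ℕ)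
    (hr : Refines n a σ T w) :
    ∃ σ' t a' w', Exec objs p σ σ' t ∧ Refines n a' σ' (T + t) (w + w') ∧ Q a' w' := by
  induction p generalizing a Q σ T w with
  | skip => exact ⟨σ, 1, a, 1, .skip σ, hr.tick, h⟩
  | const r k =>
    refine ⟨_, 1, _, 1, .const σ r k, ?_, h⟩
    obtain ⟨h1, h2, h3⟩ := hr.tick
    exact ⟨by simp [Config.setReg, h1], h2, h3⟩
  | add r x y =>
    refine ⟨_, 1, _, 1, .add σ r x y, ?_, h⟩
    obtain ⟨h1, h2, h3⟩ := hr.tick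
    exact ⟨by simp [Config.setReg, h1], h2, h3⟩
  | sub r x y =>
    refine ⟨_, 1, _, 1, .sub σ r x y, ?_, h⟩
    obtain ⟨h1, h2, h3⟩ := hr.tick
    exact ⟨by simp [Config.setReg, h1], h2, h3⟩
  | load r k x =>
    refine ⟨_, 1, _, 1, .load σ r k x, ?_, h⟩
    obtain ⟨h1, h2, h3⟩ := hr.tick
    exact ⟨by simp [Config.setReg, h1, h2], h2, h3⟩
  | store k x y =>
    refine ⟨_, 1, _, 1, .store σ k x y, ?_, h⟩
    obtain ⟨h1, h2, h3⟩ := hr.tick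
    exact ⟨h1, by simp [Config.setMem, h1, h2], h3⟩
  | dsInsert i h' =>
    obtain ⟨x, hx, hl, hs, hQ⟩ := h
    have h1 := hr.1
    refine ⟨_, _, _, 1, .dsInsert σ i h' x (by rw [h1]; exact hx), ?_, hQ⟩
    simpa only [h1] using hr.request _ _ hl hs
  | dsErase i h' =>
    obtain ⟨hl, hs, hQ⟩ := h
    have h1 := hr.1
    refine ⟨_, _, _, 1, .dsErase σ i h', ?_, hQ⟩
    simpa only [h1] using hr.request _ _ hl hs
  | dsFind r i h' =>
    obtain ⟨x, hx, hs, hQ⟩ := h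
    have h1 := hr.1
    refine ⟨_, _, _, 1, .dsFind σ r i h' x (by rw [h1]; exact hx), ?_,
      hQ ((D.answer (σ.inst (σ.reg i)) (.find x)).elim 0 (fun j => j + 1)) ?_ ?_⟩
    · have := hr.request (a.reg i) (.find x) trivial hs
      obtain ⟨g1, g2, g3⟩ := this
      refine ⟨by simp [Config.setReg, Config.request, h1], g2, ?_⟩
      simpa [DSOp.act, h1, Config.setReg] using g3
    all_goals
      obtain ⟨-, -, mf, tf, h3, -, -⟩ := hr
      have hc := hD n _ _ _ _ (h3 (a.reg i)) x
      rw [h1]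
    · intro hz
      cases ho : D.answer (σ.inst (a.reg i)) (.find x) with
      | none => exact hc.2 ho
      | some j => simp [ho] at hz
    · intro g hz
      cases ho : D.answer (σ.inst (a.reg i)) (.find x) with
      | none => simp [ho] at hz
      | some j =>
        obtain rfl : j = g := by simpa [ho] using hz
        exact hc.1 j ho
  | seq p p' ih ih' =>
    obtain ⟨σ₁, t₁, a₁, w₁, e₁, r₁, q₁⟩ := ih _ _ h σ T w hr
    obtain ⟨σ₂, t₂, a₂, w₂, e₂, r₂, q₂⟩ := ih' _ _ q₁ σ₁ _ _ r₁
    exact ⟨σ₂, _, a₂, _, .seq e₁ e₂, by simpa only [add_assoc] using r₂, q₂⟩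
  | ite x y p p' ih ih' =>
    have h1 := hr.1
    by_cases hc : a.reg x < a.reg y
    · obtain ⟨σ₁, t₁, a₁, w₁, e₁, r₁, q₁⟩ := ih _ _ (h.1 hc) σ _ _ hr.tick
      exact ⟨σ₁, _, a₁, _, .iteTrue (by rw [h1]; exact hc) e₁,
        by simpa only [add_assoc] using r₁, q₁⟩
    · obtain ⟨σ₁, t₁, a₁, w₁, e₁, r₁, q₁⟩ := ih' _ _ (h.2 hc) σ _ _ hr.tick
      exact ⟨σ₁, _, a₁, _, .iteFalse (by rw [h1]; exact hc) e₁,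
        by simpa only [add_assoc] using r₁, q₁⟩
  | loop x y p ih =>
    obtain ⟨I, k, hI, hb, hQ⟩ := h
    -- Strong induction on the remaining work `k` proves termination, as each pass consumes at least
    -- one unit. The extra 1 in `k + 1` is the final test, which fails.
    suffices H : ∀ k a σ T w, I k a → Refines n a σ T w → ∃ σ' t a' w' k',
        Exec objs (.loop x y p) σ σ' t ∧ Refines n a' σ' (T + t) (w + w') ∧
        I k' a' ∧ ¬ a'.reg x < a'.reg y ∧ w' + k' ≤ k + 1 by
      obtain ⟨σ', t, a', w', k', e, r, i, c, l⟩ := H k a σ T w hI hr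
      exact ⟨σ', t, a', w', e, r, hQ k' a' w' i c l⟩
    clear hI hQ hr a σ T w k
    intro k
    induction k using Nat.strong_induction_on with
    | _ k ihk =>
      intro a σ T w hI hr
      have h1 := hr.1
      by_cases hc : a.reg x < a.reg y
      · obtain ⟨σ₁, t₁, a₁, w₁, e₁, r₁, k₁, l₁, i₁⟩ := ih _ _ (hb k a hI hc) σ _ _ hr.tick
        obtain ⟨σ₂, t₂, a₂, w₂, k₂, e₂, r₂, i₂, c₂, l₂⟩ := ihk k₁ (by omega) a₁ σ₁ _ _ i₁ r₁
        exact ⟨σ₂, _, a₂, 1 + w₁ + w₂, k₂, .loopStep (by rw [h1]; exact hc) e₁ e₂,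
          by simpa only [add_assoc] using r₂, i₂, c₂, by omega⟩
      · exact ⟨σ, 1, a, 1, k, .loopDone (by rw [h1]; exact hc), hr.tick, hI, hc, by omega⟩

/-- The amortized bound holds for each instance from its own start, so it can be summed over the
instances. The factor 2 absorbs the machine's own steps, as `1 ≤ A * τ n`. -/
theorem Refines.time_le {τ : ℕ → ℝ} {A : ℝ} {n : ℕ}
    (hA : ∀ (q : D.State) (S : Store C) (m t : ℕ), D.Reach n q S m t → (t : ℝ) ≤ A * τ n * m)
    (hA1 : 1 ≤ A * τ n) {a : AState C} {σ : Config D} {T w : ℕ} (h : Refines n a σ T w) :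
    (T : ℝ) ≤ 2 * (A * τ n) * w := by
  obtain ⟨-, -, mf, tf, h3, h4, h5⟩ := h
  have hsum : ((tf.sum fun _ t => t : ℕ) : ℝ) ≤ A * τ n * (mf.sum fun _ m => m : ℕ) := by
    -- Both sums are extended to the union of the supports, to be compared term by term.
    rw [Finsupp.sum_of_support_subset tf (Finset.subset_union_left (s₂ := mf.support)) _ (by simp),
      Finsupp.sum_of_support_subset mf (Finset.subset_union_right (s₁ := tf.support)) _ (by simp)]
    push_cast
    rw [Finset.mul_sum]
    exact Finset.sum_le_sum fun i _ => hA _ _ _ _ (h3 i)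
  have h4' : ((mf.sum fun _ m => m : ℕ) : ℝ) ≤ w := by exact_mod_cast h4
  have h5' : (T : ℝ) ≤ w + (tf.sum fun _ t => t : ℕ) := by exact_mod_cast h5
  have hw : (0 : ℝ) ≤ w := by positivity
  nlinarith

theorem Refines.initial (n E : ℕ) :
    Refines n ⟨Function.update (fun _ => 0) 2 E, fun _ _ => 0, fun _ _ => none⟩
      (Config.initial D E) 0 0 :=
  ⟨rfl, rfl, 0, 0, fun _ => .start, by simp, by simp⟩

end

/-! ### Families of objects, distributed over instances -/

section
variable {X : Type u} {C : Set (Set X)}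

/-- Every object `h` with `fam h ≠ 0` is stored in instance `off h + fam h`. The offsets, multiples of
`E + 3`, split the objects into `G` parts of at most `n` objects. -/
structure Core (ob : Store C) (E G n : ℕ) (off fam : ℕ → ℕ) (S : ℕ → Store C) : Prop where
  sync : ∀ i h, S i h = if fam h ≠ 0 ∧ off h + fam h = i then ob h else none
  off_eq : ∀ h, ob h ≠ none → ∃ j < G, off h = j * (E + 3)
  fam_lt : ∀ h, fam h < E + 3
  present : ∀ h, fam h ≠ 0 → ob h ≠ none
  bound : ∀ o, {h | ob h ≠ none ∧ off h = o}.ncard ≤ n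
  fin : {h | ob h ≠ none}.Finite

theorem stride_inj {j j' l l' s : ℕ} (hl : l < s) (hl' : l' < s)
    (h : j * s + l = j' * s + l') : j = j' ∧ l = l' := by
  have h1 := congrArg (· / s) h
  have h2 := congrArg (· % s) h
  have hs : 0 < s := by omega
  simp only [Nat.mul_comm _ s, Nat.mul_add_div hs, Nat.div_eq_of_lt hl, Nat.div_eq_of_lt hl',
    Nat.mul_add_mod, Nat.mod_eq_of_lt hl, Nat.mod_eq_of_lt hl'] at h1 h2
  exact ⟨by simpa using h1, h2⟩

/-- Families are smaller than the stride, so division with remainder recovers part and family from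
the number of an instance. -/
theorem Core.mem_inst {ob : Store C} {E G n : ℕ} {off fam : ℕ → ℕ} {S : ℕ → Store C}
    (hc : Core ob E G n off fam S) {j l g : ℕ} (hl : l < E + 3) {y : C}
    (hg : S (j * (E + 3) + l) g = some y) :
    off g = j * (E + 3) ∧ fam g = l ∧ ob g = some y := by
  rw [hc.sync] at hg
  split_ifs at hg with h
  obtain ⟨h1, h2⟩ := h
  obtain ⟨j', -, h3⟩ := hc.off_eq g (hc.present g h1)
  rw [h3] at h2
  obtain ⟨rfl, h5⟩ := stride_inj (hc.fam_lt g) hl h2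
  exact ⟨h3, h5, hg⟩

/-- An instance stores only objects of a single part. This is what keeps each request within the
range of the time bound for `n`. -/
theorem Core.size_le {ob : Store C} {E G n : ℕ} {off fam : ℕ → ℕ} {S : ℕ → Store C}
    (hc : Core ob E G n off fam S) (j l : ℕ) (hl : l < E + 3) :
    (S (j * (E + 3) + l)).size ≤ n := by
  refine (Set.ncard_le_ncard ?_ (hc.fin.subset fun h hh => hh.1)).trans (hc.bound (j * (E + 3)))
  intro g hg
  obtain ⟨y, hy⟩ := Option.ne_none_iff_exists'.1 hg
  obtain ⟨h1, -, h3⟩ := hc.mem_inst hl hy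
  exact ⟨by simp [h3], h1⟩

theorem Core.erase {ob : Store C} {E G n : ℕ} {off fam : ℕ → ℕ} {S : ℕ → Store C}
    (hc : Core ob E G n off fam S) {h : ℕ} (hf : fam h ≠ 0) :
    Core ob E G n off (Function.update fam h 0)
      (Function.update S (off h + fam h) (Function.update (S (off h + fam h)) h none)) := by
  refine ⟨fun i g => ?_, hc.off_eq, fun g => ?_, fun g hg => ?_, hc.bound, hc.fin⟩
  · have := hc.sync i g
    by_cases hi : i = off h + fam h <;> by_cases hgh : g = h <;> simp_all
    intro he
    exact absurd he.symm hi
  · by_cases hgh : g = h <;> simp [hgh, hc.fam_lt]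
  · by_cases hgh : g = h
    · simp [hgh] at hg
    · exact hc.present g (by simpa [hgh] using hg)

theorem Core.insert {ob : Store C} {E G n : ℕ} {off fam : ℕ → ℕ} {S : ℕ → Store C}
    (hc : Core ob E G n off fam S) {h l : ℕ} {x : C} (hf : fam h = 0) (hx : ob h = some x)
    (hl : l < E + 3) (hl0 : l ≠ 0) :
    Core ob E G n off (Function.update fam h l)
      (Function.update S (off h + l) (Function.update (S (off h + l)) h (some x))) := by
  refine ⟨fun i g => ?_, hc.off_eq, fun g => ?_, fun g hg => ?_, hc.bound, hc.fin⟩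
  · have := hc.sync i g
    by_cases hi : i = off h + l <;> by_cases hgh : g = h <;> simp_all
    rintro rfl
    exact absurd rfl hi
  · by_cases hgh : g = h <;> simp [hgh, hc.fam_lt, hl]
  · by_cases hgh : g = h
    · simp [hgh, hx]
    · exact hc.present g (by simpa [hgh] using hg)

/-! Register 5 holds `0`, register 6 holds `1`, register 7 holds the stride `E + 3`. -/

/-- Remove the object in register 20 from its family. -/
def evict : Prog :=
  .seq (.load 22 3 20) (.ite 5 22
    (.seq (.load 23 2 20) (.seq (.add 23 23 22) (.seq (.dsErase 23 20) (.store 3 20 5)))) .skip)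

/-- Put the object in register 20 into the family in register 21. -/
def place : Prog :=
  .seq (.store 3 20 21) (.seq (.load 23 2 20) (.seq (.add 23 23 21) (.dsInsert 23 20)))

/-- Search `g` instances, from the one in register 27 on, with the object in register 25. -/
def findFrom : ℕ → Prog
  | 0 => .const 26 0
  | g + 1 => .seq (.dsFind 26 27 25) (.ite 5 26 .skip (.seq (.add 27 27 7) (findFrom g)))

/-- Search the family in register 24 with the object in register 25. -/
def findFam (G : ℕ) : Prog := .seq (.add 27 24 5) (findFrom G)

/-- The stored objects `ob` are kept apart from the accessible ones `objs`: when a deletion is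
processed, the object is already gone, but erasing it takes only its handle. -/
theorem vc_evict {ob objs : Store C} {E G n : ℕ} {ρ : ℕ → ℕ} {mem : ℕ → ℕ → ℕ} {S : ℕ → Store C}
    {Q : AState C → ℕ → Prop} (h : ℕ) (hc : Core ob E G n (mem 2) (mem 3) S) (h5 : ρ 5 = 0)
    (h20 : ρ 20 = h)
    (hQ : ∀ ρ' S' w, (∀ r < 22, ρ' r = ρ r) → w ≤ 6 →
      Core ob E G n (mem 2) (Function.update (mem 3) h 0) S' →
      Q ⟨ρ', Function.update mem 3 (Function.update (mem 3) h 0), S'⟩ w) :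
    vc objs n evict ⟨ρ, mem, S⟩ Q := by
  simp only [evict, vc]
  simp only [Function.update_self, ne_eq, Nat.reduceEqDiff, not_false_eq_true,
    Function.update_of_ne, h5, h20]
  refine ⟨fun hf => ?_, fun hf => ?_⟩
  · have he := hc.erase (h := h) (by omega)
    obtain ⟨j, hj, ho⟩ := hc.off_eq h (hc.present h (by omega))
    refine ⟨?_, ?_, hQ _ _ _ ?_ ?_ he⟩
    · simp only [DSOp.Legal]
      rw [hc.sync, if_pos ⟨by omega, rfl⟩]
      exact hc.present h (by omega)
    · have := he.size_le j (mem 3 h) (hc.fam_lt h)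
      rw [← ho] at this
      simpa [DSOp.act] using this
    · intro r hr
      rw [Function.update_of_ne, Function.update_of_ne, Function.update_of_ne] <;> omega
    · omega
  · have hf0 : mem 3 h = 0 := by omega
    -- Writing the value that is there already lets one postcondition serve both branches.
    have e : Function.update (mem 3) h 0 = mem 3 := by rw [← hf0]; simp
    rw [e] at hQ
    have e' : Function.update mem 3 (mem 3) = mem := by simp
    rw [e'] at hQ
    refine hQ _ _ _ ?_ (by omega) hc
    intro r hr
    rw [Function.update_of_ne]; omega

/-- An instance must not store the same object twice, whereas an object may be present in both sets
under different handles. `hnew` excludes this within the family. -/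
theorem vc_place {objs : Store C} {E G n : ℕ} {ρ : ℕ → ℕ} {mem : ℕ → ℕ → ℕ} {S : ℕ → Store C}
    {Q : AState C → ℕ → Prop} (h l : ℕ) (x : C) (hc : Core objs E G n (mem 2) (mem 3) S)
    (h20 : ρ 20 = h) (h21 : ρ 21 = l) (hx : objs h = some x) (hf : mem 3 h = 0)
    (hl : l < E + 3) (hl0 : l ≠ 0) (hnew : ∀ g, mem 3 g = l → objs g ≠ some x)
    (hQ : ∀ ρ' S' w, (∀ r < 22, ρ' r = ρ r) → w ≤ 6 →
      Core objs E G n (mem 2) (Function.update (mem 3) h l) S' →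
      Q ⟨ρ', Function.update mem 3 (Function.update (mem 3) h l), S'⟩ w) :
    vc objs n place ⟨ρ, mem, S⟩ Q := by
  simp only [place, vc]
  simp only [Function.update_self, ne_eq, Nat.reduceEqDiff, not_false_eq_true,
    Function.update_of_ne, h20, h21]
  have he := hc.insert hf hx hl hl0
  obtain ⟨j, hj, ho⟩ := hc.off_eq h (by simp [hx])
  refine ⟨x, hx, ⟨?_, ?_⟩, ?_, hQ _ _ _ ?_ ?_ he⟩
  · rw [hc.sync, if_neg (by simp [hf])]
  · intro g hg
    rw [ho] at hg
    obtain ⟨-, h2, h3⟩ := hc.mem_inst hl hg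
    exact hnew g h2 h3
  · have := he.size_le j l hl
    rw [← ho] at this
    simpa [DSOp.act] using this
  · intro r hr
    rw [Function.update_of_ne, Function.update_of_ne] <;> omega
  · omega

/-- Induction on the number `d` of parts that are left; the first `j` are known to contain no
answer. Every object lies in one of the `G` parts, so failure in all of them is conclusive. -/
theorem vc_findFrom {objs : Store C} {E G n : ℕ} {mem : ℕ → ℕ → ℕ} {S : ℕ → Store C}
    (h l : ℕ) (x : C) (hc : Core objs E G n (mem 2) (mem 3) S)
    (hx : objs h = some x) (hl : l < E + 3) (hl0 : l ≠ 0) (d : ℕ) :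
    ∀ (j : ℕ) (ρ : ℕ → ℕ) (Q : AState C → ℕ → Prop), j + d = G → ρ 5 = 0 → ρ 7 = E + 3 →
    ρ 25 = h → ρ 27 = j * (E + 3) + l →
    (∀ g, mem 3 g = l → ∀ y, objs g = some y → (∃ i < j, mem 2 g = i * (E + 3)) → ¬ Meets x y) →
    (∀ ρ' w, (∀ r < 26, ρ' r = ρ r) → w ≤ 4 * d + 1 →
      (ρ' 26 = 0 → ∀ g, mem 3 g = l → ∀ y, objs g = some y → ¬ Meets x y) →
      (∀ g, ρ' 26 = g + 1 → mem 3 g = l ∧ ∃ y, objs g = some y ∧ Meets x y) →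
      Q ⟨ρ', mem, S⟩ w) →
    vc objs n (findFrom d) ⟨ρ, mem, S⟩ Q := by
  induction d with
  | zero =>
    intro j ρ Q hj h5 h7 h25 h27 hnone hQ
    simp only [findFrom, vc]
    refine hQ _ _ (fun r hr => by rw [Function.update_of_ne]; omega) (by omega) ?_ (by simp)
    intro _ g hg y hy
    obtain ⟨i, hi, ho⟩ := hc.off_eq g (by simp [hy])
    exact hnone g hg y hy ⟨i, by omega, ho⟩
  | succ d ih =>
    intro j ρ Q hj h5 h7 h25 h27 hnone hQ
    simp only [findFrom, vc]
    rw [h25, h27]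
    refine ⟨x, hx, hc.size_le j l hl, fun z hz0 hz1 => ⟨fun hp => ?_, fun hp => ?_⟩⟩
    · refine hQ _ _ (fun r hr => by rw [Function.update_of_ne]; omega) (by omega) ?_ ?_
      · simp only [Function.update_self, ne_eq, Nat.reduceEqDiff, not_false_eq_true,
          Function.update_of_ne, h5] at hp ⊢
        omega
      · simp only [Function.update_self]
        intro g hg
        obtain ⟨y, hy, hm⟩ := hz1 g hg
        obtain ⟨-, h2, h3⟩ := hc.mem_inst hl hy
        exact ⟨h2, y, h3, hm⟩
    · simp only [Function.update_self, ne_eq, Nat.reduceEqDiff, not_false_eq_true,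
          Function.update_of_ne, h5] at hp
      have hz : z = 0 := by omega
      refine ih (j + 1) _ _ (by omega) ?_ ?_ ?_ ?_ ?_ ?_
      · simp [h5]
      · simp [h7]
      · simp [h25]
      · simp [h7, h27]; ring
      · rintro g hg y hy ⟨i, hi, ho⟩
        by_cases hij : i = j
        · subst hij
          refine hz0 hz g y ?_
          rw [hc.sync, if_pos ⟨by omega, by rw [ho, hg]⟩, hy]
        · exact hnone g hg y hy ⟨i, by omega, ho⟩
      · intro ρ' w hρ hw h1 h2
        refine hQ ρ' _ (fun r hr => ?_) (by omega) h1 h2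
        rw [hρ r hr, Function.update_of_ne, Function.update_of_ne] <;> omega

theorem vc_findFam {objs : Store C} {E G n : ℕ} {ρ : ℕ → ℕ} {mem : ℕ → ℕ → ℕ} {S : ℕ → Store C}
    {Q : AState C → ℕ → Prop} (h l : ℕ) (x : C) (hc : Core objs E G n (mem 2) (mem 3) S)
    (h5 : ρ 5 = 0) (h7 : ρ 7 = E + 3) (h24 : ρ 24 = l) (h25 : ρ 25 = h)
    (hx : objs h = some x) (hl : l < E + 3) (hl0 : l ≠ 0)
    (hQ : ∀ ρ' w, (∀ r < 26, ρ' r = ρ r) → w ≤ 4 * G + 2 →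
      (ρ' 26 = 0 → ∀ g, mem 3 g = l → ∀ y, objs g = some y → ¬ Meets x y) →
      (∀ g, ρ' 26 = g + 1 → mem 3 g = l ∧ ∃ y, objs g = some y ∧ Meets x y) →
      Q ⟨ρ', mem, S⟩ w) :
    vc objs n (findFam G) ⟨ρ, mem, S⟩ Q := by
  simp only [findFam, vc]
  refine vc_findFrom h l x hc hx hl hl0 G 0 _ _ (by simp) (by simp [h5]) (by simp [h7])
    (by simp [h25]) (by simp [h24, h5]) (by simp) ?_
  intro ρ' w hρ hw h1 h2
  refine hQ ρ' _ (fun r hr => ?_) (by omega) h1 h2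
  rw [hρ r hr, Function.update_of_ne]; omega

end

/-! ### Matchings, stored by partners, and the auction invariant -/

section
variable {X : Type u} {C : Set (Set X)}

/-- `s` is a matching of the intersection graph, as a set of pairs whose second entry belongs to the
second set. -/
def IsPairing (V : TwoSets C) (s : Finset (ℕ × ℕ)) : Prop :=
  (∀ e ∈ s, (bipGraph V).Adj e.1 e.2 ∧ ∃ x, V e.2 = some (true, x)) ∧
  (∀ e ∈ s, ∀ e' ∈ s, e.1 = e'.1 → e = e') ∧ ∀ e ∈ s, ∀ e' ∈ s, e.2 = e'.2 → e = e'

/-- No matching has more than `K` edges. -/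
def OptLe (V : TwoSets C) (K : ℕ) : Prop := ∀ s, IsPairing V s → s.card ≤ K

/-- The matched objects of the second set. -/
def matchedItems (V : TwoSets C) (mate : ℕ → ℕ) : Set ℕ :=
  {b | (∃ x, V b = some (true, x)) ∧ mate b ≠ 0}

theorem bipGraph_adj_iff {V : TwoSets C} {h g : ℕ} {s : Bool} {x : C} (hx : V h = some (s, x)) :
    (bipGraph V).Adj h g ↔ ∃ y, V g = some (!s, y) ∧ Meets x y := by
  constructor
  · rintro ⟨s', x', y, h1, h2, h3⟩
    rw [hx] at h1
    cases h1
    exact ⟨y, h2, h3⟩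
  · rintro ⟨y, h1, h2⟩
    exact ⟨s, x, y, hx, h1, h2⟩

theorem bipGraph_adj_left {V : TwoSets C} {a b : ℕ} {y : C} (h : (bipGraph V).Adj a b)
    (hb : V b = some (true, y)) : ∃ x, V a = some (false, x) := by
  obtain ⟨s, x, y', h1, h2, -⟩ := h
  rw [hb] at h2
  cases s <;> simp_all

theorem bipGraph_adj_right {V : TwoSets C} {a b : ℕ} {x : C} (h : (bipGraph V).Adj a b)
    (ha : V a = some (false, x)) : ∃ y, V b = some (true, y) := by
  obtain ⟨s, x', y', h1, h2, -⟩ := h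
  rw [ha] at h1
  cases s <;> simp_all

theorem bipGraph_adj_update {V : TwoSets C} {h u w : ℕ} {o : Option (Bool × C)} (hu : u ≠ h)
    (hw : w ≠ h) : (bipGraph (Function.update V h o)).Adj u w ↔ (bipGraph V).Adj u w := by
  simp [bipGraph, hu, hw]

/-- `mate` describes a matching, which is maximal up to edges at the object `h` with `cur = h + 1`,
and `fam` assigns family `1` to the other free objects of the first set, `2` to those of the second,
and a family from `3` on only to matched objects of the second set. -/
structure Inv (V : TwoSets C) (mate side fam : ℕ → ℕ) (cur : ℕ) : Prop where
  side_eq : ∀ h s x, V h = some (s, x) → side h = if s then 2 else 1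
  mate_symm : ∀ h g, mate h = g + 1 → mate g = h + 1
  mate_adj : ∀ h g, mate h = g + 1 → (bipGraph V).Adj h g
  cur_spec : ∀ h, cur = h + 1 → V h ≠ none ∧ mate h = 0 ∧ fam h = 0
  free : ∀ h s x, V h = some (s, x) → mate h = 0 → h + 1 ≠ cur → fam h = if s then 2 else 1
  matched : ∀ h s x, V h = some (s, x) → mate h ≠ 0 → fam h = 0 ∨ (s = true ∧ 3 ≤ fam h)
  maximal : ∀ h g, (bipGraph V).Adj h g → mate h = 0 → mate g = 0 → h + 1 = cur ∨ g + 1 = cur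

theorem Inv.present {V : TwoSets C} {mate side fam : ℕ → ℕ} {cur : ℕ}
    (hi : Inv V mate side fam cur) {h : ℕ} (hm : mate h ≠ 0) : V h ≠ none := by
  obtain ⟨g, hg⟩ := Nat.exists_eq_succ_of_ne_zero hm
  obtain ⟨s, x, y, h1, -⟩ := hi.mate_adj h g hg
  simp [h1]

theorem Inv.of_fam {V : TwoSets C} {mate side fam : ℕ → ℕ} {cur : ℕ}
    (hi : Inv V mate side fam cur) {h : ℕ} (hf : fam h ≠ 0) (hp : V h ≠ none) :
    (fam h = 1 ∧ mate h = 0 ∧ ∃ x, V h = some (false, x)) ∨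
    (fam h = 2 ∧ mate h = 0 ∧ ∃ x, V h = some (true, x)) ∨
    (3 ≤ fam h ∧ mate h ≠ 0 ∧ ∃ x, V h = some (true, x)) := by
  obtain ⟨⟨s, x⟩, hx⟩ := Option.ne_none_iff_exists'.1 hp
  by_cases hm : mate h = 0
  · have hc : h + 1 ≠ cur := fun hc => hf (hi.cur_spec h hc.symm).2.2
    have := hi.free h s x hx hm hc
    cases s <;> simp_all
  · rcases hi.matched h s x hx hm with h1 | ⟨rfl, h2⟩
    · exact absurd h1 hf
    · exact .inr (.inr ⟨h2, hm, x, hx⟩)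

/-- This covers both the linking of free objects and the displacement of a former partner of `g`. As
partners are stored with offset one, `mate g` encodes the new exceptional object, or none. Only a
displaced partner becomes free, so maximality can fail only there. -/
theorem Inv.assign {V : TwoSets C} {mate side fam mate' fam' : ℕ → ℕ} {h g l : ℕ}
    (hi : Inv V mate side fam (h + 1)) (hadj : (bipGraph V).Adj h g)
    (hp : ∀ p, mate g = p + 1 → fam p = 0)
    (hl : l = 0 ∨ 3 ≤ l ∧ ∃ y, V g = some (true, y))
    (mh : mate' h = g + 1) (mg : mate' g = h + 1) (mp : ∀ p, mate g = p + 1 → mate' p = 0)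
    (mo : ∀ u, u ≠ h → u ≠ g → mate g ≠ u + 1 → mate' u = mate u)
    (fg : fam' g = l) (fo : ∀ u, u ≠ g → fam' u = fam u) :
    Inv V mate' side fam' (mate g) := by
  obtain ⟨hV, hm0, hf0⟩ := hi.cur_spec h rfl
  have hne : h ≠ g := hadj.ne
  -- A new pair that starts outside `h` and `g` is an old pair that avoids `h`, `g` and the former
  -- partner of `g`.
  have key : ∀ u w, u ≠ h → u ≠ g → mate' u = w + 1 → mate g ≠ u + 1 ∧ mate u = w + 1 ∧ w ≠ h ∧
      w ≠ g ∧ mate g ≠ w + 1 := by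
    intro u w h1 h2 h3
    have h4 : mate g ≠ u + 1 := fun h4 => by rw [mp u h4] at h3; omega
    rw [mo u h1 h2 h4] at h3
    have h5 := hi.mate_symm u w h3
    refine ⟨h4, h3, ?_, ?_, ?_⟩
    · rintro rfl; omega
    · rintro rfl; omega
    · intro h6
      have := hi.mate_symm g w h6
      omega
  refine ⟨hi.side_eq, ?_, ?_, ?_, ?_, ?_, ?_⟩
  · intro u w hu
    by_cases h1 : u = h
    · subst h1; have : w = g := by omega
      rw [this, mg]
    by_cases h2 : u = g
    · subst h2; have : w = h := by omega
      rw [this, mh]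
    obtain ⟨-, k2, k3, k4, k5⟩ := key u w h1 h2 hu
    rw [mo w k3 k4 k5]
    exact hi.mate_symm u w k2
  · intro u w hu
    by_cases h1 : u = h
    · subst h1; have : w = g := by omega
      rwa [this]
    by_cases h2 : u = g
    · subst h2; have : w = h := by omega
      rw [this]; exact hadj.symm
    exact hi.mate_adj u w (key u w h1 h2 hu).2.1
  · intro p hpp
    have hpm := hi.mate_symm g p hpp
    have hpg : p ≠ g := (hi.mate_adj g p hpp).ne'
    exact ⟨hi.present (by omega), mp p hpp, by rw [fo p hpg]; exact hp p hpp⟩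
  · intro u s x hu hmu hc
    have h1 : u ≠ h := by rintro rfl; omega
    have h2 : u ≠ g := by rintro rfl; omega
    rw [mo u h1 h2 hc.symm] at hmu
    rw [fo u h2]
    exact hi.free u s x hu hmu (by omega)
  · intro u s x hu hmu
    by_cases h2 : u = g
    · subst h2
      rw [fg]
      rcases hl with hl | ⟨hl, y, hy⟩
      · exact .inl hl
      · rw [hy] at hu; cases hu; exact .inr ⟨rfl, hl⟩
    rw [fo u h2]
    by_cases h1 : u = h
    · subst h1; exact .inl hf0
    obtain ⟨w, hw⟩ := Nat.exists_eq_succ_of_ne_zero hmu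
    exact hi.matched u s x hu (by rw [(key u w h1 h2 hw).2.1]; omega)
  · intro u w huw hu hw
    have h1 : u ≠ h := by rintro rfl; omega
    have h2 : u ≠ g := by rintro rfl; omega
    have h3 : w ≠ h := by rintro rfl; omega
    have h4 : w ≠ g := by rintro rfl; omega
    by_contra hcon
    push Not at hcon
    rw [mo u h1 h2 hcon.1.symm] at hu
    rw [mo w h3 h4 hcon.2.symm] at hw
    have := hi.maximal u w huw hu hw
    omega

/-- All neighbours of `h` are matched, so `h` needs no exemption from maximality any more. -/
theorem Inv.release {V : TwoSets C} {mate side fam fam' : ℕ → ℕ} {h : ℕ} {s : Bool} {x : C}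
    (hi : Inv V mate side fam (h + 1)) (hx : V h = some (s, x))
    (hno : ∀ g, (bipGraph V).Adj h g → mate g ≠ 0)
    (fh : fam' h = if s then 2 else 1) (fo : ∀ u, u ≠ h → fam' u = fam u) :
    Inv V mate side fam' 0 := by
  obtain ⟨-, hm0, hf0⟩ := hi.cur_spec h rfl
  refine ⟨hi.side_eq, hi.mate_symm, hi.mate_adj, by simp, ?_, ?_, ?_⟩
  · intro u s' x' hu hm _
    by_cases h1 : u = h
    · subst h1; rw [hx] at hu; cases hu; exact fh
    · rw [fo u h1]; exact hi.free u s' x' hu hm (by omega)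
  · intro u s' x' hu hm
    have h1 : u ≠ h := by rintro rfl; omega
    rw [fo u h1]; exact hi.matched u s' x' hu hm
  · intro u w huw hu hw
    rcases hi.maximal u w huw hu hw with h1 | h1
    · obtain rfl : u = h := by omega
      exact absurd hw (hno w huw)
    · obtain rfl : w = h := by omega
      exact absurd hu (hno u huw.symm)

theorem Inv.take {V : TwoSets C} {mate side fam fam' : ℕ → ℕ} {h : ℕ}
    (hi : Inv V mate side fam 0) (hV : V h ≠ none) (hm : mate h = 0)
    (fh : fam' h = 0) (fo : ∀ u, u ≠ h → fam' u = fam u) :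
    Inv V mate side fam' (h + 1) := by
  refine ⟨hi.side_eq, hi.mate_symm, hi.mate_adj, ?_, ?_, ?_, ?_⟩
  · intro u hu
    obtain rfl : h = u := by omega
    exact ⟨hV, hm, fh⟩
  · intro u s' x' hu hm hc
    rw [fo u (by omega)]; exact hi.free u s' x' hu hm (by omega)
  · intro u s' x' hu hm'
    have h1 : u ≠ h := by rintro rfl; omega
    rw [fo u h1]; exact hi.matched u s' x' hu hm'
  · intro u w huw hu hw
    have := hi.maximal u w huw hu hw
    omega

theorem Inv.insert {V : TwoSets C} {mate side side' fam : ℕ → ℕ} {h : ℕ} {s : Bool} {x : C}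
    (hi : Inv V mate side fam 0) (hV : V h = none) (hf : fam h = 0)
    (sh : side' h = if s then 2 else 1) (so : ∀ u, u ≠ h → side' u = side u) :
    Inv (Function.update V h (some (s, x))) mate side' fam (h + 1) := by
  have hm : mate h = 0 := by
    by_contra hm
    exact hi.present hm hV
  refine ⟨?_, hi.mate_symm, ?_, ?_, ?_, ?_, ?_⟩
  · intro u s' x' hu
    by_cases h1 : u = h
    · subst h1; simp at hu; rw [sh, hu.1]
    · rw [so u h1]; exact hi.side_eq u s' x' (by simpa [h1] using hu)
  · intro u w hu
    have hw := hi.mate_symm u w hu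
    have h1 : u ≠ h := by rintro rfl; omega
    have h2 : w ≠ h := by rintro rfl; omega
    exact (bipGraph_adj_update h1 h2).2 (hi.mate_adj u w hu)
  · intro u hu
    obtain rfl : h = u := by omega
    simp [hm, hf]
  · intro u s' x' hu hmu hc
    have h1 : u ≠ h := by omega
    exact hi.free u s' x' (by simpa [h1] using hu) hmu (by omega)
  · intro u s' x' hu hmu
    have h1 : u ≠ h := by rintro rfl; omega
    exact hi.matched u s' x' (by simpa [h1] using hu) hmu
  · intro u w huw hu hw
    by_cases h1 : u = h
    · simp [h1]
    by_cases h2 : w = h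
    · simp [h2]
    have := hi.maximal u w ((bipGraph_adj_update h1 h2).1 huw) hu hw
    omega

/-- Only the partner of `h` can become free, and `mate h` encodes it as the exceptional object. By
`hn` it is in no family at that moment, as is required of the exceptional object. -/
theorem Inv.delete {V : TwoSets C} {mate mate' side fam fam' : ℕ → ℕ} {h : ℕ}
    (hi : Inv V mate side fam 0) (hn : ∀ u, mate u ≠ 0 → fam u = 0)
    (mh : mate' h = 0) (mp : ∀ p, mate h = p + 1 → mate' p = 0)
    (mo : ∀ u, u ≠ h → mate h ≠ u + 1 → mate' u = mate u)
    (fo : ∀ u, u ≠ h → fam' u = fam u) :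
    Inv (Function.update V h none) mate' side fam' (mate h) := by
  have key : ∀ u w, mate' u = w + 1 → u ≠ h ∧ mate h ≠ u + 1 ∧ mate u = w + 1 ∧ w ≠ h ∧
      mate h ≠ w + 1 := by
    intro u w h3
    have h1 : u ≠ h := by rintro rfl; omega
    have h4 : mate h ≠ u + 1 := fun h4 => by rw [mp u h4] at h3; omega
    rw [mo u h1 h4] at h3
    have h5 := hi.mate_symm u w h3
    refine ⟨h1, h4, h3, ?_, ?_⟩
    · rintro rfl; omega
    · intro h6
      have := hi.mate_symm h w h6
      omega
  refine ⟨?_, ?_, ?_, ?_, ?_, ?_, ?_⟩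
  · intro u s x hu
    have h1 : u ≠ h := by rintro rfl; simp at hu
    exact hi.side_eq u s x (by simpa [h1] using hu)
  · intro u w hu
    obtain ⟨-, -, k1, k2, k3⟩ := key u w hu
    rw [mo w k2 k3]
    exact hi.mate_symm u w k1
  · intro u w hu
    obtain ⟨k0, -, k1, k2, k3⟩ := key u w hu
    exact (bipGraph_adj_update k0 k2).2 (hi.mate_adj u w k1)
  · intro p hpp
    have hpm := hi.mate_symm h p hpp
    have hpg : p ≠ h := (hi.mate_adj h p hpp).ne'
    refine ⟨?_, mp p hpp, by rw [fo p hpg]; exact hn p (by omega)⟩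
    simpa [hpg] using hi.present (h := p) (by omega)
  · intro u s x hu hmu hc
    have h1 : u ≠ h := by rintro rfl; simp at hu
    rw [mo u h1 hc.symm] at hmu
    rw [fo u h1]
    exact hi.free u s x (by simpa [h1] using hu) hmu (by omega)
  · intro u s x hu hmu
    obtain ⟨w, hw⟩ := Nat.exists_eq_succ_of_ne_zero hmu
    obtain ⟨k0, -, k1, -⟩ := key u w hw
    rw [fo u k0]
    exact hi.matched u s x (by simpa [k0] using hu) (by omega)
  · intro u w huw hu hw
    have h1 : u ≠ h := by
      rintro rfl; obtain ⟨s, x, y, h1, -⟩ := huw; simp at h1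
    have h2 : w ≠ h := by
      rintro rfl; obtain ⟨s, x, y, -, h1, -⟩ := huw; simp at h1
    by_contra hcon
    push Not at hcon
    rw [mo u h1 hcon.1.symm] at hu
    rw [mo w h2 hcon.2.symm] at hw
    have := hi.maximal u w ((bipGraph_adj_update h1 h2).1 huw) hu hw
    omega

/-- Prices of matched items can be set and removed freely: maximality does not refer to them. -/
theorem Inv.mono_fam {V : TwoSets C} {mate side fam fam' : ℕ → ℕ}
    (hi : Inv V mate side fam 0)
    (hf : ∀ u, fam' u = fam u ∨ mate u ≠ 0 ∧ (fam' u = 0 ∨ 3 ≤ fam' u ∧ ∃ x, V u = some (true, x))) :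
    Inv V mate side fam' 0 := by
  refine ⟨hi.side_eq, hi.mate_symm, hi.mate_adj, by simp, ?_, ?_, hi.maximal⟩
  · intro u s x hu hm hc
    rcases hf u with h1 | ⟨h1, -⟩
    · rw [h1]; exact hi.free u s x hu hm hc
    · exact absurd hm h1
  · intro u s x hu hm
    rcases hf u with h1 | ⟨-, h1 | ⟨h1, y, hy⟩⟩
    · rw [h1]; exact hi.matched u s x hu hm
    · exact .inl h1
    · rw [hy] at hu; cases hu; exact .inr ⟨rfl, h1⟩

/-- Weak duality. -/
theorem IsPairing.mul_card_le {V : TwoSets C} {s : Finset (ℕ × ℕ)} (hs : IsPairing V s)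
    (T len : ℕ) (A B u p : ℕ → ℕ)
    (hcov : ∀ a b, (bipGraph V).Adj a b → (∃ y, V b = some (true, y)) → T ≤ u a + p b)
    (hu : ∀ a, u a ≠ 0 → ∃ k < len, A k = a) (hp : ∀ b, p b ≠ 0 → ∃ k < len, B k = b) :
    T * s.card ≤ ∑ k ∈ Finset.range len, (u (A k) + p (B k)) := by
  -- Each vertex is met by at most one pair, and vertices of nonzero value occur in the list `A`;
  -- repetitions there only enlarge the right side.
  have aux : ∀ (f : ℕ × ℕ → ℕ) (u A : ℕ → ℕ), (∀ e ∈ s, ∀ e' ∈ s, f e = f e' → e = e') →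
      (∀ a, u a ≠ 0 → ∃ k < len, A k = a) →
      ∑ e ∈ s, u (f e) ≤ ∑ k ∈ Finset.range len, u (A k) := by
    intro f u A hf hA
    calc ∑ e ∈ s, u (f e) = ∑ a ∈ s.image f, u a :=
          (Finset.sum_image (fun e he e' he' => hf e he e' he')).symm
      _ ≤ ∑ a ∈ (Finset.range len).image A, u a := by
          refine Finset.sum_le_sum_of_ne_zero fun a _ ha => ?_
          obtain ⟨k, hk, rfl⟩ := hA a ha
          exact Finset.mem_image_of_mem _ (Finset.mem_range.2 hk)
      _ ≤ _ := Finset.sum_image_le_of_nonneg (fun _ _ => Nat.zero_le _)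
  rw [Finset.sum_add_distrib]
  calc T * s.card = ∑ e ∈ s, T := by simp [mul_comm]
    _ ≤ ∑ e ∈ s, (u e.1 + p e.2) :=
        Finset.sum_le_sum fun e he => hcov _ _ (hs.1 e he).1 (hs.1 e he).2
    _ ≤ _ := by
        rw [Finset.sum_add_distrib]
        exact add_le_add (aux _ u A hs.2.1 hu) (aux _ p B hs.2.2 hp)

/-- The update affects only pairs that contain `h`, and a matching has at most one of those. -/
theorem OptLe.update {V : TwoSets C} {K : ℕ} (hK : OptLe V K) (h : ℕ)
    (o : Option (Bool × C)) : OptLe (Function.update V h o) (K + 1) := by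
  intro s hs
  set f : Finset (ℕ × ℕ) := s.filter fun e => e.1 ≠ h ∧ e.2 ≠ h with hf
  have h1 : f.card ≤ K := by
    refine hK f ⟨fun e he => ?_, fun e he e' he' => ?_, fun e he e' he' => ?_⟩
    · obtain ⟨he, h1, h2⟩ := Finset.mem_filter.1 he
      obtain ⟨h3, h4⟩ := hs.1 e he
      exact ⟨(bipGraph_adj_update h1 h2).1 h3, by simpa [h2] using h4⟩
    · exact hs.2.1 e (Finset.mem_filter.1 he).1 e' (Finset.mem_filter.1 he').1
    · exact hs.2.2 e (Finset.mem_filter.1 he).1 e' (Finset.mem_filter.1 he').1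
  have h2 : (s.filter fun e => ¬ (e.1 ≠ h ∧ e.2 ≠ h)).card ≤ 1 := by
    rw [Finset.card_le_one]
    -- The two entries of a pair belong to different sets, so `h` cannot be the first entry of one
    -- pair and the second of another.
    have side : ∀ e ∈ s, ¬ ∃ e' ∈ s, e.1 = e'.2 := by
      rintro e he ⟨e', he', h1⟩
      obtain ⟨h3, y, hy⟩ := hs.1 e he
      obtain ⟨x, hx⟩ := bipGraph_adj_left h3 hy
      obtain ⟨-, y', hy'⟩ := hs.1 e' he'
      rw [h1, hy'] at hx
      simp at hx
    intro e he e' he'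
    simp only [Finset.mem_filter] at he he'
    have k1 := side e he.1
    have k2 := side e' he'.1
    push Not at k1 k2
    have k3 := k1 e' he'.1
    have k4 := k2 e he.1
    by_cases c1 : e.1 = h <;> by_cases c2 : e'.1 = h
    · exact hs.2.1 e he.1 e' he'.1 (by omega)
    · exact absurd (by by_contra c3; exact he'.2 ⟨c2, by omega⟩) (not_false)
    · exact absurd (by by_contra c3; exact he.2 ⟨c1, by omega⟩) (not_false)
    · refine hs.2.2 e he.1 e' he'.1 ?_
      by_contra c3
      by_cases c4 : e.2 = h
      · exact he'.2 ⟨c2, by omega⟩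
      · exact he.2 ⟨c1, c4⟩
  have h3 : f.card + (s.filter fun e => ¬ (e.1 ≠ h ∧ e.2 ≠ h)).card = s.card := by
    convert Finset.card_filter_add_card_filter_not (s := s) (fun e : ℕ × ℕ => e.1 ≠ h ∧ e.2 ≠ h)
  omega

/-- The list `L` of length `len` holds exactly the matched objects of the second set. -/
structure ListsItems (V : TwoSets C) (mate L : ℕ → ℕ) (len : ℕ) : Prop where
  mem : ∀ k < len, L k ∈ matchedItems V mate
  inj : ∀ k < len, ∀ k' < len, L k = L k' → k = k'
  all : ∀ b ∈ matchedItems V mate, ∃ k < len, L k = b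

theorem ListsItems.ncard_eq {V : TwoSets C} {mate L : ℕ → ℕ} {len : ℕ}
    (hl : ListsItems V mate L len) : (matchedItems V mate).ncard = len := by
  have : matchedItems V mate = ((Finset.range len).image L : Finset ℕ) := by
    ext b
    simp only [Finset.coe_image, Finset.coe_range, Set.mem_image, Set.mem_Iio]
    exact ⟨hl.all b, by rintro ⟨k, hk, rfl⟩; exact hl.mem k hk⟩
  rw [this, Set.ncard_coe_finset, Finset.card_image_of_injOn, Finset.card_range]
  intro k hk k' hk'
  simp only [Finset.coe_range, Set.mem_Iio] at hk hk'
  exact hl.inj k hk k' hk'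

/-- The listed items together with their partners form a matching. -/
theorem ListsItems.le_opt {V : TwoSets C} {mate side fam L : ℕ → ℕ} {len cur K : ℕ}
    (hl : ListsItems V mate L len) (hi : Inv V mate side fam cur) (hK : OptLe V K) : len ≤ K := by
  have key : ∀ k < len, ∃ a, mate (L k) = a + 1 := fun k hk =>
    Nat.exists_eq_succ_of_ne_zero (hl.mem k hk).2
  have h := hK ((Finset.range len).image fun k => (mate (L k) - 1, L k)) ⟨?_, ?_, ?_⟩
  · rwa [Finset.card_image_of_injOn, Finset.card_range] at h
    intro k hk k' hk' h
    simp only [Finset.coe_range, Set.mem_Iio] at hk hk'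
    exact hl.inj k hk k' hk' (by simpa using congrArg Prod.snd h)
  · intro e he
    simp only [Finset.mem_image, Finset.mem_range] at he
    obtain ⟨k, hk, rfl⟩ := he
    obtain ⟨a, ha⟩ := key k hk
    exact ⟨by simpa [ha] using (hi.mate_adj _ _ ha).symm, (hl.mem k hk).1⟩
  · intro e he e' he'
    simp only [Finset.mem_image, Finset.mem_range] at he he'
    obtain ⟨k, hk, rfl⟩ := he
    obtain ⟨k', hk', rfl⟩ := he'
    obtain ⟨a, ha⟩ := key k hk
    obtain ⟨a', ha'⟩ := key k' hk'
    intro h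
    have h3 : a = a' := by simpa [ha, ha'] using h
    subst h3
    have h1 := hi.mate_symm _ _ ha
    have h2 := hi.mate_symm _ _ ha'
    have h4 : L k = L k' := by omega
    rw [h4]
  · intro e he e' he'
    simp only [Finset.mem_image, Finset.mem_range] at he he'
    obtain ⟨k, hk, rfl⟩ := he
    obtain ⟨k', hk', rfl⟩ := he'
    intro h
    simp only at h
    rw [h]

/-- The invariant of the auction: `cur - 1` is the bidder whose turn it is, and the first `i` items
of the list are through. -/
structure Auction (V : TwoSets C) (E : ℕ) (mate side fam L : ℕ → ℕ) (len i cur : ℕ) : Prop where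
  inv : Inv V mate side fam cur
  curA : ∀ h, cur = h + 1 → ∃ x, V h = some (false, x)
  cur_lt : cur ≠ 0 → i < len
  le_len : i ≤ len
  fam_le : ∀ h, fam h ≤ E + 2
  item : ∀ b ∈ matchedItems V mate, 3 ≤ fam b
  cs : ∀ a b x, mate a = b + 1 → V a = some (false, x) → ∀ b', (bipGraph V).Adj a b' →
    fam b ≤ fam b' + 1
  done : ∀ k < i, ∀ a, (bipGraph V).Adj a (L k) → fam a = 1 → E + 2 ≤ fam (L k)
  list : ListsItems V mate L len

/-- The total price increase. -/
def raised (fam L : ℕ → ℕ) (len : ℕ) : ℕ := ∑ k ∈ Finset.range len, (fam (L k) - 2)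

/-- No price exceeds `E`, and at most `K` items are listed. As successful bids raise this sum, their
number is bounded as well. -/
theorem Auction.raised_le {V : TwoSets C} {E : ℕ} {mate side fam L : ℕ → ℕ} {len i cur K : ℕ}
    (h : Auction V E mate side fam L len i cur) (hK : OptLe V K) :
    raised fam L len ≤ E * K := by
  have h1 : raised fam L len ≤ ∑ k ∈ Finset.range len, E :=
    Finset.sum_le_sum fun k _ => by have := h.fam_le (L k); omega
  have h2 := h.list.le_opt h.inv hK
  calc _ ≤ _ := h1
    _ = E * len := by simp [mul_comm]
    _ ≤ E * K := Nat.mul_le_mul_left _ h2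

theorem Auction.fam_item {V : TwoSets C} {E : ℕ} {mate side fam L : ℕ → ℕ} {len i cur : ℕ}
    (h : Auction V E mate side fam L len i cur) {b : ℕ} {y : C} (hb : V b = some (true, y)) :
    2 ≤ fam b := by
  by_cases hm : mate b = 0
  · have hc : b + 1 ≠ cur := by
      intro hc
      obtain ⟨x, hx⟩ := h.curA b hc.symm
      simp [hb] at hx
    have := h.inv.free b true y hb hm hc
    simp at this; omega
  · have := h.item b ⟨⟨y, hb⟩, hm⟩
    omega

/-- The dual solution consists of the prices `fam b - 2` and the values `E + 3 - fam b` of the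
bidders matched to `b`, so that a matched pair has sum `E + 1`. An edge at a matched bidder is
covered by `E` because of `cs`. At a free bidder, maximality makes the item matched, hence listed,
and `done` gives it price `E`. -/
theorem Auction.opt {V : TwoSets C} {E : ℕ} {mate side fam L : ℕ → ℕ} {len : ℕ}
    (h : Auction V E mate side fam L len len 0) {s : Finset (ℕ × ℕ)} (hs : IsPairing V s) :
    E * s.card ≤ (E + 1) * len := by
  classical
  have := hs.mul_card_le E len (fun k => mate (L k) - 1) L
    (fun a => if mate a ≠ 0 ∧ (∃ x, V a = some (false, x)) then E + 3 - fam (mate a - 1) else 0)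
    (fun b => if b ∈ matchedItems V mate then fam b - 2 else 0) ?_ ?_ ?_
  · refine this.trans (le_of_eq ?_)
    rw [Finset.sum_congr rfl (g := fun _ => E + 1), Finset.sum_const, Finset.card_range,
      smul_eq_mul, mul_comm]
    intro k hk
    have hk := h.list.mem k (Finset.mem_range.1 hk)
    obtain ⟨⟨y, hy⟩, hm⟩ := id hk
    obtain ⟨a, ha⟩ := Nat.exists_eq_succ_of_ne_zero hm
    have ha' := h.inv.mate_symm _ _ ha
    obtain ⟨x, hx⟩ := bipGraph_adj_left (h.inv.mate_adj _ _ ha).symm hy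
    have h1 := h.item _ hk
    have h2 := h.fam_le (L k)
    simp only [ha, Nat.succ_eq_add_one, Nat.add_sub_cancel]
    rw [if_pos ⟨by omega, x, hx⟩, if_pos hk, ha', Nat.add_sub_cancel]
    omega
  · rintro a b hadj ⟨y, hy⟩
    obtain ⟨x, hx⟩ := bipGraph_adj_left hadj hy
    have hp : (if b ∈ matchedItems V mate then fam b - 2 else 0) = fam b - 2 := by
      split_ifs with hb
      · rfl
      · have hm : mate b = 0 := by
          by_contra hm
          exact hb ⟨⟨y, hy⟩, hm⟩
        have := h.inv.free b true y hy hm (by omega)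
        simp [this]
    simp only [hp]
    have hb2 := h.fam_item hy
    by_cases hm : mate a = 0
    · have hfa := h.inv.free a false x hx hm (by omega)
      have hmb : mate b ≠ 0 := by
        intro hmb
        have := h.inv.maximal a b hadj hm hmb
        omega
      obtain ⟨k, hk, rfl⟩ := h.list.all b ⟨⟨y, hy⟩, hmb⟩
      have := h.done k hk a hadj (by simpa using hfa)
      omega
    · obtain ⟨b', hb'⟩ := Nat.exists_eq_succ_of_ne_zero hm
      have h1 := h.cs a b' x hb' hx b hadj
      rw [if_pos ⟨hm, x, hx⟩, hb', Nat.succ_sub_one]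
      omega
  · intro a ha
    split_ifs at ha with hc
    · obtain ⟨hm, x, hx⟩ := hc
      obtain ⟨b, hb⟩ := Nat.exists_eq_succ_of_ne_zero hm
      have hb' := h.inv.mate_symm _ _ hb
      obtain ⟨y, hy⟩ := bipGraph_adj_right (h.inv.mate_adj _ _ hb) hx
      obtain ⟨k, hk, rfl⟩ := h.list.all b ⟨⟨y, hy⟩, by omega⟩
      exact ⟨k, hk, by omega⟩
    · exact absurd rfl ha
  · intro b hb
    split_ifs at hb with hc
    · exact h.list.all b hc
    · exact absurd rfl hb

/-- An item that is through remains so: prices never fall during the auction, and a bidder returns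
to family `1` only if all items it meets have the maximal price (`Auction.giveUp`). -/
theorem Auction.advance {V : TwoSets C} {E : ℕ} {mate side fam L : ℕ → ℕ} {len i : ℕ}
    (h : Auction V E mate side fam L len i 0) (hi : i < len)
    (hd : E + 2 ≤ fam (L i) ∨ ∀ a, (bipGraph V).Adj a (L i) → fam a ≠ 1) :
    Auction V E mate side fam L len (i + 1) 0 := by
  refine ⟨h.inv, h.curA, by simp, hi, h.fam_le, h.item, h.cs, ?_, h.list⟩
  intro k hk a ha hf
  by_cases hki : k = i
  · subst hki
    rcases hd with hd | hd
    · exact hd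
    · exact absurd hf (hd a ha)
  · exact h.done k (by omega) a ha hf

theorem Auction.take {V : TwoSets C} {E : ℕ} {mate side fam fam' L : ℕ → ℕ} {len i a : ℕ}
    (h : Auction V E mate side fam L len i 0) (hi : i < len) (hV : V a ≠ none) (hf : fam a = 1)
    (fh : fam' a = 0) (fo : ∀ u, u ≠ a → fam' u = fam u) :
    Auction V E mate side fam' L len i (a + 1) := by
  have := h.inv.of_fam (h := a) (by omega) hV
  obtain ⟨-, hm, x, hx⟩ : fam a = 1 ∧ mate a = 0 ∧ ∃ x, V a = some (false, x) := by
    rcases this with h | h | h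
    · exact h
    · omega
    · omega
  -- Only a bidder changes its family, so all prices stay as they are.
  have hB : ∀ b y, V b = some (true, y) → fam' b = fam b := by
    intro b y hb
    refine fo b ?_
    rintro rfl
    simp [hb] at hx
  refine ⟨h.inv.take hV hm fh fo, ?_, fun _ => hi, h.le_len, ?_, ?_, ?_, ?_, h.list⟩
  · intro u hu
    obtain rfl : a = u := by omega
    exact ⟨x, hx⟩
  · intro u
    by_cases hu : u = a
    · rw [hu, fh]; omega
    · rw [fo u hu]; exact h.fam_le u
  · intro b hb
    obtain ⟨⟨y, hy⟩, -⟩ := id hb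
    rw [hB b y hy]
    exact h.item b hb
  · intro a' b x' hm' hx' b' hb'
    obtain ⟨y, hy⟩ := bipGraph_adj_right (h.inv.mate_adj _ _ hm') hx'
    obtain ⟨y', hy'⟩ := bipGraph_adj_right hb' hx'
    rw [hB b y hy, hB b' y' hy']
    exact h.cs a' b x' hm' hx' b' hb'
  · intro k hk a' ha' hf'
    have ha'a : a' ≠ a := by rintro rfl; omega
    obtain ⟨⟨y, hy⟩, -⟩ := h.list.mem k (by have := h.le_len; omega)
    rw [hB _ y hy]
    rw [fo a' ha'a] at hf'
    exact h.done k hk a' ha' hf'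

/-- Free items have price 0. As `E` is positive, items of price `E` are matched, so the bidder can
be made free without violating maximality. -/
theorem Auction.giveUp {V : TwoSets C} {E : ℕ} {mate side fam fam' L : ℕ → ℕ} {len i a : ℕ}
    (h : Auction V E mate side fam L len i (a + 1))
    (hno : ∀ b, (bipGraph V).Adj a b → E + 2 ≤ fam b)
    (fh : fam' a = 1) (fo : ∀ u, u ≠ a → fam' u = fam u) (hE : 0 < E) :
    Auction V E mate side fam' L len i 0 := by
  obtain ⟨x, hx⟩ := h.curA a rfl
  have hB : ∀ b y, V b = some (true, y) → fam' b = fam b := by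
    intro b y hb
    refine fo b ?_
    rintro rfl
    simp [hb] at hx
  refine ⟨?_, by simp, by simp, h.le_len, ?_, ?_, ?_, ?_, h.list⟩
  · refine h.inv.release hx ?_ (by simpa using fh) fo
    intro b hb hm
    obtain ⟨y, hy⟩ := bipGraph_adj_right hb hx
    have h1 := hno b hb
    have h2 := h.inv.free b true y hy hm (by
      intro hc
      obtain rfl : b = a := by omega
      simp [hx] at hy)
    simp at h2
    omega
  · intro u
    by_cases hu : u = a
    · rw [hu, fh]; omega
    · rw [fo u hu]; exact h.fam_le u
  · intro b hb
    obtain ⟨⟨y, hy⟩, -⟩ := id hb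
    rw [hB b y hy]
    exact h.item b hb
  · intro a' b x' hm' hx' b' hb'
    obtain ⟨y, hy⟩ := bipGraph_adj_right (h.inv.mate_adj _ _ hm') hx'
    obtain ⟨y', hy'⟩ := bipGraph_adj_right hb' hx'
    rw [hB b y hy, hB b' y' hy']
    exact h.cs a' b x' hm' hx' b' hb'
  · intro k hk a' ha' hf'
    obtain ⟨⟨y, hy⟩, -⟩ := h.list.mem k (by have := h.le_len; omega)
    rw [hB _ y hy]
    by_cases ha'a : a' = a
    · subst ha'a
      exact hno _ ha'
    · rw [fo a' ha'a] at hf'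
      exact h.done k hk a' ha' hf'

/-- The item was a cheapest one, so after the raise it is at most one dearer than the alternatives,
which is `cs` for `a`. For other matched bidders the own price is unchanged, since the old partner
of `b` is displaced, and alternatives only get dearer. -/
theorem Auction.bid {V : TwoSets C} {E : ℕ} {mate mate' side fam fam' L L' : ℕ → ℕ}
    {len len' i a b : ℕ}
    (h : Auction V E mate side fam L len i (a + 1)) (hadj : (bipGraph V).Adj a b)
    (hlt : fam b < E + 2) (hmin : ∀ b', (bipGraph V).Adj a b' → fam b ≤ fam b')
    (mh : mate' a = b + 1) (mg : mate' b = a + 1) (mp : ∀ p, mate b = p + 1 → mate' p = 0)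
    (mo : ∀ u, u ≠ a → u ≠ b → mate b ≠ u + 1 → mate' u = mate u)
    (fg : fam' b = fam b + 1) (fo : ∀ u, u ≠ b → fam' u = fam u)
    (hL : mate b = 0 ∧ len' = len + 1 ∧ L' = Function.update L len b ∨
      mate b ≠ 0 ∧ len' = len ∧ L' = L) :
    Auction V E mate' side fam' L' len' i (mate b) ∧
      raised fam L len + 1 ≤ raised fam' L' len' := by
  obtain ⟨x, hx⟩ := h.curA a rfl
  obtain ⟨y, hy⟩ := bipGraph_adj_right hadj hx
  obtain ⟨-, hma, hfa⟩ := h.inv.cur_spec a rfl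
  have hb2 := h.fam_item hy
  have hlen := h.cur_lt (by omega)
  have hne : a ≠ b := hadj.ne
  have hAB : ∀ p z, mate b = p + 1 → V p ≠ some (true, z) := by
    intro p z hp hz
    obtain ⟨z', hz'⟩ := bipGraph_adj_left (h.inv.mate_adj _ _ hp).symm hy
    simp [hz] at hz'
  have hprev : ∀ p, mate b = p + 1 → ∃ z, V p = some (false, z) := fun p hp =>
    bipGraph_adj_left (h.inv.mate_adj _ _ hp).symm hy
  have hle : ∀ u, fam u ≤ fam' u := by
    intro u
    by_cases hu : u = b
    · rw [hu]; omega
    · rw [fo u hu]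
  have hinv : Inv V mate' side fam' (mate b) := by
    refine h.inv.assign hadj ?_ (.inr ⟨?_, y, hy⟩) mh mg mp mo fg fo
    · intro p hp
      have hm := h.inv.mate_symm b p hp
      obtain ⟨z, hz⟩ := hprev p hp
      rcases h.inv.matched p false z hz (by omega) with h1 | ⟨h1, -⟩
      · exact h1
      · simp at h1
    · omega
  have hitems : ∀ u, u ∈ matchedItems V mate' ↔ u ∈ matchedItems V mate ∨ u = b := by
    intro u
    simp only [matchedItems, Set.mem_ofPred_eq]
    by_cases hub : u = b
    · subst hub; simp [mg, hy]
    simp only [hub, or_false, and_congr_right_iff]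
    rintro ⟨z, hz⟩
    rw [mo u (by rintro rfl; simp [hx] at hz) hub (fun hp => hAB u z hp hz)]
  refine ⟨⟨hinv, hprev, ?_, ?_, ?_, ?_, ?_, ?_, ?_⟩, ?_⟩
  · intro _; omega
  · omega
  · intro u
    by_cases hu : u = b
    · rw [hu]; omega
    · rw [fo u hu]; exact h.fam_le u
  · intro u hu
    by_cases hub : u = b
    · rw [hub]; omega
    rw [fo u hub]
    exact h.item u (((hitems u).1 hu).resolve_right hub)
  · intro a' b₁ x' hm' hx' b' hb'
    by_cases ha' : a' = a
    · subst ha'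
      obtain rfl : b₁ = b := by omega
      have := hmin b' hb'
      have := hle b'
      omega
    have hab : a' ≠ b := by rintro rfl; simp [hy] at hx'
    have hpa : mate b ≠ a' + 1 := by
      intro hp; have := mp a' hp; omega
    rw [mo a' ha' hab hpa] at hm'
    have h1 := h.cs a' b₁ x' hm' hx' b' hb'
    have h2 := hle b'
    rw [fo b₁ (by
      rintro rfl
      exact hpa (h.inv.mate_symm _ _ hm'))]
    omega
  · intro k hk a' ha' hf'
    -- A newly matched item is appended at position `len`, behind all items that are through.
    have hLk : L' k = L k := by
      rcases hL with ⟨-, -, rfl⟩ | ⟨-, -, rfl⟩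
      · rw [Function.update_of_ne]; omega
      · rfl
    rw [hLk] at ha' ⊢
    rw [fo a' (by rintro rfl; omega)] at hf'
    exact (h.done k hk a' ha' hf').trans (hle _)
  · rcases hL with ⟨hm0, rfl, rfl⟩ | ⟨hm0, rfl, rfl⟩
    · have hbn : ∀ k < len, L k ≠ b := by
        rintro k hk rfl
        exact (h.list.mem k hk).2 hm0
      refine ⟨?_, ?_, ?_⟩
      · intro k hk
        rw [hitems]
        by_cases hkl : k = len
        · simp [hkl]
        · rw [Function.update_of_ne hkl]
          exact .inl (h.list.mem k (by omega))
      · intro k hk k' hk'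
        by_cases hkl : k = len <;> by_cases hkl' : k' = len
        · simp [hkl, hkl']
        · rw [hkl, Function.update_self, Function.update_of_ne hkl']
          intro he; exact absurd he.symm (hbn k' (by omega))
        · rw [hkl', Function.update_self, Function.update_of_ne hkl]
          intro he; exact absurd he (hbn k (by omega))
        · rw [Function.update_of_ne hkl, Function.update_of_ne hkl']
          exact h.list.inj k (by omega) k' (by omega)
      · intro u hu
        rcases (hitems u).1 hu with hu | rfl
        · obtain ⟨k, hk, hke⟩ := h.list.all u hu
          exact ⟨k, by omega, by rwa [Function.update_of_ne (by omega)]⟩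
        · exact ⟨len, by omega, by simp⟩
    · refine ⟨fun k hk => (hitems _).2 (.inl (h.list.mem k hk)), h.list.inj, fun u hu => ?_⟩
      rcases (hitems u).1 hu with hu | rfl
      · exact h.list.all u hu
      · exact h.list.all u ⟨⟨y, hy⟩, hm0⟩
  · rcases hL with ⟨hm0, rfl, rfl⟩ | ⟨hm0, rfl, rfl⟩
    · unfold raised
      rw [Finset.sum_range_succ, Function.update_self]
      refine add_le_add (Finset.sum_le_sum fun k hk => ?_) (by omega)
      rw [Function.update_of_ne (by have := Finset.mem_range.1 hk; omega)]
      have := hle (L k)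
      omega
    · obtain ⟨k, hk, hke⟩ := h.list.all b ⟨⟨y, hy⟩, hm0⟩
      refine Nat.succ_le_of_lt (Finset.sum_lt_sum (fun k _ => ?_) ⟨k, Finset.mem_range.2 hk, ?_⟩)
      · have := hle (L' k)
        omega
      · rw [hke]; omega

end

/-! ### Keeping the matching maximal -/

section
variable {X : Type u} {C : Set (Set X)}

/-- No object has two handles in the same set. -/
def Distinct (V : TwoSets C) : Prop := ∀ h g, V h = V g → V h ≠ none → h = g

theorem objs_of {V : TwoSets C} {h : ℕ} {s : Bool} {x : C} (hx : V h = some (s, x)) :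
    V.objs h = some x := by
  simp [TwoSets.objs, hx]

theorem objs_ne_none {V : TwoSets C} {h : ℕ} : V.objs h ≠ none ↔ V h ≠ none := by
  simp [TwoSets.objs]

theorem objs_update (V : TwoSets C) (h : ℕ) (o : Option (Bool × C)) :
    TwoSets.objs (Function.update V h o) = Function.update V.objs h (o.map Prod.snd) := by
  funext g
  by_cases hg : g = h
  · subst hg; simp [TwoSets.objs]
  · simp [TwoSets.objs, hg]

theorem Inv.of_fam_free {V : TwoSets C} {mate side fam : ℕ → ℕ} {cur g : ℕ}
    (hi : Inv V mate side fam cur) {s : Bool} {y : C} (hf : fam g = if s then 2 else 1)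
    (hy : V.objs g = some y) : mate g = 0 ∧ V g = some (s, y) := by
  have hgp : V g ≠ none := objs_ne_none.1 (by simp [hy])
  have hfam := hi.of_fam (h := g) (by rw [hf]; split_ifs <;> simp) hgp
  rcases hfam with ⟨h1, h2, z, hz⟩ | ⟨h1, h2, z, hz⟩ | ⟨h1, h2, z, hz⟩
  all_goals
    rw [objs_of hz] at hy
    cases hy
    cases s <;> simp_all

/-- The invariant outside of the auction, with arrays `0`: partners, `1`: sets, `2`: offsets,
`3`: families, `4`: numbers of objects by offset, `5`: a list of the objects that became matched. -/
structure Calm (V : TwoSets C) (E G n : ℕ) (mem : ℕ → ℕ → ℕ) (S : ℕ → Store C) (len cur : ℕ) :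
    Prop where
  core : Core V.objs E G n (mem 2) (mem 3) S
  inv : Inv V (mem 0) (mem 1) (mem 3) cur
  idle : ∀ u, mem 0 u ≠ 0 → mem 3 u = 0
  listed : ∀ b ∈ matchedItems V (mem 0), ∃ k < len, mem 5 k = b
  count : ∀ j < G, mem 4 (j * (E + 3)) = {h | V.objs h ≠ none ∧ mem 2 h = j * (E + 3)}.ncard

/-! ### Symbolic execution, with written values in simplified form -/

theorem vc_add {objs : Store C} {n : ℕ} {ρ : ℕ → ℕ} {mem : ℕ → ℕ → ℕ} {S : ℕ → Store C}
    {Q : AState C → ℕ → Prop} {r x y : ℕ} {p : Prog} (z : ℕ) (hz : ρ x + ρ y = z)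
    (h : vc objs n p ⟨Function.update ρ r z, mem, S⟩ (fun a w => Q a (1 + w))) :
    vc objs n (.seq (.add r x y) p) ⟨ρ, mem, S⟩ Q := by
  subst hz; exact h

theorem vc_sub {objs : Store C} {n : ℕ} {ρ : ℕ → ℕ} {mem : ℕ → ℕ → ℕ} {S : ℕ → Store C}
    {Q : AState C → ℕ → Prop} {r x y : ℕ} {p : Prog} (z : ℕ) (hz : ρ x - ρ y = z)
    (h : vc objs n p ⟨Function.update ρ r z, mem, S⟩ (fun a w => Q a (1 + w))) :
    vc objs n (.seq (.sub r x y) p) ⟨ρ, mem, S⟩ Q := by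
  subst hz; exact h

theorem vc_const {objs : Store C} {n : ℕ} {ρ : ℕ → ℕ} {mem : ℕ → ℕ → ℕ} {S : ℕ → Store C}
    {Q : AState C → ℕ → Prop} {r z : ℕ} {p : Prog}
    (h : vc objs n p ⟨Function.update ρ r z, mem, S⟩ (fun a w => Q a (1 + w))) :
    vc objs n (.seq (.const r z) p) ⟨ρ, mem, S⟩ Q := h

theorem vc_load {objs : Store C} {n : ℕ} {ρ : ℕ → ℕ} {mem : ℕ → ℕ → ℕ} {S : ℕ → Store C}
    {Q : AState C → ℕ → Prop} {r k x : ℕ} {p : Prog} (z : ℕ) (hz : mem k (ρ x) = z)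
    (h : vc objs n p ⟨Function.update ρ r z, mem, S⟩ (fun a w => Q a (1 + w))) :
    vc objs n (.seq (.load r k x) p) ⟨ρ, mem, S⟩ Q := by
  subst hz; exact h

theorem vc_store {objs : Store C} {n : ℕ} {ρ : ℕ → ℕ} {mem : ℕ → ℕ → ℕ} {S : ℕ → Store C}
    {Q : AState C → ℕ → Prop} {k x y : ℕ} {p : Prog} (i z : ℕ) (hi : ρ x = i) (hz : ρ y = z)
    (h : vc objs n p ⟨ρ, Function.update mem k (Function.update (mem k) i z), S⟩
      (fun a w => Q a (1 + w))) :
    vc objs n (.seq (.store k x y) p) ⟨ρ, mem, S⟩ Q := by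
  subst hi hz; exact h

theorem vc_seq {objs : Store C} {n : ℕ} {a : AState C} {Q : AState C → ℕ → Prop} {p p' : Prog}
    (h : vc objs n p a (fun a₁ w₁ => vc objs n p' a₁ (fun a₂ w₂ => Q a₂ (w₁ + w₂)))) :
    vc objs n (.seq p p') a Q := h

theorem vc_ite {objs : Store C} {n : ℕ} {ρ : ℕ → ℕ} {mem : ℕ → ℕ → ℕ} {S : ℕ → Store C}
    {Q : AState C → ℕ → Prop} {x y : ℕ} {p p' : Prog} (i j : ℕ) (hi : ρ x = i) (hj : ρ y = j)
    (h : i < j → vc objs n p ⟨ρ, mem, S⟩ (fun a w => Q a (1 + w)))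
    (h' : j ≤ i → vc objs n p' ⟨ρ, mem, S⟩ (fun a w => Q a (1 + w))) :
    vc objs n (.ite x y p p') ⟨ρ, mem, S⟩ Q := by
  subst hi hj; exact ⟨h, fun hh => h' (not_lt.1 hh)⟩

/-- Match the objects in registers 10 and 20, and append them to the list. -/
def link : Prog :=
  .seq (.add 12 10 6) (.seq (.store 0 20 12) (.seq (.add 13 20 6) (.seq (.store 0 10 13)
    (.seq (.store 5 4 10) (.seq (.add 4 4 6) (.seq (.store 5 4 20) (.seq (.add 4 4 6) .skip)))))))

/-- Both ends are appended without asking which one is the item; `gather` sorts this out later.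
Hence the list grows by 2. -/
theorem vc_link {objs : Store C} {n : ℕ} {ρ : ℕ → ℕ} {mem : ℕ → ℕ → ℕ} {S : ℕ → Store C}
    {Q : AState C → ℕ → Prop} {h g len : ℕ} (h6 : ρ 6 = 1) (h10 : ρ 10 = h) (h20 : ρ 20 = g)
    (h4 : ρ 4 = len)
    (hQ : ∀ ρ', (∀ r < 10, r ≠ 4 → ρ' r = ρ r) → ρ' 4 = len + 2 →
      Q ⟨ρ', Function.update (Function.update mem 0
        (Function.update (Function.update (mem 0) g (h + 1)) h (g + 1))) 5
        (Function.update (Function.update (mem 5) len h) (len + 1) g), S⟩ 9) :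
    vc objs n link ⟨ρ, mem, S⟩ Q := by
  unfold link
  refine vc_add (h + 1) (by simp [h10, h6]) ?_
  refine vc_store g (h + 1) (by simp [h20]) (by simp) ?_
  refine vc_add (g + 1) (by simp [h20, h6]) ?_
  refine vc_store h (g + 1) (by simp [h10]) (by simp) ?_
  refine vc_store len h (by simp [h4]) (by simp [h10]) ?_
  refine vc_add (len + 1) (by simp [h4, h6]) ?_
  refine vc_store (len + 1) g (by simp) (by simp [h20]) ?_
  refine vc_add (len + 2) (by simp [h6]) ?_
  simp only [vc]
  have := hQ (Function.update (Function.update (Function.update (Function.update ρ 12 (h + 1)) 13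
    (g + 1)) 4 (len + 1)) 4 (len + 2)) ?_ (by simp)
  · simpa using this
  · intro r hr hr4
    iterate 4 rw [Function.update_of_ne (by omega)]

/-- Match the object in register 10 to a free one, or make it free. -/
def settle (G : ℕ) : Prog :=
  .seq (.load 11 1 10) (.seq (.const 24 3) (.seq (.sub 24 24 11) (.seq (.add 25 10 5)
  (.seq (findFam G) (.ite 5 26
    (.seq (.sub 20 26 6) (.seq evict link))
    (.seq (.add 20 10 5) (.seq (.add 21 11 5) place)))))))

/-- One search restores maximality: either a free neighbour is found and linked, or there is none
and `h` itself may become free. Nothing gets unmatched. -/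
theorem vc_settle {V : TwoSets C} {E G n : ℕ} {ρ : ℕ → ℕ} {mem : ℕ → ℕ → ℕ} {S : ℕ → Store C}
    {Q : AState C → ℕ → Prop} (h len : ℕ) (hV : Distinct V)
    (hc : Calm V E G n mem S len (h + 1)) (h5 : ρ 5 = 0) (h6 : ρ 6 = 1) (h7 : ρ 7 = E + 3)
    (h10 : ρ 10 = h) (h4 : ρ 4 = len) (hE : 0 < E)
    (hQ : ∀ ρ' mem' S' len' w, (∀ r < 10, r ≠ 4 → ρ' r = ρ r) → ρ' 4 = len' → len' ≤ len + 2 →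
      w ≤ 4 * G + 40 → Calm V E G n mem' S' len' 0 → (∀ u, mem 0 u ≠ 0 → mem' 0 u ≠ 0) →
      Q ⟨ρ', mem', S'⟩ w) :
    vc V.objs n (settle G) ⟨ρ, mem, S⟩ Q := by
  obtain ⟨hp, hm, hf⟩ := hc.inv.cur_spec h rfl
  obtain ⟨⟨s, x⟩, hx⟩ := Option.ne_none_iff_exists'.1 hp
  have hside := hc.inv.side_eq h s x hx
  unfold settle
  refine vc_load (if s then 2 else 1) (by simp [h10, hside]) ?_
  refine vc_const ?_
  -- The free objects of a set are in the family with the number of that set, so 3 minus this number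
  -- is the opposite family.
  refine vc_sub (if s then 1 else 2) (by cases s <;> simp) ?_
  refine vc_add h (by simp [h10, h5]) ?_
  refine vc_seq ?_
  refine vc_findFam h (if s then 1 else 2) x hc.core (by simp [h5]) (by simp [h7]) (by simp)
    (by simp) (objs_of hx) (by split_ifs <;> omega) (by split_ifs <;> omega) ?_
  intro ρ₁ w₁ hρ₁ hw₁ hnone hsome
  have r4 : ρ₁ 4 = len := by simp [hρ₁, h4]
  have r5 : ρ₁ 5 = 0 := by simp [hρ₁, h5]
  have r6 : ρ₁ 6 = 1 := by simp [hρ₁, h6]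
  have r10 : ρ₁ 10 = h := by simp [hρ₁, h10]
  have r11 : ρ₁ 11 = if s then 2 else 1 := by simp [hρ₁]
  have rlow : ∀ r < 10, ρ₁ r = ρ r := by
    intro r hr
    rw [hρ₁ r (by omega)]
    iterate 4 rw [Function.update_of_ne (by omega)]
  refine vc_ite 0 _ r5 rfl (fun hpos => ?_) (fun hpos => ?_)
  · obtain ⟨g, hg⟩ := Nat.exists_eq_succ_of_ne_zero (Nat.pos_iff_ne_zero.1 hpos)
    obtain ⟨hfg, y, hy, hmeet⟩ := hsome g hg
    obtain ⟨hmg, hVg⟩ := hc.inv.of_fam_free (s := !s) (by rw [hfg]; cases s <;> simp) hy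
    have hadj : (bipGraph V).Adj h g := (bipGraph_adj_iff hx).2 ⟨y, hVg, hmeet⟩
    have hne : h ≠ g := hadj.ne
    refine vc_sub g (by simp [hg, r6]) ?_
    refine vc_seq ?_
    refine vc_evict g hc.core (by simp [r5]) (by simp) ?_
    intro ρ₂ S₂ w₂ hρ₂ hw₂ hc₂
    have q4 : ρ₂ 4 = len := by simp [hρ₂, r4]
    have q6 : ρ₂ 6 = 1 := by simp [hρ₂, r6]
    have q10 : ρ₂ 10 = h := by simp [hρ₂, r10]
    have q20 : ρ₂ 20 = g := by simp [hρ₂]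
    refine vc_link q6 q10 q20 q4 ?_
    intro ρ₃ hρ₃ hρ₃4
    refine hQ _ _ S₂ (len + 2) _ ?_ hρ₃4 le_rfl (by omega) ?_ ?_
    · intro r hr hr4
      rw [hρ₃ r hr hr4, hρ₂ r (by omega), Function.update_of_ne (by omega), rlow r hr]
    · have hmem0 : ∀ u, (Function.update (Function.update (mem 0) g (h + 1)) h (g + 1)) u =
          if u = h then g + 1 else if u = g then h + 1 else mem 0 u := by
        intro u; simp [Function.update_apply]
      have hitems : ∀ b ∈ matchedItems V
          (Function.update (Function.update (mem 0) g (h + 1)) h (g + 1)),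
          b = h ∨ b = g ∨ b ∈ matchedItems V (mem 0) := by
        rintro b ⟨hb1, hb2⟩
        rw [hmem0] at hb2
        by_cases h1 : b = h
        · exact .inl h1
        by_cases h2 : b = g
        · exact .inr (.inl h2)
        exact .inr (.inr ⟨hb1, by simpa [h1, h2] using hb2⟩)
      refine ⟨?_, ?_, ?_, ?_, ?_⟩
      · simpa using hc₂
      · have := hc.inv.assign
          (mate' := Function.update (Function.update (mem 0) g (h + 1)) h (g + 1))
          (fam' := Function.update (mem 3) g 0) (l := 0) hadj
          (by simp [hmg]) (.inl rfl) (by simp) (by simp [hne.symm]) (by simp [hmg])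
          (by intro u h1 h2 _; simp [h1, h2]) (by simp) (by intro u h1; simp [h1])
        simpa [hmg] using this
      · intro u hu
        simp only [ne_eq, Function.update_self, Function.update_of_ne,
          OfNat.zero_ne_ofNat, not_false_eq_true, Nat.reduceEqDiff,
          hmem0] at hu ⊢
        by_cases h2 : u = g
        · simp [h2]
        rw [Function.update_of_ne h2]
        by_cases h1 : u = h
        · rw [h1]; exact hf
        · exact hc.idle u (by simpa [h1, h2] using hu)
      · intro b hb
        simp only [ne_eq, Function.update_self, Function.update_of_ne,
          OfNat.zero_ne_ofNat, not_false_eq_true, Nat.reduceEqDiff] at hb ⊢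
        rcases hitems b hb with rfl | rfl | hb
        · exact ⟨len, by omega, by simp⟩
        · exact ⟨len + 1, by omega, by simp⟩
        · obtain ⟨k, hk, hkb⟩ := hc.listed b hb
          refine ⟨k, by omega, ?_⟩
          rw [Function.update_of_ne (by omega), Function.update_of_ne (by omega), hkb]
      · simpa using hc.count
    · intro u hu
      simp only [ne_eq, Function.update_self, Function.update_of_ne,
          OfNat.zero_ne_ofNat, not_false_eq_true, Nat.reduceEqDiff,
          Function.update_apply]
      split_ifs <;> simp_all
  · have hno : ∀ g, (bipGraph V).Adj h g → mem 0 g ≠ 0 := by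
      intro g hadj hmg
      obtain ⟨y, hy, hmeet⟩ := (bipGraph_adj_iff hx).1 hadj
      have hfg := hc.inv.free g _ y hy hmg (by have := hadj.ne; omega)
      exact hnone (by omega) g (by rw [hfg]; cases s <;> simp) y (objs_of hy) hmeet
    refine vc_add h (by simp [r10, r5]) ?_
    refine vc_add (if s then 2 else 1) (by simp [r11, r5]) ?_
    refine vc_place h (if s then 2 else 1) x hc.core (by simp) (by simp)
      (objs_of hx) hf (by split_ifs <;> omega) (by split_ifs <;> omega) ?_ ?_
    -- The family contains only free objects of the same set, where the same object means the same
    -- handle; but `h` is in no family.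
    · intro g hfg hgx
      have hVg := (hc.inv.of_fam_free hfg hgx).2
      have := hV h g (by rw [hx, hVg]) hp
      subst this
      rw [hf] at hfg
      cases s <;> simp at hfg
    · intro ρ₂ S₂ w₂ hρ₂ hw₂ hc₂
      refine hQ _ _ S₂ len _ ?_ (by simp [hρ₂, r4]) (by omega) (by omega) ?_ ?_
      · intro r hr hr4
        rw [hρ₂ r (by omega), Function.update_of_ne (by omega), Function.update_of_ne (by omega),
          rlow r hr]
      · refine ⟨?_, ?_, ?_, ?_, ?_⟩
        · simpa using hc₂
        · have := hc.inv.release (fam' := Function.update (mem 3) h (if s then 2 else 1)) hx hno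
            (by simp) (by intro u hu; simp [hu])
          simpa using this
        · intro u hu
          have hu' : mem 0 u ≠ 0 := by simpa using hu
          have huh : u ≠ h := by rintro rfl; exact hu' hm
          simpa [huh] using hc.idle u hu'
        · simpa using hc.listed
        · simpa using hc.count
      · intro u hu
        simpa using hu

/-- Put the offset of a smallest part into register 10, its size into register 11. -/
def pickFrom : ℕ → Prog
  | 0 => .skip
  | d + 1 => .seq (.add 12 12 7) (.seq (.load 13 4 12) (.seq (.ite 13 11
      (.seq (.add 10 12 5) (.add 11 13 5)) .skip) (pickFrom d)))

theorem vc_pickFrom {objs : Store C} {E n : ℕ} {mem : ℕ → ℕ → ℕ} {S : ℕ → Store C} (d : ℕ) :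
    ∀ (j i : ℕ) (ρ : ℕ → ℕ) (Q : AState C → ℕ → Prop), ρ 5 = 0 → ρ 7 = E + 3 →
    ρ 12 = j * (E + 3) → i ≤ j → ρ 10 = i * (E + 3) → ρ 11 = mem 4 (i * (E + 3)) →
    (∀ k ≤ j, mem 4 (i * (E + 3)) ≤ mem 4 (k * (E + 3))) →
    (∀ ρ' w i, (∀ r < 10, ρ' r = ρ r) → w ≤ 7 * d + 1 → i ≤ j + d →
      ρ' 10 = i * (E + 3) → ρ' 11 = mem 4 (i * (E + 3)) →
      (∀ k ≤ j + d, mem 4 (i * (E + 3)) ≤ mem 4 (k * (E + 3))) → Q ⟨ρ', mem, S⟩ w) →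
    vc objs n (pickFrom d) ⟨ρ, mem, S⟩ Q := by
  induction d with
  | zero =>
    intro j i ρ Q h5 h7 h12 hi h10 h11 hmin hQ
    simp only [pickFrom, vc]
    exact hQ _ _ i (fun _ _ => rfl) (by omega) hi h10 h11 hmin
  | succ d ih =>
    intro j i ρ Q h5 h7 h12 hi h10 h11 hmin hQ
    simp only [pickFrom, vc]
    have e : j * (E + 3) + (E + 3) = (j + 1) * (E + 3) := by ring
    simp only [Function.update_self, ne_eq, Nat.reduceEqDiff, not_false_eq_true,
      Function.update_of_ne, h5, h7, h11, h12, e, add_zero]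
    refine ⟨fun hlt => ?_, fun hlt => ?_⟩
    · refine ih (j + 1) (j + 1) _ _ (by simp [h5]) (by simp [h7]) (by simp) le_rfl
        (by simp) (by simp) ?_ ?_
      · intro k hk
        by_cases hkj : k = j + 1
        · rw [hkj]
        · exact hlt.le.trans (hmin k (by omega))
      · intro ρ' w i' hρ hw hi' h1 h2 h3
        refine hQ _ _ i' (fun r hr => ?_) (by omega) (by omega) h1 h2
          (fun k hk => h3 k (by omega))
        rw [hρ r hr]
        iterate 4 rw [Function.update_of_ne (by omega)]
    · refine ih (j + 1) i _ _ (by simp [h5]) (by simp [h7]) (by simp) (by omega)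
        (by simp [h10]) (by simp [h11]) ?_ ?_
      · intro k hk
        by_cases hkj : k = j + 1
        · rw [hkj]; omega
        · exact hmin k (by omega)
      · intro ρ' w i' hρ hw hi' h1 h2 h3
        refine hQ _ _ i' (fun r hr => ?_) (by omega) (by omega) h1 h2
          (fun k hk => h3 k (by omega))
        rw [hρ r hr]
        iterate 2 rw [Function.update_of_ne (by omega)]

end

/-! ### Insertions and deletions -/

section
variable {X : Type u} {C : Set (Set X)}

/-- Parts with different offsets are disjoint. This is the pigeonhole principle that finds room in a
smallest part. -/
theorem mul_le_ncard {ob : Store C} (hfin : {h | ob h ≠ none}.Finite) (off : ℕ → ℕ) (s G c : ℕ)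
    (hs : 0 < s) (hc : ∀ j < G, c ≤ {h | ob h ≠ none ∧ off h = j * s}.ncard) :
    G * c ≤ {h | ob h ≠ none}.ncard := by
  classical
  have hsub : (((Finset.range G).biUnion fun j => hfin.toFinset.filter fun h => off h = j * s :
      Finset ℕ) : Set ℕ) ⊆ {h | ob h ≠ none} := by
    intro h hh
    simp only [Finset.coe_biUnion, Set.mem_iUnion, Finset.mem_coe, Finset.mem_filter,
      Set.Finite.mem_toFinset] at hh
    obtain ⟨j, -, h1, -⟩ := hh
    exact h1
  have h1 := Set.ncard_le_ncard hsub hfin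
  rw [Set.ncard_coe_finset, Finset.card_biUnion] at h1
  · refine le_trans ?_ h1
    calc G * c = ∑ j ∈ Finset.range G, c := by simp
      _ ≤ _ := Finset.sum_le_sum fun j hj => ?_
    refine (hc j (Finset.mem_range.1 hj)).trans (le_of_eq ?_)
    rw [← Set.ncard_coe_finset]
    congr 1
    ext h
    simp
  · intro j _ j' _ hjj
    refine Finset.disjoint_filter.2 fun h _ h1 h2 => hjj ?_
    rw [h1] at h2
    exact Nat.eq_of_mul_eq_mul_right hs h2

theorem part_update_some {ob : Store C} {off : ℕ → ℕ} {h o o' : ℕ} {x : C} (hn : ob h = none) :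
    {g | Function.update ob h (some x) g ≠ none ∧ Function.update off h o' g = o} =
      if o = o' then insert h {g | ob g ≠ none ∧ off g = o} else {g | ob g ≠ none ∧ off g = o} := by
  ext g
  by_cases hg : g = h <;> by_cases ho : o = o' <;> simp [hg, ho, hn]
  exact fun h1 => ho h1.symm

theorem ncard_part_update_some {ob : Store C} (hfin : {h | ob h ≠ none}.Finite) {off : ℕ → ℕ}
    {h o o' : ℕ} {x : C} (hn : ob h = none) :
    {g | Function.update ob h (some x) g ≠ none ∧ Function.update off h o' g = o}.ncard =
      {g | ob g ≠ none ∧ off g = o}.ncard + if o = o' then 1 else 0 := by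
  rw [part_update_some hn]
  split_ifs with ho
  · rw [Set.ncard_insert_of_notMem (by simp [hn]) (hfin.subset fun g hg => hg.1)]
  · rfl

theorem ncard_part_update_none {ob : Store C} {off : ℕ → ℕ}
    {h o : ℕ} (hn : ob h ≠ none) :
    {g | Function.update ob h none g ≠ none ∧ off g = o}.ncard =
      {g | ob g ≠ none ∧ off g = o}.ncard - if o = off h then 1 else 0 := by
  have e : {g | Function.update ob h none g ≠ none ∧ off g = o} =
      {g | ob g ≠ none ∧ off g = o} \ {h} := by
    ext g
    by_cases hg : g = h <;> simp [hg]
  rw [e]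
  split_ifs with ho
  · exact Set.ncard_sdiff_singleton_of_mem (show h ∈ {g | ob g ≠ none ∧ off g = o} from ⟨hn, ho.symm⟩)
  · rw [Set.sdiff_singleton_eq_self (fun hh => ho hh.2.symm)]; rfl

theorem Core.add {ob : Store C} {E G n : ℕ} {off fam : ℕ → ℕ} {S : ℕ → Store C}
    (hc : Core ob E G n off fam S) {h i : ℕ} {x : C} (hn : ob h = none) (hi : i < G)
    (hle : {g | ob g ≠ none ∧ off g = i * (E + 3)}.ncard + 1 ≤ n) :
    Core (Function.update ob h (some x)) E G n (Function.update off h (i * (E + 3))) fam S := by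
  have hf : fam h = 0 := by
    by_contra hf
    exact hc.present h hf hn
  refine ⟨fun j g => ?_, fun g hg => ?_, hc.fam_lt, fun g hg => ?_, fun o => ?_, ?_⟩
  · rw [hc.sync]
    by_cases hg : g = h
    · subst hg; simp [hf]
    · simp [hg]
  · by_cases hgh : g = h
    · exact ⟨i, hi, by simp [hgh]⟩
    · simpa [hgh] using hc.off_eq g (by simpa [hgh] using hg)
  · have hgh : g ≠ h := by rintro rfl; exact hg hf
    simpa [hgh] using hc.present g hg
  · rw [ncard_part_update_some hc.fin hn]
    split_ifs with ho
    · rw [ho]; exact hle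
    · exact hc.bound o
  · refine (hc.fin.insert h).subset fun g hg => ?_
    by_cases hgh : g = h
    · exact .inl hgh
    · exact .inr (by simpa [hgh] using hg)

theorem Core.remove {ob : Store C} {E G n : ℕ} {off fam : ℕ → ℕ} {S : ℕ → Store C}
    (hc : Core ob E G n off fam S) {h : ℕ} (hf : fam h = 0) :
    Core (Function.update ob h none) E G n off fam S := by
  have hsub : ∀ g, Function.update ob h none g ≠ none → g ≠ h ∧ ob g ≠ none := by
    intro g hg
    have hgh : g ≠ h := by rintro rfl; simp at hg
    exact ⟨hgh, by simpa [hgh] using hg⟩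
  refine ⟨fun j g => ?_, fun g hg => hc.off_eq g (hsub g hg).2, hc.fam_lt, fun g hg => ?_,
    fun o => ?_, hc.fin.subset fun g hg => (hsub g hg).2⟩
  · rw [hc.sync]
    by_cases hg : g = h
    · subst hg; simp [hf]
    · simp [hg]
  · have hgh : g ≠ h := by rintro rfl; exact hg hf
    simpa [hgh] using hc.present g hg
  · refine (Set.ncard_le_ncard (t := {g | ob g ≠ none ∧ off g = o}) ?_
      (hc.fin.subset fun g hg => hg.1)).trans (hc.bound o)
    exact fun g hg => ⟨(hsub g hg.1).2, hg.2⟩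

/-- At most the item `z` is lost, so an update costs the matching at most one edge. -/
theorem ncard_matchedItems_le {V V' : TwoSets C} {mate mate' : ℕ → ℕ} {z : ℕ}
    (hfin : {h | V'.objs h ≠ none}.Finite)
    (h : ∀ b ∈ matchedItems V mate, b ≠ z → b ∈ matchedItems V' mate') :
    (matchedItems V mate).ncard ≤ (matchedItems V' mate').ncard + 1 := by
  have hf : (matchedItems V' mate').Finite := by
    refine hfin.subset ?_
    rintro b ⟨⟨x, hx⟩, -⟩
    simp [objs_of hx]
  refine (Set.ncard_le_ncard (t := insert z (matchedItems V' mate')) ?_ (hf.insert z)).trans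
    (Set.ncard_insert_le _ _)
  intro b hb
  by_cases hz : b = z
  · exact .inl hz
  · exact .inr (h b hb hz)

/-- Insert the object in register 1 into the set in register 0. -/
def insertObj (G : ℕ) : Prog :=
  .seq (.store 1 1 0) (.seq (.const 12 0) (.seq (.const 10 0) (.seq (.load 11 4 10)
    (.seq (pickFrom (G - 1)) (.seq (.store 2 1 10) (.seq (.add 11 11 6) (.seq (.store 4 10 11)
      (.seq (.add 10 1 5) (settle G)))))))))

/-- Delete the object in register 1. -/
def deleteObj (G : ℕ) : Prog :=
  .seq (.load 10 2 1) (.seq (.load 11 4 10) (.seq (.sub 11 11 6) (.seq (.store 4 10 11)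
    (.seq (.add 20 1 5) (.seq evict (.seq (.load 10 0 1) (.ite 5 10
      (.seq (.store 0 1 5) (.seq (.sub 10 10 6) (.seq (.store 0 10 5) (settle G))))
      .skip)))))))

theorem vc_insertObj {V : TwoSets C} {E G n : ℕ} {ρ : ℕ → ℕ} {mem : ℕ → ℕ → ℕ}
    {S : ℕ → Store C} {Q : AState C → ℕ → Prop} {h len : ℕ} {s : Bool} {x : C}
    (hV : Distinct (Function.update V h (some (s, x)))) (hh : V h = none)
    (hc : Calm V E G n mem S len 0) (h0 : ρ 0 = if s then 2 else 1) (h1 : ρ 1 = h)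
    (h5 : ρ 5 = 0) (h6 : ρ 6 = 1) (h7 : ρ 7 = E + 3)
    (h4 : ρ 4 = len) (hE : 0 < E) (hG : 0 < G)
    (hn : {g | TwoSets.objs (Function.update V h (some (s, x))) g ≠ none}.ncard ≤ G * n)
    (hQ : ∀ ρ' mem' S' len' w, (∀ r < 10, r ≠ 4 → ρ' r = ρ r) → ρ' 4 = len' → len' ≤ len + 2 →
      w ≤ 11 * G + 50 → Calm (Function.update V h (some (s, x))) E G n mem' S' len' 0 →
      (matchedItems V (mem 0)).ncard ≤
        (matchedItems (Function.update V h (some (s, x))) (mem' 0)).ncard + 1 →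
      Q ⟨ρ', mem', S'⟩ w) :
    vc (TwoSets.objs (Function.update V h (some (s, x)))) n (insertObj G) ⟨ρ, mem, S⟩ Q := by
  have hobn : V.objs h = none := by simp [TwoSets.objs, hh]
  have hob : TwoSets.objs (Function.update V h (some (s, x))) =
    Function.update V.objs h (some x) := objs_update V h _
  unfold insertObj
  refine vc_store h (if s then 2 else 1) h1 h0 ?_
  refine vc_const (vc_const ?_)
  refine vc_load (mem 4 0) (by simp) ?_
  refine vc_seq ?_
  refine vc_pickFrom (E := E) (G - 1) 0 0 _ _ (by simp [h5]) (by simp [h7]) (by simp) le_rfl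
    (by simp) (by simp) (by simp) ?_
  intro ρ₁ w₁ i hρ₁ hw₁ hi h10 h11 hmin
  have e4 : Function.update mem 1 (Function.update (mem 1) h (if s then 2 else 1)) 4 = mem 4 := by
    simp
  rw [e4] at h11 hmin
  have r1 : ρ₁ 1 = h := by simp [hρ₁, h1]
  have r4 : ρ₁ 4 = len := by simp [hρ₁, h4]
  have r5 : ρ₁ 5 = 0 := by simp [hρ₁, h5]
  have r6 : ρ₁ 6 = 1 := by simp [hρ₁, h6]
  have r7 : ρ₁ 7 = E + 3 := by simp [hρ₁, h7]
  have hiG : i < G := by omega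
  -- If a smallest part had `n` objects already, all parts together would have `G * n`, leaving no
  -- room for the new object in `hn`.
  have hsize : {g | V.objs g ≠ none ∧ mem 2 g = i * (E + 3)}.ncard + 1 ≤ n := by
    rw [← hc.count i hiG]
    have h1 := mul_le_ncard hc.core.fin (mem 2) (E + 3) G (mem 4 (i * (E + 3))) (by omega)
      (fun j hj => by rw [← hc.count j hj]; exact hmin j (by omega))
    have h2 : {g | V.objs g ≠ none}.ncard + 1 ≤ G * n := by
      refine le_trans (le_of_eq ?_) hn
      rw [hob, ← Set.ncard_insert_of_notMem (a := h) (by simp [hobn]) hc.core.fin]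
      congr 1
      ext g
      by_cases hg : g = h <;> simp [hg]
    by_contra hcon
    have := Nat.mul_le_mul_left G (show n ≤ mem 4 (i * (E + 3)) by omega)
    omega
  refine vc_store h (i * (E + 3)) r1 h10 ?_
  refine vc_add (mem 4 (i * (E + 3)) + 1) (by rw [h11, r6]) ?_
  refine vc_store (i * (E + 3)) (mem 4 (i * (E + 3)) + 1) (by simp [h10]) (by simp) ?_
  refine vc_add h (by simp [r1, r5]) ?_
  have hfh : mem 3 h = 0 := by
    by_contra hf
    exact hc.core.present h hf hobn
  refine vc_settle h len hV ⟨?_, ?_, ?_, ?_, ?_⟩ (by simp [r5]) (by simp [r6]) (by simp [r7])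
    (by simp) (by simp [r4]) hE ?_
  · rw [hob]
    simpa using hc.core.add hobn hiG hsize
  · have := hc.inv.insert (s := s) (x := x)
      (side' := Function.update (mem 1) h (if s then 2 else 1)) hh hfh (by simp)
      (by intro u hu; simp [hu])
    simpa using this
  · simpa using hc.idle
  · rintro b ⟨⟨y, hy⟩, hm⟩
    simp only [ne_eq, Nat.reduceEqDiff, not_false_eq_true, Function.update_of_ne,
      OfNat.zero_ne_ofNat, OfNat.ofNat_ne_one, zero_ne_one] at hm ⊢
    have hbh : b ≠ h := by
      rintro rfl
      exact hc.inv.present hm hh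
    exact hc.listed b ⟨⟨y, by simpa [hbh] using hy⟩, hm⟩
  · intro j hj
    rw [hob]
    simp only [Function.update_self, ne_eq, Nat.reduceEqDiff, not_false_eq_true,
      Function.update_of_ne, OfNat.ofNat_ne_one]
    have := ncard_part_update_some (x := x) hc.core.fin (off := mem 2) (o := j * (E + 3))
      (o' := i * (E + 3)) hobn
    simp only [ne_eq] at this
    rw [this, ← hc.count j hj, Function.update_apply]
    split_ifs with hji
    · rw [hji]
    · rfl
  · intro ρ' mem' S' len' w hρ' h4' hlen' hw' hc' hm'
    refine hQ ρ' mem' S' len' _ ?_ h4' hlen' (by omega) hc' ?_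
    · intro r hr hr4
      rw [hρ' r hr hr4, Function.update_of_ne (by omega), Function.update_of_ne (by omega), hρ₁ r hr]
      iterate 3 rw [Function.update_of_ne (by omega)]
    · refine ncard_matchedItems_le (z := h) hc'.core.fin ?_
      rintro b ⟨⟨y, hy⟩, hm⟩ hbh
      refine ⟨⟨y, by simpa [hbh] using hy⟩, hm' b (by simpa using hm)⟩

theorem vc_deleteObj {V : TwoSets C} {E G n : ℕ} {ρ : ℕ → ℕ} {mem : ℕ → ℕ → ℕ}
    {S : ℕ → Store C} {Q : AState C → ℕ → Prop} {h len : ℕ}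
    (hV : Distinct (Function.update V h none)) (hh : V h ≠ none)
    (hc : Calm V E G n mem S len 0) (h1 : ρ 1 = h)
    (h5 : ρ 5 = 0) (h6 : ρ 6 = 1) (h7 : ρ 7 = E + 3)
    (h4 : ρ 4 = len) (hE : 0 < E)
    (hQ : ∀ ρ' mem' S' len' w, (∀ r < 10, r ≠ 4 → ρ' r = ρ r) → ρ' 4 = len' → len' ≤ len + 2 →
      w ≤ 11 * G + 60 → Calm (Function.update V h none) E G n mem' S' len' 0 →
      (matchedItems V (mem 0)).ncard ≤
        (matchedItems (Function.update V h none) (mem' 0)).ncard + 1 →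
      Q ⟨ρ', mem', S'⟩ w) :
    vc (TwoSets.objs (Function.update V h none)) n (deleteObj G) ⟨ρ, mem, S⟩ Q := by
  have hobn : V.objs h ≠ none := objs_ne_none.2 hh
  have hob : TwoSets.objs (Function.update V h none) =
    Function.update V.objs h none := objs_update V h _
  unfold deleteObj
  refine vc_load (mem 2 h) (by rw [h1]) ?_
  refine vc_load (mem 4 (mem 2 h)) (by simp) ?_
  refine vc_sub (mem 4 (mem 2 h) - 1) (by simp [h6]) ?_
  refine vc_store (mem 2 h) (mem 4 (mem 2 h) - 1) (by simp) (by simp) ?_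
  refine vc_add h (by simp [h1, h5]) ?_
  refine vc_seq ?_
  refine vc_evict (ob := V.objs) (E := E) (G := G) h (by simpa using hc.core) (by simp [h5])
    (by simp) ?_
  intro ρ₁ S₁ w₁ hρ₁ hw₁ hc₁
  have r1 : ρ₁ 1 = h := by simp [hρ₁, h1]
  have r4 : ρ₁ 4 = len := by simp [hρ₁, h4]
  have r5 : ρ₁ 5 = 0 := by simp [hρ₁, h5]
  have r6 : ρ₁ 6 = 1 := by simp [hρ₁, h6]
  have r7 : ρ₁ 7 = E + 3 := by simp [hρ₁, h7]
  have rlow : ∀ r < 10, ρ₁ r = ρ r := by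
    intro r hr
    rw [hρ₁ r (by omega)]
    iterate 4 rw [Function.update_of_ne (by omega)]
  have hc₂ : Core (TwoSets.objs (Function.update V h none)) E G n (mem 2)
      (Function.update (mem 3) h 0) S₁ := by
    rw [hob]
    exact Core.remove (by simpa using hc₁) (by simp)
  have hcount : ∀ j < G, Function.update (mem 4) (mem 2 h) (mem 4 (mem 2 h) - 1) (j * (E + 3)) =
      {g | TwoSets.objs (Function.update V h none) g ≠ none ∧ mem 2 g = j * (E + 3)}.ncard := by
    intro j hj
    rw [hob, ncard_part_update_none hobn, ← hc.count j hj, Function.update_apply]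
    split_ifs with hji
    · rw [hji]
    · rfl
  have hinv : ∀ mate', mate' h = 0 → (∀ p, mem 0 h = p + 1 → mate' p = 0) →
      (∀ u, u ≠ h → mem 0 h ≠ u + 1 → mate' u = mem 0 u) →
      Inv (Function.update V h none) mate' (mem 1) (Function.update (mem 3) h 0) (mem 0 h) :=
    fun mate' a b c => hc.inv.delete hc.idle a b c (by intro u hu; simp [hu])
  have hidle : ∀ u, mem 0 u ≠ 0 → Function.update (mem 3) h 0 u = 0 := by
    intro u hu
    by_cases huh : u = h
    · simp [huh]
    · simpa [huh] using hc.idle u hu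
  have hitem : ∀ mate' : ℕ → ℕ, (∀ u, mate' u ≠ 0 → mem 0 u ≠ 0) →
      ∀ b ∈ matchedItems (Function.update V h none) mate', ∃ k < len, mem 5 k = b := by
    rintro mate' hm' b ⟨⟨y, hy⟩, hm⟩
    have hbh : b ≠ h := by rintro rfl; simp at hy
    exact hc.listed b ⟨⟨y, by simpa [hbh] using hy⟩, hm' b hm⟩
  refine vc_load (mem 0 h) (by simp [r1]) ?_
  refine vc_ite 0 (mem 0 h) (by simp [r5]) (by simp) (fun hpos => ?_) (fun hpos => ?_)
  · obtain ⟨p, hp⟩ := Nat.exists_eq_succ_of_ne_zero (Nat.pos_iff_ne_zero.1 hpos)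
    have hadj := hc.inv.mate_adj h p hp
    have hne : h ≠ p := hadj.ne
    have hz : ∀ u, Function.update (Function.update (mem 0) h 0) p 0 u ≠ 0 → mem 0 u ≠ 0 := by
      intro u hu h0
      apply hu
      simp only [Function.update_apply]
      split_ifs <;> simp [h0]
    refine vc_store h 0 (by simp [r1]) (by simp [r5]) ?_
    refine vc_sub p (by simp [r6, hp]) ?_
    refine vc_store p 0 (by simp) (by simp [r5]) ?_
    refine vc_settle p len hV ⟨?_, ?_, ?_, ?_, ?_⟩ (by simp [r5]) (by simp [r6]) (by simp [r7])
      (by simp) (by simp [r4]) hE ?_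
    · simpa using hc₂
    · have := hinv (Function.update (Function.update (mem 0) h 0) p 0) (by simp [hne])
        (by intro q hq; rw [show q = p by omega]; simp)
        (by intro u h1 h2; rw [Function.update_of_ne (by omega), Function.update_of_ne h1])
      rw [hp] at this
      simpa using this
    · intro u hu
      simpa using hidle u (hz u (by simpa using hu))
    · have := hitem (Function.update (Function.update (mem 0) h 0) p 0) hz
      simpa using this
    · simpa using hcount
    · intro ρ' mem' S' len' w hρ' h4' hlen' hw' hc' hm'
      refine hQ ρ' mem' S' len' _ ?_ h4' hlen' (by omega) hc' ?_
      · intro r hr hr4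
        rw [hρ' r hr hr4, Function.update_of_ne (by omega), Function.update_of_ne (by omega),
          rlow r hr]
      · have key : ∀ b ∈ matchedItems V (mem 0), b ≠ h → b ≠ p →
            b ∈ matchedItems (Function.update V h none) (mem' 0) := by
          rintro b ⟨⟨y, hy⟩, hm⟩ hbh hbp
          exact ⟨⟨y, by simpa [hbh] using hy⟩, hm' b (by simpa [hbh, hbp] using hm)⟩
        -- Exactly one of `h` and its partner `p` is an item, and only this one can be lost.
        obtain ⟨s, a, b, ha, hb, -⟩ := hadj
        cases s
        · refine ncard_matchedItems_le (z := p) hc'.core.fin fun u hu hup => key u hu ?_ hup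
          rintro rfl
          obtain ⟨⟨y, hy⟩, -⟩ := hu
          simp [ha] at hy
        · refine ncard_matchedItems_le (z := h) hc'.core.fin fun u hu huh => key u hu huh ?_
          rintro rfl
          obtain ⟨⟨y, hy⟩, -⟩ := hu
          simp [hb] at hy
  · have hm0 : mem 0 h = 0 := by omega
    have hi := hinv (mem 0) hm0 (by intro p hp; omega) (fun _ _ _ => rfl)
    rw [hm0] at hi
    simp only [vc]
    refine hQ _ _ S₁ len _ ?_ (by simp [r4]) (by omega) (by omega) ⟨?_, ?_, ?_, ?_, ?_⟩ ?_
    · intro r hr _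
      rw [Function.update_of_ne (by omega), rlow r hr]
    · simpa using hc₂
    · simpa using hi
    · simpa using hidle
    · simpa using hitem (mem 0) (fun _ hu => hu)
    · simpa using hcount
    · refine ncard_matchedItems_le (z := h) hc₂.fin ?_
      rintro b ⟨⟨y, hy⟩, hm⟩ hbh
      exact ⟨⟨y, by simpa [hbh] using hy⟩, by simpa using hm⟩

end

/-! ### The list of matched items -/

section
variable {X : Type u} {C : Set (Set X)}

theorem vc_loop {objs : Store C} {n : ℕ} {ρ : ℕ → ℕ} {mem : ℕ → ℕ → ℕ} {S : ℕ → Store C}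
    {Q : AState C → ℕ → Prop} {x y : ℕ} {p : Prog}
    (I : ℕ → (ℕ → ℕ) → (ℕ → ℕ → ℕ) → (ℕ → Store C) → Prop) (k : ℕ) (h0 : I k ρ mem S)
    (hstep : ∀ k ρ mem S, I k ρ mem S → ρ x < ρ y → vc objs n p ⟨ρ, mem, S⟩
      (fun a w => ∃ k', k' + w + 1 ≤ k ∧ I k' a.reg a.mem a.st))
    (hend : ∀ k' ρ mem S w, I k' ρ mem S → ρ y ≤ ρ x → w + k' ≤ k + 1 → Q ⟨ρ, mem, S⟩ w) :
    vc objs n (.loop x y p) ⟨ρ, mem, S⟩ Q :=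
  ⟨fun k a => I k a.reg a.mem a.st, k, h0, fun k a h hlt => hstep k a.reg a.mem a.st h hlt,
    fun k' a w h hle hw => hend k' a.reg a.mem a.st w h (not_lt.1 hle) hw⟩

/-- The invariant while the list of the objects that became matched is thinned out: the first `i`
entries were read, the first `j` are the matched items that were found, and these are in
family `3`. -/
structure Gather (V : TwoSets C) (mate side fam L : ℕ → ℕ) (len i j : ℕ) : Prop where
  inv : Inv V mate side fam 0
  fam_eq : ∀ u, mate u ≠ 0 → fam u = 0 ∨ u ∈ matchedItems V mate ∧ fam u = 3
  le : j ≤ i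
  le_len : i ≤ len
  mem : ∀ k < j, L k ∈ matchedItems V mate ∧ fam (L k) = 3
  inj : ∀ k < j, ∀ k' < j, L k = L k' → k = k'
  todo : ∀ b ∈ matchedItems V mate, fam b = 0 → ∃ k, i ≤ k ∧ k < len ∧ L k = b
  found : ∀ b ∈ matchedItems V mate, fam b ≠ 0 → ∃ k < j, L k = b

theorem Gather.skip {V : TwoSets C} {mate side fam L : ℕ → ℕ} {len i j : ℕ}
    (h : Gather V mate side fam L len i j) (hi : i < len)
    (hL : L i ∈ matchedItems V mate → fam (L i) ≠ 0) :
    Gather V mate side fam L len (i + 1) j := by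
  refine ⟨h.inv, h.fam_eq, by have := h.le; omega, hi, h.mem, h.inj, ?_, h.found⟩
  intro b hb hf
  obtain ⟨k, hk, hkl, rfl⟩ := h.todo b hb hf
  refine ⟨k, ?_, hkl, rfl⟩
  rcases Nat.lt_or_ge i k with h1 | h1
  · exact h1
  · obtain rfl : i = k := by omega
    exact absurd hf (hL hb)

/-- The list is thinned out in place: the writing position never overtakes the reading position, so
no unread entry is destroyed. Family `3` doubles as the mark that makes later duplicates be skipped.
-/
theorem Gather.push {V : TwoSets C} {mate side fam fam' L : ℕ → ℕ} {len i j b : ℕ}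
    (h : Gather V mate side fam L len i j) (hi : i < len) (hLi : L i = b)
    (hb : b ∈ matchedItems V mate) (hf : fam b = 0) (fb : fam' b = 3)
    (fo : ∀ u, u ≠ b → fam' u = fam u) :
    Gather V mate side fam' (Function.update L j b) len (i + 1) (j + 1) := by
  have hle := h.le
  have hne : ∀ k < j, L k ≠ b := by
    rintro k hk rfl
    have := (h.mem k hk).2
    omega
  refine ⟨?_, ?_, by omega, hi, ?_, ?_, ?_, ?_⟩
  · refine h.inv.mono_fam fun u => ?_
    by_cases hu : u = b
    · subst hu; exact .inr ⟨hb.2, .inr ⟨by omega, hb.1⟩⟩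
    · exact .inl (fo u hu)
  · intro u hu
    by_cases hub : u = b
    · subst hub; exact .inr ⟨hb, fb⟩
    · rw [fo u hub]; exact h.fam_eq u hu
  · intro k hk
    by_cases hkj : k = j
    · subst hkj; simpa using ⟨hb, fb⟩
    · rw [Function.update_of_ne hkj, fo _ (hne k (by omega))]
      exact h.mem k (by omega)
  · intro k hk k' hk'
    by_cases hkl : k = j <;> by_cases hkl' : k' = j
    · simp [hkl, hkl']
    · rw [hkl, Function.update_self, Function.update_of_ne hkl']
      intro he; exact absurd he.symm (hne k' (by omega))
    · rw [hkl', Function.update_self, Function.update_of_ne hkl]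
      intro he; exact absurd he (hne k (by omega))
    · rw [Function.update_of_ne hkl, Function.update_of_ne hkl']
      exact h.inj k (by omega) k' (by omega)
  · intro u hu hfu
    have hub : u ≠ b := by rintro rfl; omega
    rw [fo u hub] at hfu
    obtain ⟨k, hk, hkl, rfl⟩ := h.todo u hu hfu
    have hki : k ≠ i := by rintro rfl; exact hub hLi
    exact ⟨k, by omega, hkl, by rw [Function.update_of_ne (by omega)]⟩
  · intro u hu hfu
    by_cases hub : u = b
    · exact ⟨j, by omega, by simp [hub]⟩
    · rw [fo u hub] at hfu
      obtain ⟨k, hk, rfl⟩ := h.found u hu hfu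
      exact ⟨k, by omega, by rw [Function.update_of_ne (by omega)]⟩

/-- All matched items have price 1 and all free ones price 0, so `cs` holds at the start for any
maximal matching. -/
theorem Gather.auction {V : TwoSets C} {E : ℕ} {mate side fam L : ℕ → ℕ} {len j : ℕ}
    (h : Gather V mate side fam L len len j) (hf : ∀ u, fam u < E + 3) :
    Auction V E mate side fam L j 0 0 := by
  have item : ∀ b ∈ matchedItems V mate, fam b = 3 := by
    intro b hb
    rcases h.fam_eq b hb.2 with h1 | ⟨-, h1⟩
    · obtain ⟨k, h2, h3, -⟩ := h.todo b hb h1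
      omega
    · exact h1
  refine ⟨h.inv, by simp, by simp, Nat.zero_le _, fun u => by have := hf u; omega,
    fun b hb => (item b hb).ge, ?_, by simp, ⟨fun k hk => (h.mem k hk).1, h.inj, fun b hb =>
      h.found b hb (by rw [item b hb]; omega)⟩⟩
  intro a b x hab hx b' hb'
  obtain ⟨y, hy⟩ := bipGraph_adj_right (h.inv.mate_adj _ _ hab) hx
  obtain ⟨y', hy'⟩ := bipGraph_adj_right hb' hx
  have h1 := item b ⟨⟨y, hy⟩, by rw [h.inv.mate_symm _ _ hab]; omega⟩
  by_cases hm : mate b' = 0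
  · have := h.inv.free b' true y' hy' hm (by omega)
    simp at this
    omega
  · have := item b' ⟨⟨y', hy'⟩, hm⟩
    omega

/-- Thin out the list to the matched items, and put these into family `3`. -/
def gather : Prog :=
  .seq (.const 10 0) (.seq (.const 11 0) (.seq (.const 17 2) (.seq (.const 18 3)
    (.seq (.loop 10 4 (.seq (.load 12 5 10) (.seq (.add 10 10 6) (.seq (.load 13 1 12) (.ite 6 13
      (.seq (.load 14 0 12) (.ite 5 14
        (.seq (.load 15 3 12) (.ite 15 6
          (.seq (.store 5 11 12) (.seq (.add 11 11 6) (.seq (.add 20 12 5) (.seq (.add 21 18 5)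
            place)))) .skip)) .skip)) .skip)))))
    (.seq (.add 4 11 5) (.seq (.add 16 2 17) .skip))))))

theorem vc_gather {V : TwoSets C} {E G n : ℕ} {ρ : ℕ → ℕ} {mem : ℕ → ℕ → ℕ} {S : ℕ → Store C}
    {Q : AState C → ℕ → Prop} {len : ℕ} (hV : Distinct V)
    (hc : Calm V E G n mem S len 0) (h2 : ρ 2 = E) (h5 : ρ 5 = 0) (h6 : ρ 6 = 1)
    (h4 : ρ 4 = len) (hE : 0 < E)
    (hQ : ∀ ρ' mem' S' len' w, (∀ r < 10, r ≠ 4 → ρ' r = ρ r) → ρ' 4 = len' → ρ' 16 = E + 2 →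
      ρ' 17 = 2 → w ≤ 21 * len + 10 → mem' 0 = mem 0 → mem' 2 = mem 2 → mem' 4 = mem 4 →
      Core V.objs E G n (mem' 2) (mem' 3) S' →
      Auction V E (mem' 0) (mem' 1) (mem' 3) (mem' 5) len' 0 0 →
      Q ⟨ρ', mem', S'⟩ w) :
    vc V.objs n gather ⟨ρ, mem, S⟩ Q := by
  unfold gather
  refine vc_const (vc_const (vc_const (vc_const (vc_seq ?_))))
  -- 21 units per unread entry suffice for the longest pass, which ends with `place`.
  refine vc_loop (fun k ρ' mem' S' => ∃ i j, k = 21 * (len - i) ∧ (∀ r < 10, ρ' r = ρ r) ∧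
    ρ' 10 = i ∧ ρ' 11 = j ∧ ρ' 17 = 2 ∧ ρ' 18 = 3 ∧ mem' 0 = mem 0 ∧ mem' 2 = mem 2 ∧
    mem' 4 = mem 4 ∧ Core V.objs E G n (mem' 2) (mem' 3) S' ∧
    Gather V (mem' 0) (mem' 1) (mem' 3) (mem' 5) len i j) (21 * len) ?_ ?_ ?_
  · refine ⟨0, 0, by simp, ?_, by simp, by simp, by simp, by simp, rfl, rfl, rfl, hc.core, hc.inv,
      fun u hu => .inl (hc.idle u hu), le_rfl, Nat.zero_le _, by simp, by simp, ?_, ?_⟩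
    · intro r hr
      iterate 4 rw [Function.update_of_ne (by omega)]
    · intro b hb _
      obtain ⟨k, hk⟩ := hc.listed b hb
      exact ⟨k, Nat.zero_le _, hk⟩
    · intro b hb hf
      exact absurd (hc.idle b hb.2) hf
  · rintro k ρ₁ mem₁ S₁ ⟨i, j, rfl, hρ, r10, r11, r17, r18, m0, m2, m4, hcore, hg⟩ hlt
    have r4 : ρ₁ 4 = len := by rw [hρ 4 (by omega), h4]
    have r5 : ρ₁ 5 = 0 := by rw [hρ 5 (by omega), h5]
    have r6 : ρ₁ 6 = 1 := by rw [hρ 6 (by omega), h6]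
    have hi : i < len := by omega
    have hskip : ∀ (ρ₂ : ℕ → ℕ) (w : ℕ), (∀ r < 10, ρ₂ r = ρ₁ r) → ρ₂ 10 = i + 1 → ρ₂ 11 = j → ρ₂ 17 = 2 →
        ρ₂ 18 = 3 → w ≤ 20 → (mem₁ 5 i ∈ matchedItems V (mem₁ 0) → mem₁ 3 (mem₁ 5 i) ≠ 0) →
        ∃ k', k' + w + 1 ≤ 21 * (len - i) ∧ ∃ i j, k' = 21 * (len - i) ∧ (∀ r < 10, ρ₂ r = ρ r) ∧
          ρ₂ 10 = i ∧ ρ₂ 11 = j ∧ ρ₂ 17 = 2 ∧ ρ₂ 18 = 3 ∧ mem₁ 0 = mem 0 ∧ mem₁ 2 = mem 2 ∧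
          mem₁ 4 = mem 4 ∧ Core V.objs E G n (mem₁ 2) (mem₁ 3) S₁ ∧
          Gather V (mem₁ 0) (mem₁ 1) (mem₁ 3) (mem₁ 5) len i j :=
      fun ρ₂ w a b c d e f g => ⟨21 * (len - (i + 1)), by omega, i + 1, j, rfl,
        fun r hr => by rw [a r hr, hρ r hr], b, c, d, e, m0, m2, m4, hcore, hg.skip hi g⟩
    refine vc_load (mem₁ 5 i) (by rw [r10]) ?_
    refine vc_add (i + 1) (by simp [r10, r6]) ?_
    refine vc_load (mem₁ 1 (mem₁ 5 i)) (by simp) ?_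
    refine vc_ite 1 (mem₁ 1 (mem₁ 5 i)) (by simp [r6]) (by simp) (fun hside => ?_) (fun hside => ?_)
    · refine vc_load (mem₁ 0 (mem₁ 5 i)) (by simp) ?_
      refine vc_ite 0 (mem₁ 0 (mem₁ 5 i)) (by simp [r5]) (by simp) (fun hm => ?_) (fun hm => ?_)
      · refine vc_load (mem₁ 3 (mem₁ 5 i)) (by simp) ?_
        refine vc_ite (mem₁ 3 (mem₁ 5 i)) 1 (by simp) (by simp [r6]) (fun hf => ?_) (fun hf => ?_)
        · obtain ⟨⟨s, x⟩, hx⟩ := Option.ne_none_iff_exists'.1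
            (hg.inv.present (h := mem₁ 5 i) (by omega))
          have hs := hg.inv.side_eq _ _ _ hx
          have hst : s = true := by
            cases s
            · simp at hs; omega
            · rfl
          subst hst
          have hf0 : mem₁ 3 (mem₁ 5 i) = 0 := by omega
          refine vc_store j (mem₁ 5 i) (by simp [r11]) (by simp) ?_
          refine vc_add (j + 1) (by simp [r11, r6]) ?_
          refine vc_add (mem₁ 5 i) (by simp [r5]) ?_
          refine vc_add 3 (by simp [r18, r5]) ?_
          refine vc_place (E := E) (G := G) (mem₁ 5 i) 3 x (by simpa using hcore) (by simp)
            (by simp) (objs_of hx) (by simpa using hf0) (by omega) (by omega) ?_ ?_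
          · intro g hg3 hgx
            simp only [ne_eq, Nat.reduceEqDiff, not_false_eq_true, Function.update_of_ne] at hg3
            have hgp : V g ≠ none := objs_ne_none.1 (by simp [hgx])
            rcases hg.inv.of_fam (h := g) (by omega) hgp with h | h | ⟨-, -, z, hz⟩
            · omega
            · omega
            · rw [objs_of hz] at hgx
              cases hgx
              have := hV g (mem₁ 5 i) (by rw [hz, hx]) hgp
              rw [this] at hg3
              omega
          · intro ρ₂ S₂ w₂ hρ₂ hw₂ hc₂
            refine ⟨21 * (len - (i + 1)), by omega, i + 1, j + 1, rfl, ?_, ?_, ?_, ?_, ?_, ?_,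
              ?_, ?_, ?_, ?_⟩
            · intro r hr
              rw [← hρ r hr]
              dsimp only
              rw [hρ₂ r (by omega)]
              iterate 8 rw [Function.update_of_ne (by omega)]
            · simp [hρ₂]
            · simp [hρ₂]
            · simp [hρ₂, r17]
            · simp [hρ₂, r18]
            · simpa using m0
            · simpa using m2
            · simpa using m4
            · simpa using hc₂
            · have := hg.push (fam' := Function.update (mem₁ 3) (mem₁ 5 i) 3) hi rfl
                ⟨⟨x, hx⟩, by omega⟩ hf0 (by simp) (by intro u hu; simp [hu])
              simpa using this
        · simp only [vc]
          refine hskip _ _ ?_ (by simp) (by simp [r11]) (by simp [r17]) (by simp [r18]) (by omega) ?_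
          · intro r hr
            iterate 5 rw [Function.update_of_ne (by omega)]
          · intro _; omega
      · simp only [vc]
        refine hskip _ _ ?_ (by simp) (by simp [r11]) (by simp [r17]) (by simp [r18]) (by omega) ?_
        · intro r hr
          iterate 4 rw [Function.update_of_ne (by omega)]
        · rintro ⟨-, h⟩; omega
    · simp only [vc]
      refine hskip _ _ ?_ (by simp) (by simp [r11]) (by simp [r17]) (by simp [r18]) (by omega) ?_
      · intro r hr
        iterate 3 rw [Function.update_of_ne (by omega)]
      · rintro ⟨⟨x, hx⟩, -⟩
        have := hg.inv.side_eq _ _ _ hx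
        simp at this
        omega
  · rintro k' ρ₁ mem₁ S₁ w ⟨i, j, rfl, hρ, r10, r11, r17, r18, m0, m2, m4, hcore, hg⟩ hle hw
    have r2 : ρ₁ 2 = E := by rw [hρ 2 (by omega), h2]
    have r4 : ρ₁ 4 = len := by rw [hρ 4 (by omega), h4]
    have r5 : ρ₁ 5 = 0 := by rw [hρ 5 (by omega), h5]
    obtain rfl : i = len := by have := hg.le_len; omega
    refine vc_add j (by simp [r11, r5]) ?_
    refine vc_add (E + 2) (by simp [r2, r17]) ?_
    simp only [vc]
    refine hQ _ mem₁ S₁ j _ ?_ (by simp) (by simp) (by simp [r17]) (by omega) m0 m2 m4 hcore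
      (hg.auction hcore.fam_lt)
    intro r hr hr4
    rw [Function.update_of_ne (by omega), Function.update_of_ne (by omega), hρ r hr]

/-- Remove the listed objects from their families. -/
def cleanUp : Prog :=
  .seq (.const 10 0) (.loop 10 4 (.seq (.load 20 5 10) (.seq (.add 10 10 6) evict)))

/-- Prices are kept only during the auction. The list contains all matched items, so evicting its
entries leaves no matched object in a family. -/
theorem vc_cleanUp {V : TwoSets C} {E G n : ℕ} {ρ : ℕ → ℕ} {mem : ℕ → ℕ → ℕ} {S : ℕ → Store C}
    {Q : AState C → ℕ → Prop} {len : ℕ}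
    (hc : Core V.objs E G n (mem 2) (mem 3) S)
    (ha : Auction V E (mem 0) (mem 1) (mem 3) (mem 5) len len 0)
    (h5 : ρ 5 = 0) (h6 : ρ 6 = 1) (h4 : ρ 4 = len)
    (hcount : ∀ j < G, mem 4 (j * (E + 3)) =
      {h | V.objs h ≠ none ∧ mem 2 h = j * (E + 3)}.ncard)
    (hQ : ∀ ρ' mem' S' w, (∀ r < 10, ρ' r = ρ r) → w ≤ 10 * len + 2 → mem' 0 = mem 0 →
      Calm V E G n mem' S' len 0 → Q ⟨ρ', mem', S'⟩ w) :
    vc V.objs n cleanUp ⟨ρ, mem, S⟩ Q := by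
  unfold cleanUp
  refine vc_const ?_
  refine vc_loop (fun k ρ' mem' S' => ∃ i, k = 10 * (len - i) ∧ (∀ r < 10, ρ' r = ρ r) ∧
    ρ' 10 = i ∧ i ≤ len ∧ mem' 0 = mem 0 ∧ mem' 2 = mem 2 ∧
    mem' 4 = mem 4 ∧ mem' 5 = mem 5 ∧ Core V.objs E G n (mem' 2) (mem' 3) S' ∧
    Inv V (mem' 0) (mem' 1) (mem' 3) 0 ∧
    ∀ u, mem 0 u ≠ 0 → mem' 3 u = 0 ∨ ∃ k, i ≤ k ∧ k < len ∧ mem 5 k = u) (10 * len) ?_ ?_ ?_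
  · refine ⟨0, by simp, ?_, by simp, Nat.zero_le _, rfl, rfl, rfl, rfl, hc, ha.inv, ?_⟩
    · intro r hr
      rw [Function.update_of_ne (by omega)]
    · intro u hu
      obtain ⟨⟨s, x⟩, hx⟩ := Option.ne_none_iff_exists'.1 (ha.inv.present hu)
      rcases ha.inv.matched u s x hx hu with h | ⟨rfl, -⟩
      · exact .inl h
      · obtain ⟨k, hk⟩ := ha.list.all u ⟨⟨x, hx⟩, hu⟩
        exact .inr ⟨k, Nat.zero_le _, hk⟩
  · rintro k ρ₁ mem₁ S₁ ⟨i, rfl, hρ, r10, hle, m0, m2, m4, m5, hcore, hinv, hidle⟩ hlt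
    have r4 : ρ₁ 4 = len := by rw [hρ 4 (by omega), h4]
    have r5 : ρ₁ 5 = 0 := by rw [hρ 5 (by omega), h5]
    have r6 : ρ₁ 6 = 1 := by rw [hρ 6 (by omega), h6]
    have hi : i < len := by omega
    have hmi : mem 5 i ∈ matchedItems V (mem 0) := ha.list.mem i hi
    refine vc_load (mem 5 i) (by rw [r10, m5]) ?_
    refine vc_add (i + 1) (by simp [r10, r6]) ?_
    refine vc_evict (mem 5 i) hcore (by simp [r5]) (by simp) ?_
    intro ρ₂ S₂ w₂ hρ₂ hw₂ hc₂
    refine ⟨10 * (len - (i + 1)), by omega, i + 1, rfl, ?_, by simp [hρ₂], hi, by simpa using m0,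
      by simpa using m2, by simpa using m4, by simpa using m5, by simpa using hc₂, ?_, ?_⟩
    · intro r hr
      dsimp only
      rw [hρ₂ r (by omega), Function.update_of_ne (by omega), Function.update_of_ne (by omega),
        hρ r hr]
    · have := hinv.mono_fam (fam' := Function.update (mem₁ 3) (mem 5 i) 0) (by
        intro u
        by_cases hu : u = mem 5 i
        · subst hu; exact .inr ⟨by rw [m0]; exact hmi.2, .inl (by simp)⟩
        · exact .inl (by simp [hu]))
      simpa using this
    · intro u hu
      simp only [Function.update_self]
      by_cases hui : u = mem 5 i
      · simp [hui]
      rw [Function.update_of_ne hui]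
      rcases hidle u hu with h | ⟨k, hk, hkl, rfl⟩
      · exact .inl h
      · have hki : k ≠ i := by rintro rfl; exact hui rfl
        exact .inr ⟨k, by omega, hkl, rfl⟩
  · rintro k ρ₁ mem₁ S₁ w ⟨i, rfl, hρ, r10, hle, m0, m2, m4, m5, hcore, hinv, hidle⟩ hge hw
    have r4 : ρ₁ 4 = len := by rw [hρ 4 (by omega), h4]
    refine hQ ρ₁ mem₁ S₁ _ hρ (by omega) m0 ⟨hcore, hinv, ?_, ?_, ?_⟩
    · intro u hu
      rw [m0] at hu
      rcases hidle u hu with h | ⟨k, hk, hkl, -⟩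
      · exact h
      · omega
    · intro b hb
      rw [m0] at hb
      rw [m5]
      exact ha.list.all b hb
    · rw [m2, m4]
      exact hcount

end

/-! ### The auction -/

section
variable {X : Type u} {C : Set (Set X)}

/-- Search the families `2, …, E + 1` in this order for an object that meets the bidder whose
successor is in register 11. -/
def scan (G : ℕ) : Prog :=
  .seq (.sub 14 11 6) (.seq (.add 15 17 5) (.seq (.const 26 0) (.seq (.add 19 16 5)
    (.loop 15 19 (.seq (.add 24 15 5) (.seq (.add 25 14 5) (.seq (findFam G)
      (.ite 5 26 (.seq (.const 19 0) .skip) (.seq (.add 15 15 6) .skip)))))))))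

/-- The families are searched by increasing price, so the first hit is a cheapest item. Family `E +
2`, the maximal price, is left out, since no bid is allowed there. -/
theorem vc_scan {V : TwoSets C} {E G n : ℕ} {ρ : ℕ → ℕ} {mem : ℕ → ℕ → ℕ} {S : ℕ → Store C}
    {Q : AState C → ℕ → Prop} {a cur : ℕ} {x : C}
    (hc : Core V.objs E G n (mem 2) (mem 3) S) (hi : Inv V (mem 0) (mem 1) (mem 3) cur)
    (ha : V a = some (false, x)) (hitem : ∀ b, (bipGraph V).Adj a b → 2 ≤ mem 3 b)
    (h5 : ρ 5 = 0) (h6 : ρ 6 = 1) (h7 : ρ 7 = E + 3) (h11 : ρ 11 = a + 1) (h16 : ρ 16 = E + 2)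
    (h17 : ρ 17 = 2)
    (hQ : ∀ ρ' w, (∀ r < 19, r ≠ 14 → r ≠ 15 → ρ' r = ρ r) → ρ' 14 = a →
      w ≤ (4 * G + 8) * E + 5 →
      (ρ' 26 = 0 ∧ (∀ b, (bipGraph V).Adj a b → E + 2 ≤ mem 3 b)) ∨
      (∃ b, ρ' 26 = b + 1 ∧ ρ' 15 = mem 3 b ∧ (bipGraph V).Adj a b ∧ mem 3 b < E + 2 ∧
        ∀ b', (bipGraph V).Adj a b' → mem 3 b ≤ mem 3 b') →
      Q ⟨ρ', mem, S⟩ w) :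
    vc V.objs n (scan G) ⟨ρ, mem, S⟩ Q := by
  unfold scan
  refine vc_sub a (by simp [h11, h6]) ?_
  refine vc_add 2 (by simp [h17, h5]) ?_
  refine vc_const ?_
  refine vc_add (E + 2) (by simp [h16, h5]) ?_
  refine vc_loop (fun k ρ' mem' S' => mem' = mem ∧ S' = S ∧
    (∀ r < 19, r ≠ 14 → r ≠ 15 → ρ' r = ρ r) ∧ ρ' 14 = a ∧
    ((∃ l, k = (4 * G + 8) * (E + 2 - l) ∧ ρ' 15 = l ∧ ρ' 19 = E + 2 ∧ 2 ≤ l ∧ l ≤ E + 2 ∧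
      ρ' 26 = 0 ∧ (∀ b, (bipGraph V).Adj a b → l ≤ mem 3 b)) ∨
    (ρ' 19 = 0 ∧ ∃ b, ρ' 26 = b + 1 ∧ ρ' 15 = mem 3 b ∧ (bipGraph V).Adj a b ∧
      mem 3 b < E + 2 ∧ ∀ b', (bipGraph V).Adj a b' → mem 3 b ≤ mem 3 b')))
    ((4 * G + 8) * E) ?_ ?_ ?_
  · refine ⟨rfl, rfl, ?_, by simp, .inl ⟨2, by simp, by simp, by simp, le_rfl, by omega, by simp,
      hitem⟩⟩
    intro r hr h1 h2
    iterate 4 rw [Function.update_of_ne (by omega)]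
  · rintro k ρ₁ mem₁ S₁ ⟨rfl, rfl, hρ, r14, hst⟩ hlt
    rcases hst with ⟨l, rfl, r15, r19, hl2, hlE, r26, hmin⟩ | ⟨r19, -⟩
    · have r5 : ρ₁ 5 = 0 := by rw [hρ 5 (by omega) (by omega) (by omega), h5]
      have r6 : ρ₁ 6 = 1 := by rw [hρ 6 (by omega) (by omega) (by omega), h6]
      have r7 : ρ₁ 7 = E + 3 := by rw [hρ 7 (by omega) (by omega) (by omega), h7]
      have hlt' : l < E + 2 := by omega
      refine vc_add l (by simp [r15, r5]) ?_
      refine vc_add a (by simp [r14, r5]) ?_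
      refine vc_seq ?_
      refine vc_findFam a l x hc (by simp [r5]) (by simp [r7]) (by simp) (by simp)
        (objs_of ha) (by omega) (by omega) ?_
      intro ρ₂ w₂ hρ₂ hw₂ hnone hsome
      have hlow : ∀ r < 19, r ≠ 14 → r ≠ 15 → ρ₂ r = ρ r := by
        intro r hr h1 h2
        rw [hρ₂ r (by omega), Function.update_of_ne (by omega), Function.update_of_ne (by omega),
          hρ r hr h1 h2]
      have hstep : (4 * G + 8) * (E + 2 - l) = (4 * G + 8) * (E + 2 - (l + 1)) + (4 * G + 8) := by
        rw [show E + 2 - l = E + 2 - (l + 1) + 1 by omega]; ring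
      refine vc_ite 0 (ρ₂ 26) (by simp [hρ₂, r5]) rfl (fun hpos => ?_) (fun hpos => ?_)
      · obtain ⟨g, hg⟩ := Nat.exists_eq_succ_of_ne_zero (Nat.pos_iff_ne_zero.1 hpos)
        obtain ⟨hfg, y, hy, hmeet⟩ := hsome g hg
        have hVg : V g = some (true, y) := by
          rcases hi.of_fam (h := g) (by omega) (objs_ne_none.1 (by simp [hy])) with
            h | ⟨-, -, z, hz⟩ | ⟨-, -, z, hz⟩
          · omega
          all_goals
            rw [objs_of hz] at hy
            cases hy
            exact hz
        -- Setting the upper limit in register 19 to 0 leaves the loop while register 15 keeps the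
        -- family that was found.
        refine vc_const ?_
        simp only [vc]
        refine ⟨0, ?_, trivial, trivial, ?_, by simp [hρ₂, r14], .inr ⟨by simp, g, by simp [hg],
          by simp [hρ₂, r15, hfg], (bipGraph_adj_iff ha).2 ⟨y, by simpa using hVg, hmeet⟩,
          by omega, by rw [hfg]; exact hmin⟩⟩
        · omega
        · intro r hr h1 h2
          rw [Function.update_of_ne (by omega), hlow r hr h1 h2]
      · refine vc_add (l + 1) (by simp [hρ₂, r15, r6]) ?_
        simp only [vc]
        refine ⟨(4 * G + 8) * (E + 2 - (l + 1)), by omega, trivial, trivial, ?_, by simp [hρ₂, r14],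
          .inl ⟨l + 1, rfl, by simp, by simp [hρ₂, r19], by omega, hlt', by
            simp; omega, ?_⟩⟩
        · intro r hr h1 h2
          rw [Function.update_of_ne h2, hlow r hr h1 h2]
        · intro b hb
          have h1 := hmin b hb
          obtain ⟨y, hy, hm⟩ := (bipGraph_adj_iff ha).1 hb
          have h2 : mem₁ 3 b ≠ l := fun h2 => hnone (by omega) b h2 y (objs_of hy) hm
          omega
    · omega
  · rintro k ρ₁ mem₁ S₁ w ⟨rfl, rfl, hρ, r14, hst⟩ hle hw
    refine hQ ρ₁ _ hρ r14 (by omega) ?_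
    rcases hst with ⟨l, rfl, r15, r19, hl2, hlE, r26, hmin⟩ | ⟨-, hst⟩
    · obtain rfl : l = E + 2 := by omega
      exact .inl ⟨r26, hmin⟩
    · exact .inr hst

/-- The state of the program during the auction, with the registers before the auction, the offsets
and the sizes of the parts. -/
structure Stage (V : TwoSets C) (E G n : ℕ) (ρ₀ off cnt : ℕ → ℕ) (ρ : ℕ → ℕ) (mem : ℕ → ℕ → ℕ)
    (S : ℕ → Store C) (len i cur : ℕ) : Prop where
  low : ∀ r < 10, r ≠ 4 → ρ r = ρ₀ r
  r4 : ρ 4 = len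
  r10 : ρ 10 = i
  r11 : ρ 11 = cur
  r16 : ρ 16 = E + 2
  r17 : ρ 17 = 2
  off_eq : mem 2 = off
  cnt_eq : mem 4 = cnt
  core : Core V.objs E G n (mem 2) (mem 3) S
  auction : Auction V E (mem 0) (mem 1) (mem 3) (mem 5) len i cur

/-- Let the bidder whose successor is in register 11 bid. -/
def bid (G : ℕ) : Prog :=
  .seq (scan G) (.ite 5 26
    (.seq (.sub 20 26 6) (.seq (.load 12 0 20) (.seq (.store 0 14 26) (.seq (.store 0 20 11)
      (.seq evict (.seq (.add 21 15 6) (.seq place (.ite 5 12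
        (.seq (.sub 13 12 6) (.seq (.store 0 13 5) (.seq (.add 11 12 5) .skip)))
        (.seq (.store 5 4 20) (.seq (.add 4 4 6) (.seq (.add 11 12 5) .skip)))))))))))
    (.seq (.add 20 14 5) (.seq (.add 21 6 5) (.seq place (.seq (.const 11 0) .skip)))))

theorem raised_congr {V : TwoSets C} {mate fam fam' L : ℕ → ℕ} {len a : ℕ} {x : C}
    (hl : ListsItems V mate L len) (ha : V a = some (false, x))
    (fo : ∀ u, u ≠ a → fam' u = fam u) : raised fam' L len = raised fam L len := by
  refine Finset.sum_congr rfl fun k hk => ?_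
  obtain ⟨⟨y, hy⟩, -⟩ := hl.mem k (Finset.mem_range.1 hk)
  rw [fo]
  rintro rfl
  simp [ha] at hy

/-- A bid either raises the total price or ends with a bidder giving up. In the latter case the
maximality of all prices it meets is recorded, which shows that a bidder just taken for an
affordable item does not give up. -/
theorem vc_bid {V : TwoSets C} {E G n : ℕ} {ρ₀ off cnt ρ : ℕ → ℕ} {mem : ℕ → ℕ → ℕ}
    {S : ℕ → Store C} {Q : AState C → ℕ → Prop} {len i a : ℕ} (hV : Distinct V) (hE : 0 < E)
    (hs : Stage V E G n ρ₀ off cnt ρ mem S len i (a + 1))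
    (h5 : ρ₀ 5 = 0) (h6 : ρ₀ 6 = 1) (h7 : ρ₀ 7 = E + 3)
    (hQ : ∀ ρ' mem' S' len' cur' w, w ≤ (4 * G + 8) * E + 40 →
      Stage V E G n ρ₀ off cnt ρ' mem' S' len' i cur' →
      (raised (mem 3) (mem 5) len + 1 ≤ raised (mem' 3) (mem' 5) len' ∨
      (cur' = 0 ∧ raised (mem' 3) (mem' 5) len' = raised (mem 3) (mem 5) len ∧
        ∀ b, (bipGraph V).Adj a b → E + 2 ≤ mem 3 b)) →
      Q ⟨ρ', mem', S'⟩ w) :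
    vc V.objs n (bid G) ⟨ρ, mem, S⟩ Q := by
  have hau := hs.auction
  obtain ⟨x, hx⟩ := hau.curA a rfl
  obtain ⟨-, hma, hfa⟩ := hau.inv.cur_spec a rfl
  have r5 : ρ 5 = 0 := by rw [hs.low 5 (by omega) (by omega), h5]
  have r6 : ρ 6 = 1 := by rw [hs.low 6 (by omega) (by omega), h6]
  have r7 : ρ 7 = E + 3 := by rw [hs.low 7 (by omega) (by omega), h7]
  unfold bid
  refine vc_seq ?_
  refine vc_scan hs.core hau.inv hx (fun b hb => ?_) r5 r6 r7 hs.r11 hs.r16 hs.r17 ?_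
  · obtain ⟨y, hy⟩ := bipGraph_adj_right hb hx
    exact hau.fam_item hy
  intro ρ₁ w₁ hρ₁ q14 hw₁ hres
  have q4 : ρ₁ 4 = len := by rw [hρ₁ 4 (by omega) (by omega) (by omega), hs.r4]
  have q5 : ρ₁ 5 = 0 := by rw [hρ₁ 5 (by omega) (by omega) (by omega), r5]
  have q6 : ρ₁ 6 = 1 := by rw [hρ₁ 6 (by omega) (by omega) (by omega), r6]
  have q10 : ρ₁ 10 = i := by rw [hρ₁ 10 (by omega) (by omega) (by omega), hs.r10]
  have q11 : ρ₁ 11 = a + 1 := by rw [hρ₁ 11 (by omega) (by omega) (by omega), hs.r11]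
  have q16 : ρ₁ 16 = E + 2 := by rw [hρ₁ 16 (by omega) (by omega) (by omega), hs.r16]
  have q17 : ρ₁ 17 = 2 := by rw [hρ₁ 17 (by omega) (by omega) (by omega), hs.r17]
  have qlow : ∀ r < 10, r ≠ 4 → ρ₁ r = ρ₀ r := by
    intro r hr hr4
    rw [hρ₁ r (by omega) (by omega) (by omega), hs.low r hr hr4]
  rcases hres with ⟨q26, hno⟩ | ⟨b, q26, q15, hadj, hlt, hmin⟩
  · refine vc_ite 0 0 q5 q26 (fun h => absurd h (lt_irrefl _)) (fun _ => ?_)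
    refine vc_add a (by simp [q14, q5]) ?_
    refine vc_add 1 (by simp [q6, q5]) ?_
    refine vc_seq ?_
    refine vc_place a 1 x hs.core (by simp) (by simp) (objs_of hx) hfa (by omega) (by omega) ?_ ?_
    · intro g hg hgx
      have hVg := (hau.inv.of_fam_free (s := false) (by simpa using hg) hgx).2
      have := hV g a (by rw [hVg, hx]) (by simp [hVg])
      rw [this] at hg
      omega
    · intro ρ₂ S₂ w₂ hρ₂ hw₂ hc₂
      refine vc_const ?_
      simp only [vc]
      refine hQ _ _ S₂ len 0 _ (by omega) ⟨?_, ?_, ?_, ?_, ?_, ?_, ?_, ?_, ?_, ?_⟩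
        (.inr ⟨rfl, ?_, hno⟩)
      · intro r hr hr4
        rw [Function.update_of_ne (by omega), hρ₂ r (by omega), Function.update_of_ne (by omega),
          Function.update_of_ne (by omega), qlow r hr hr4]
      · simp [hρ₂, q4]
      · simp [hρ₂, q10]
      · simp
      · simp [hρ₂, q16]
      · simp [hρ₂, q17]
      · simpa using hs.off_eq
      · simpa using hs.cnt_eq
      · simpa using hc₂
      · have := hau.giveUp (fam' := Function.update (mem 3) a 1) hno (by simp)
          (by intro u hu; simp [hu]) hE
        simpa using this
      · have := raised_congr (fam := mem 3) (fam' := Function.update (mem 3) a 1) hau.list hx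
          (by intro u hu; simp [hu])
        simpa using this
  · obtain ⟨y, hy⟩ := bipGraph_adj_right hadj hx
    have hb2 := hau.fam_item hy
    have hne : a ≠ b := hadj.ne
    refine vc_ite 0 (b + 1) q5 q26 (fun _ => ?_) (fun h => absurd h (by omega))
    refine vc_sub b (by simp [q26, q6]) ?_
    -- The former partner is read before it is overwritten; it decides whether the item is new to
    -- the list and who bids next.
    refine vc_load (mem 0 b) (by simp) ?_
    refine vc_store a (b + 1) (by simp [q14]) (by simp [q26]) ?_
    refine vc_store b (a + 1) (by simp) (by simp [q11]) ?_
    refine vc_seq ?_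
    refine vc_evict (ob := V.objs) (E := E) (G := G) b (by simpa using hs.core) (by simp [q5])
      (by simp) ?_
    intro ρ₂ S₂ w₂ hρ₂ hw₂ hc₂
    refine vc_add (mem 3 b + 1) (by simp [hρ₂, q15, q6]) ?_
    refine vc_seq ?_
    refine vc_place (E := E) (G := G) b (mem 3 b + 1) y (by simpa using hc₂) (by simp [hρ₂])
      (by simp) (objs_of hy) (by simp) (by omega) (by omega) ?_ ?_
    · intro g hg hgy
      have hgb : g ≠ b := by
        rintro rfl
        simp at hg
      have hg' : mem 3 g = mem 3 b + 1 := by simpa [hgb] using hg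
      have hgp : V g ≠ none := objs_ne_none.1 (by simp [hgy])
      rcases hau.inv.of_fam (h := g) (by omega) hgp with h | h | ⟨-, -, z, hz⟩
      · omega
      · omega
      · rw [objs_of hz] at hgy
        cases hgy
        exact hgb (hV g b (by rw [hz, hy]) hgp)
    · intro ρ₃ S₃ w₃ hρ₃ hw₃ hc₃
      have t4 : ρ₃ 4 = len := by simp [hρ₃, hρ₂, q4]
      have t5 : ρ₃ 5 = 0 := by simp [hρ₃, hρ₂, q5]
      have t6 : ρ₃ 6 = 1 := by simp [hρ₃, hρ₂, q6]
      have t10 : ρ₃ 10 = i := by simp [hρ₃, hρ₂, q10]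
      have t12 : ρ₃ 12 = mem 0 b := by simp [hρ₃, hρ₂]
      have t16 : ρ₃ 16 = E + 2 := by simp [hρ₃, hρ₂, q16]
      have t17 : ρ₃ 17 = 2 := by simp [hρ₃, hρ₂, q17]
      have t20 : ρ₃ 20 = b := by simp [hρ₃, hρ₂]
      have tlow : ∀ r < 10, r ≠ 4 → ρ₃ r = ρ₀ r := by
        intro r hr hr4
        rw [hρ₃ r (by omega), Function.update_of_ne (by omega), hρ₂ r (by omega),
          Function.update_of_ne (by omega), Function.update_of_ne (by omega), qlow r hr hr4]
      refine vc_ite 0 (mem 0 b) t5 t12 (fun hpos => ?_) (fun hpos => ?_)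
      · obtain ⟨p, hp⟩ := Nat.exists_eq_succ_of_ne_zero (Nat.pos_iff_ne_zero.1 hpos)
        have hpm := hau.inv.mate_symm b p hp
        have hpa : p ≠ a := by rintro rfl; omega
        have hpb : p ≠ b := (hau.inv.mate_adj b p hp).ne'
        refine vc_sub p (by simp [t12, t6, hp]) ?_
        refine vc_store p 0 (by simp) (by simp [t5]) ?_
        refine vc_add (mem 0 b) (by simp [t12, t5]) ?_
        have key := hau.bid
          (mate' := Function.update (Function.update (Function.update (mem 0) a (b + 1)) b (a + 1))
            p 0)
          (fam' := Function.update (mem 3) b (mem 3 b + 1)) (L' := mem 5) (len' := len) hadj hlt hmin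
          (by simp [hpa.symm, hne]) (by simp [hpb.symm])
          (by intro q hq; rw [show q = p by omega]; simp)
          (by
            intro u h1 h2 h3
            rw [Function.update_of_ne (by omega), Function.update_of_ne h2,
              Function.update_of_ne h1])
          (by simp) (by intro u hu; simp [hu]) (.inr ⟨by omega, rfl, rfl⟩)
        simp only [vc]
        refine hQ _ _ S₃ len (mem 0 b) _ (by omega) ⟨?_, ?_, ?_, ?_, ?_, ?_, ?_, ?_, ?_, ?_⟩
          (.inl ?_)
        · intro r hr hr4
          rw [Function.update_of_ne (by omega), Function.update_of_ne (by omega), tlow r hr hr4]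
        · simp [t4]
        · simp [t10]
        · simp
        · simp [t16]
        · simp [t17]
        · simpa using hs.off_eq
        · simpa using hs.cnt_eq
        · simpa using hc₃
        · simpa using key.1
        · simpa using key.2
      · have hm0 : mem 0 b = 0 := by omega
        refine vc_store len b (by simp [t4]) (by simp [t20]) ?_
        refine vc_add (len + 1) (by simp [t4, t6]) ?_
        refine vc_add (mem 0 b) (by simp [t12, t5]) ?_
        have key := hau.bid
          (mate' := Function.update (Function.update (mem 0) a (b + 1)) b (a + 1))
          (fam' := Function.update (mem 3) b (mem 3 b + 1)) (L' := Function.update (mem 5) len b)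
          (len' := len + 1) hadj hlt hmin
          (by simp [hne]) (by simp)
          (by intro q hq; omega)
          (by intro u h1 h2 h3; rw [Function.update_of_ne h2, Function.update_of_ne h1])
          (by simp) (by intro u hu; simp [hu]) (.inl ⟨hm0, rfl, rfl⟩)
        simp only [vc]
        refine hQ _ _ S₃ (len + 1) (mem 0 b) _ (by omega) ⟨?_, ?_, ?_, ?_, ?_, ?_, ?_, ?_, ?_, ?_⟩
          (.inl ?_)
        · intro r hr hr4
          rw [Function.update_of_ne (by omega), Function.update_of_ne (by omega), tlow r hr hr4]
        · simp
        · simp [t10]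
        · simp
        · simp [t16]
        · simp [t17]
        · simpa using hs.off_eq
        · simpa using hs.cnt_eq
        · simpa using hc₃
        · simpa using key.1
        · simpa using key.2

/-- If no bidder is active, look for a free one that meets the current item, and move on to the next
item if there is none or the price of the item is maximal. -/
def take (G : ℕ) : Prog :=
  .ite 5 11 .skip (.seq (.load 12 5 10) (.seq (.load 13 3 12) (.ite 13 16
    (.seq (.add 24 6 5) (.seq (.add 25 12 5) (.seq (findFam G) (.ite 5 26
      (.seq (.add 11 26 5) (.seq (.sub 20 26 6) evict))
      (.seq (.add 10 10 6) .skip)))))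
    (.seq (.add 10 10 6) .skip))))

theorem vc_take {V : TwoSets C} {E G n : ℕ} {ρ₀ off cnt ρ : ℕ → ℕ} {mem : ℕ → ℕ → ℕ}
    {S : ℕ → Store C} {Q : AState C → ℕ → Prop} {len i cur : ℕ}
    (hs : Stage V E G n ρ₀ off cnt ρ mem S len i cur) (hi : i < len)
    (h5 : ρ₀ 5 = 0) (h6 : ρ₀ 6 = 1) (h7 : ρ₀ 7 = E + 3)
    (hQ : ∀ ρ' mem' S' i' cur' w, w ≤ 4 * G + 20 →
      Stage V E G n ρ₀ off cnt ρ' mem' S' len i' cur' →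
      raised (mem' 3) (mem' 5) len = raised (mem 3) (mem 5) len →
      (cur ≠ 0 ∧ i' = i ∧ cur' = cur ∨ cur = 0 ∧ cur' = 0 ∧ i' = i + 1 ∨
        cur = 0 ∧ i' = i ∧ ∃ a b, cur' = a + 1 ∧ (bipGraph V).Adj a b ∧ mem' 3 b < E + 2) →
      Q ⟨ρ', mem', S'⟩ w) :
    vc V.objs n (take G) ⟨ρ, mem, S⟩ Q := by
  have hau := hs.auction
  have r5 : ρ 5 = 0 := by rw [hs.low 5 (by omega) (by omega), h5]
  have r6 : ρ 6 = 1 := by rw [hs.low 6 (by omega) (by omega), h6]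
  have r7 : ρ 7 = E + 3 := by rw [hs.low 7 (by omega) (by omega), h7]
  unfold take
  refine vc_ite 0 cur r5 hs.r11 (fun hpos => ?_) (fun hpos => ?_)
  · simp only [vc]
    exact hQ ρ mem S i cur _ (by omega) hs rfl (.inl ⟨by omega, rfl, rfl⟩)
  obtain rfl : cur = 0 := by omega
  have hadv : ∀ (ρ' : ℕ → ℕ) (w : ℕ), w ≤ 4 * G + 20 → (∀ r < 10, ρ' r = ρ r) → ρ' 10 = i + 1 →
      ρ' 11 = ρ 11 → ρ' 16 = ρ 16 → ρ' 17 = ρ 17 →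
      (E + 2 ≤ mem 3 (mem 5 i) ∨ ∀ a, (bipGraph V).Adj a (mem 5 i) → mem 3 a ≠ 1) →
      Q ⟨ρ', mem, S⟩ w := by
    intro ρ' w hw hlow h10 h11 h16 h17 hd
    refine hQ ρ' mem S (i + 1) 0 w hw ⟨?_, ?_, h10, ?_, ?_, ?_, hs.off_eq, hs.cnt_eq, hs.core,
      hau.advance hi hd⟩ rfl (.inr (.inl ⟨rfl, rfl, rfl⟩))
    · intro r hr hr4; rw [hlow r hr, hs.low r hr hr4]
    · rw [hlow 4 (by omega), hs.r4]
    · rw [h11, hs.r11]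
    · rw [h16, hs.r16]
    · rw [h17, hs.r17]
  obtain ⟨⟨y, hy⟩, hmy⟩ := hau.list.mem i hi
  refine vc_load (mem 5 i) (by rw [hs.r10]) ?_
  refine vc_load (mem 3 (mem 5 i)) (by simp) ?_
  refine vc_ite (mem 3 (mem 5 i)) (E + 2) (by simp) (by simp [hs.r16]) (fun hlt => ?_)
    (fun hge => ?_)
  · refine vc_add 1 (by simp [r6, r5]) ?_
    refine vc_add (mem 5 i) (by simp [r5]) ?_
    refine vc_seq ?_
    refine vc_findFam (mem 5 i) 1 y hs.core (by simp [r5]) (by simp [r7]) (by simp) (by simp)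
      (objs_of hy) (by omega) (by omega) ?_
    intro ρ₁ w₁ hρ₁ hw₁ hnone hsome
    refine vc_ite 0 (ρ₁ 26) (by simp [hρ₁, r5]) rfl (fun hpos => ?_) (fun hpos => ?_)
    · obtain ⟨a, ha⟩ := Nat.exists_eq_succ_of_ne_zero (Nat.pos_iff_ne_zero.1 hpos)
      obtain ⟨hfa, x, hx, hmeet⟩ := hsome a ha
      have hVa := (hau.inv.of_fam_free (s := false) (by simpa using hfa) hx).2
      have hadj : (bipGraph V).Adj a (mem 5 i) :=
        ((bipGraph_adj_iff hy).2 ⟨x, hVa, hmeet⟩).symm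
      have hne : a ≠ mem 5 i := hadj.ne
      refine vc_add (a + 1) (by simp [ha, hρ₁, r5]) ?_
      refine vc_sub a (by simp [ha, hρ₁, r6]) ?_
      refine vc_evict a hs.core (by simp [hρ₁, r5]) (by simp) ?_
      intro ρ₂ S₂ w₂ hρ₂ hw₂ hc₂
      refine hQ _ _ S₂ i (a + 1) _ (by omega) ⟨?_, ?_, ?_, ?_, ?_, ?_, ?_, ?_, ?_, ?_⟩ ?_
        (.inr (.inr ⟨rfl, rfl, a, mem 5 i, rfl, hadj, by simpa [hne.symm] using hlt⟩))
      · intro r hr hr4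
        rw [hρ₂ r (by omega), Function.update_of_ne (by omega), Function.update_of_ne (by omega),
          hρ₁ r (by omega)]
        iterate 4 rw [Function.update_of_ne (by omega)]
        exact hs.low r hr hr4
      · simp [hρ₂, hρ₁, hs.r4]
      · simp [hρ₂, hρ₁, hs.r10]
      · simp [hρ₂]
      · simp [hρ₂, hρ₁, hs.r16]
      · simp [hρ₂, hρ₁, hs.r17]
      · simpa using hs.off_eq
      · simpa using hs.cnt_eq
      · simpa using hc₂
      · have := hau.take (fam' := Function.update (mem 3) a 0) hi (by simp [hVa]) hfa (by simp)
          (by intro u hu; simp [hu])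
        simpa using this
      · have := raised_congr (fam := mem 3) (fam' := Function.update (mem 3) a 0) hau.list hVa
          (by intro u hu; simp [hu])
        simpa using this
    · refine vc_add (i + 1) (by simp [hρ₁, hs.r10, r6]) ?_
      simp only [vc]
      refine hadv _ _ (by omega) ?_ (by simp) (by simp [hρ₁]) (by simp [hρ₁]) (by simp [hρ₁])
        (.inr ?_)
      · intro r hr
        rw [Function.update_of_ne (by omega), hρ₁ r (by omega)]
        iterate 4 rw [Function.update_of_ne (by omega)]
      · intro a ha hfa
        obtain ⟨x, hx, hm⟩ := (bipGraph_adj_iff hy).1 ha.symm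
        exact hnone (by omega) a hfa x (objs_of hx) hm
  · refine vc_add (i + 1) (by simp [hs.r10, r6]) ?_
    simp only [vc]
    refine hadv _ _ (by omega) ?_ (by simp) (by simp) (by simp) (by simp) (.inl hge)
    intro r hr
    iterate 3 rw [Function.update_of_ne (by omega)]

/-- The auction: every active bidder bids, bidders are taken as long as there is one that meets a
listed item whose price is not maximal. -/
def auctionLoop (G : ℕ) : Prog :=
  .seq (.const 10 0) (.seq (.const 11 0) (.loop 10 4 (.seq (take G) (.ite 5 11 (bid G) .skip))))

/-- A bound for the work in one round of the auction. -/
def roundCost (E G : ℕ) : ℕ := (4 * G + 8) * E + 4 * G + 80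

theorem vc_auctionLoop {V : TwoSets C} {E G n K : ℕ} {ρ : ℕ → ℕ} {mem : ℕ → ℕ → ℕ}
    {S : ℕ → Store C} {Q : AState C → ℕ → Prop} {len : ℕ} (hV : Distinct V) (hE : 0 < E)
    (hK : OptLe V K) (hc : Core V.objs E G n (mem 2) (mem 3) S)
    (ha : Auction V E (mem 0) (mem 1) (mem 3) (mem 5) len 0 0)
    (h5 : ρ 5 = 0) (h6 : ρ 6 = 1) (h7 : ρ 7 = E + 3) (h4 : ρ 4 = len) (h16 : ρ 16 = E + 2)
    (h17 : ρ 17 = 2)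
    (hQ : ∀ ρ' mem' S' len' w, (∀ r < 10, r ≠ 4 → ρ' r = ρ r) → ρ' 4 = len' →
      w ≤ roundCost E G * (2 * (E * K) + K) + 3 → mem' 2 = mem 2 → mem' 4 = mem 4 →
      Core V.objs E G n (mem' 2) (mem' 3) S' →
      Auction V E (mem' 0) (mem' 1) (mem' 3) (mem' 5) len' len' 0 → Q ⟨ρ', mem', S'⟩ w) :
    vc V.objs n (auctionLoop G) ⟨ρ, mem, S⟩ Q := by
  unfold auctionLoop
  refine vc_const (vc_const ?_)
  -- The potential is twice the price increase still possible, plus one for an active bidder, plus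
  -- `K - i`. A successful bid lowers the first term by at least 2 and can activate at most one
  -- bidder; giving up removes an active bidder; otherwise `i` advances. So each round lowers it by
  -- at least one.
  refine vc_loop (fun k ρ' mem' S' => ∃ len i cur,
    k = roundCost E G * (2 * (E * K - raised (mem' 3) (mem' 5) len) + (if cur = 0 then 0 else 1) +
      (K - i)) ∧ Stage V E G n ρ (mem 2) (mem 4) ρ' mem' S' len i cur)
    (roundCost E G * (2 * (E * K - raised (mem 3) (mem 5) len) + K)) ?_ ?_ ?_
  · refine ⟨len, 0, 0, by simp, ?_, by simp [h4], by simp, by simp, by simp [h16], by simp [h17],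
      rfl, rfl, hc, ha⟩
    intro r hr _
    rw [Function.update_of_ne (by omega), Function.update_of_ne (by omega)]
  · rintro k ρ₁ mem₁ S₁ ⟨len, i, cur, rfl, hs⟩ hlt
    have hi : i < len := by rw [hs.r10, hs.r4] at hlt; exact hlt
    have hlK := hs.auction.list.le_opt hs.auction.inv hK
    refine vc_seq ?_
    refine vc_take hs hi h5 h6 h7 ?_
    intro ρ₂ mem₂ S₂ i₂ cur₂ w₂ hw₂ hs₂ hr₂ hcase
    rw [← hr₂]
    have hR₂ := hs₂.auction.raised_le hK
    have fin : ∀ (A B w : ℕ), A + 1 ≤ B → w + 1 ≤ roundCost E G →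
        roundCost E G * A + w + 1 ≤ roundCost E G * B := by
      intro A B w hAB hw
      calc roundCost E G * A + w + 1 ≤ roundCost E G * (A + 1) := by rw [mul_add]; omega
        _ ≤ _ := Nat.mul_le_mul_left _ hAB
    refine vc_ite 0 cur₂ (by rw [hs₂.low 5 (by omega) (by omega), h5]) hs₂.r11 (fun hpos => ?_)
      (fun hpos => ?_)
    · obtain ⟨a, rfl⟩ := Nat.exists_eq_succ_of_ne_zero (Nat.pos_iff_ne_zero.1 hpos)
      refine vc_bid hV hE hs₂ h5 h6 h7 ?_
      intro ρ₃ mem₃ S₃ len₃ cur₃ w₃ hw₃ hs₃ hres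
      have hR₃ := hs₃.auction.raised_le hK
      refine ⟨_, ?_, len₃, i₂, cur₃, rfl, hs₃⟩
      refine fin _ _ _ ?_ (by unfold roundCost; omega)
      dsimp only
      rcases hres with hres | ⟨rfl, hres, hno⟩
      · have h3 : (if cur₃ = 0 then 0 else 1) ≤ 1 := by split_ifs <;> omega
        rcases hcase with ⟨h1, rfl, h2⟩ | ⟨h1, h2, -⟩ | ⟨h1, rfl, -⟩
        · rw [if_neg h1]; omega
        · omega
        · omega
      · rcases hcase with ⟨h1, rfl, h2⟩ | ⟨h1, h2, -⟩ | ⟨h1, rfl, a', b, h2, h3, h4⟩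
        · rw [if_neg h1, if_pos rfl]; omega
        · omega
        -- A bidder taken in this very round meets an item of price below `E` and cannot have given
        -- up.
        · obtain rfl : a = a' := by omega
          have := hno b h3
          omega
    · simp only [vc]
      obtain rfl : cur₂ = 0 := by omega
      refine ⟨_, ?_, len, i₂, 0, rfl, hs₂⟩
      refine fin _ _ _ ?_ (by unfold roundCost; omega)
      rcases hcase with ⟨h1, rfl, h2⟩ | ⟨h1, h2, rfl⟩ | ⟨h1, rfl, a', b, h2, -⟩
      · exact absurd h2.symm h1
      · have := hs₂.auction.le_len
        rw [if_pos rfl, if_pos h1]; omega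
      · omega
  · rintro k ρ₁ mem₁ S₁ w ⟨len', i, cur, rfl, hs⟩ hge hw
    rw [hs.r10, hs.r4] at hge
    have hcur : cur = 0 := by
      by_contra hcur
      have := hs.auction.cur_lt hcur
      omega
    subst hcur
    obtain rfl : i = len' := by have := hs.auction.le_len; omega
    refine hQ ρ₁ mem₁ S₁ i _ hs.low hs.r4 ?_ hs.off_eq hs.cnt_eq hs.core hs.auction
    have : roundCost E G * (2 * (E * K - raised (mem 3) (mem 5) len) + K) ≤
        roundCost E G * (2 * (E * K) + K) := Nat.mul_le_mul_left _ (by omega)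
    omega

end

/-! ### The program and its amortized analysis -/

section
variable {X : Type u} {C : Set (Set X)}

/-- Recompute the matching by an auction. -/
def rebuild (G : ℕ) : Prog :=
  .seq gather (.seq (auctionLoop G) (.seq cleanUp (.seq (.add 3 4 5) .skip)))

theorem vc_rebuild {V : TwoSets C} {E G n K : ℕ} {ρ : ℕ → ℕ} {mem : ℕ → ℕ → ℕ}
    {S : ℕ → Store C} {Q : AState C → ℕ → Prop} {len : ℕ} (hV : Distinct V) (hE : 0 < E)
    (hK : OptLe V K) (hc : Calm V E G n mem S len 0) (h2 : ρ 2 = E)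
    (h5 : ρ 5 = 0) (h6 : ρ 6 = 1) (h7 : ρ 7 = E + 3) (h4 : ρ 4 = len)
    (hQ : ∀ ρ' mem' S' len' w, ρ' 2 = E → ρ' 3 = len' → ρ' 4 = len' →
      w ≤ 21 * len + 10 * K + roundCost E G * (2 * (E * K) + K) + 20 →
      Calm V E G n mem' S' len' 0 → (matchedItems V (mem' 0)).ncard = len' →
      OptLe V ((E + 1) * len' / E) → Q ⟨ρ', mem', S'⟩ w) :
    vc V.objs n (rebuild G) ⟨ρ, mem, S⟩ Q := by
  unfold rebuild
  refine vc_seq (vc_gather hV hc h2 h5 h6 h4 hE ?_)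
  intro ρ₁ mem₁ S₁ len₁ w₁ hρ₁ q4 q16 q17 hw₁ m0 m2 m4 hc₁ ha₁
  have q5 : ρ₁ 5 = 0 := by rw [hρ₁ 5 (by omega) (by omega), h5]
  have q6 : ρ₁ 6 = 1 := by rw [hρ₁ 6 (by omega) (by omega), h6]
  have q7 : ρ₁ 7 = E + 3 := by rw [hρ₁ 7 (by omega) (by omega), h7]
  refine vc_seq (vc_auctionLoop hV hE hK hc₁ ha₁ q5 q6 q7 q4 q16 q17 ?_)
  intro ρ₂ mem₂ S₂ len₂ w₂ hρ₂ t4 hw₂ m2' m4' hc₂ ha₂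
  have t5 : ρ₂ 5 = 0 := by rw [hρ₂ 5 (by omega) (by omega), q5]
  have t6 : ρ₂ 6 = 1 := by rw [hρ₂ 6 (by omega) (by omega), q6]
  have hle := ha₂.list.le_opt ha₂.inv hK
  refine vc_seq (vc_cleanUp hc₂ ha₂ t5 t6 t4 ?_ ?_)
  · rw [m2', m4', m2, m4]
    exact hc.count
  intro ρ₃ mem₃ S₃ w₃ hρ₃ hw₃ m0' hc₃
  have s4 : ρ₃ 4 = len₂ := by rw [hρ₃ 4 (by omega), t4]
  have s5 : ρ₃ 5 = 0 := by rw [hρ₃ 5 (by omega), t5]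
  refine vc_add len₂ (by simp [s4, s5]) ?_
  simp only [vc]
  refine hQ _ _ _ len₂ _ ?_ (by simp) (by simp [s4]) (by omega) hc₃ ?_ ?_
  · rw [Function.update_of_ne (by omega), hρ₃ 2 (by omega), hρ₂ 2 (by omega) (by omega),
      hρ₁ 2 (by omega) (by omega), h2]
  · rw [m0']
    exact ha₂.list.ncard_eq
  · intro s hs
    -- Cardinalities are integers, so rounding the bound down loses nothing.
    rw [Nat.le_div_iff_mul_le hE, mul_comm]
    exact ha₂.opt hs

/-- Process one update. -/
def main (G : ℕ) : Prog :=
  .seq (.const 5 0) (.seq (.const 6 1) (.seq (.const 7 3) (.seq (.add 7 2 7)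
    (.seq (.ite 5 0 (insertObj G) (deleteObj G)) (.seq (.sub 3 3 2) (.seq (.sub 3 3 2)
      (.ite 5 3 .skip (rebuild G))))))))

/-- A bound for the work per update, without rebuilding. -/
def updateCost (G : ℕ) : ℕ := 11 * G + 100

/-- A bound for the amortized work per update. -/
def amortizedCost (E G : ℕ) : ℕ := (131 * G + 2000) * E ^ 3

/-- The invariant between the updates: the last rebuilding, `j` updates ago, left a matching with
`m₀` edges, `m` updates were processed in total by work `W`, and no matching has more than
`K` edges. -/
structure Good (V : TwoSets C) (E G n : ℕ) (a : AState C) (m W len m₀ j K : ℕ) : Prop where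
  calm : Calm V E G n a.mem a.st len 0
  r2 : a.reg 2 = E
  r3 : a.reg 3 = m₀ - 2 * E * j
  r4 : a.reg 4 = len
  budget : j = 0 ∨ 2 * E * j < m₀
  len_le : len ≤ m₀ + 2 * j
  opt : OptLe V K
  opt_le : E * K ≤ (E + 1) * m₀ + E * j
  le_ncard : m₀ ≤ (matchedItems V (a.mem 0)).ncard + j
  j_le : j ≤ m
  work : W ≤ amortizedCost E G * (m - j) + updateCost G * j

/-- As rebuilding waits until m₀ ≤ 2EJ, both OPT and the list have size O(EJ). The auction has
O(E·OPT) rounds of cost O(GE), in total O(GE³J), which is shared by `J` updates. -/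
theorem rebuild_cost {E G m₀ J K len w : ℕ} (hE : 0 < E) (hJ : 0 < J) (hm : m₀ ≤ 2 * E * J)
    (hK : E * K ≤ (E + 1) * m₀ + E * J) (hlen : len ≤ m₀ + 2 * J)
    (hw : w ≤ 21 * len + 10 * K + roundCost E G * (2 * (E * K) + K) + 30) :
    updateCost G * J + w ≤ amortizedCost E G * J := by
  have hK' : K ≤ 2 * m₀ + J := by
    refine Nat.le_of_mul_le_mul_left (hK.trans ?_) hE
    nlinarith
  have hEJ : J ≤ E * J := Nat.le_mul_of_pos_left J hE
  have hE2 : E ≤ E ^ 2 := Nat.le_self_pow (by omega) E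
  have hE3 : E ^ 2 ≤ E ^ 3 := Nat.pow_le_pow_right hE (by omega)
  have hK5 : K ≤ 5 * (E * J) := by nlinarith
  have hlen4 : len ≤ 4 * (E * J) := by nlinarith
  have hrc : roundCost E G ≤ (8 * G + 88) * E := by unfold roundCost; nlinarith
  have h1 : 2 * (E * K) + K ≤ 15 * (E ^ 2 * J) := by
    calc 2 * (E * K) + K ≤ 2 * (E * K) + E * K := by
          have := Nat.le_mul_of_pos_left K hE
          omega
      _ = 3 * E * K := by ring
      _ ≤ 3 * E * (5 * (E * J)) := Nat.mul_le_mul_left _ hK5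
      _ = _ := by ring
  have h2 : roundCost E G * (2 * (E * K) + K) ≤ (120 * G + 1320) * (E ^ 3 * J) := by
    calc _ ≤ (8 * G + 88) * E * (15 * (E ^ 2 * J)) := Nat.mul_le_mul hrc h1
      _ = _ := by ring
  have h3 : E * J ≤ E ^ 3 * J := Nat.mul_le_mul_right _ (hE2.trans hE3)
  -- `120 * G + 1320` pays for the auction, `11 * G + 100` for the updates themselves, and the
  -- remaining 580 exceeds 21·4 + 10·5 + 30, the cost of the lists and the additive constant.
  have h4 : amortizedCost E G * J = (11 * G + 680) * (E ^ 3 * J) +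
      (120 * G + 1320) * (E ^ 3 * J) := by unfold amortizedCost; ring
  have h5 : updateCost G * J ≤ (11 * G + 100) * (E ^ 3 * J) :=
    Nat.mul_le_mul_left _ (hEJ.trans h3)
  have h6 : (11 * G + 680) * (E ^ 3 * J) = (11 * G + 100) * (E ^ 3 * J) + 580 * (E ^ 3 * J) := by
    ring
  omega

/-- The registers when the program is started to process an update. -/
def feedReg (ρ : ℕ → ℕ) : Update C → ℕ → ℕ
  | .insert s h _ => Function.update (Function.update ρ 0 (if s then 2 else 1)) 1 h
  | .delete h => Function.update (Function.update ρ 0 0) 1 h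

theorem Distinct.act {V : TwoSets C} (hV : Distinct V) {w : Update C} (hw : w.Legal V) :
    Distinct (w.act V) := by
  cases w with
  | insert s h x =>
    obtain ⟨h1, h2⟩ := hw
    intro g g' hg hn
    simp only [Update.act] at hg hn
    by_cases e : g = h <;> by_cases e' : g' = h
    · rw [e, e']
    · rw [e] at hg
      simp only [Function.update_self, Function.update_of_ne e'] at hg
      exact absurd hg.symm (h2 g')
    · rw [e'] at hg
      simp only [Function.update_self, Function.update_of_ne e] at hg
      exact absurd hg (h2 g)
    · simp only [Function.update_of_ne e, Function.update_of_ne e'] at hg hn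
      exact hV g g' hg hn
  | delete h =>
    intro g g' hg hn
    simp only [Update.act] at hg hn
    by_cases e : g = h
    · simp [e] at hn
    · by_cases e' : g' = h
      · rw [e', Function.update_self] at hg; exact absurd hg hn
      simp only [Function.update_of_ne e, Function.update_of_ne e'] at hg hn
      exact hV g g' hg hn

/-- Register 3 counts down from `m₀` in steps of `2 * E`, with truncated subtraction, so it is 0
exactly when the current update makes the number of updates reach m₀ / (2E). With `m₀ = 0`, the very
next update rebuilds. -/
theorem vc_main {V : TwoSets C} {E G n : ℕ} {ρ : ℕ → ℕ} {mem : ℕ → ℕ → ℕ}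
    {S : ℕ → Store C} {m W len m₀ j K : ℕ} (hV : Distinct V) (hE : 0 < E) (hG : 0 < G)
    (hg : Good V E G n ⟨ρ, mem, S⟩ m W len m₀ j K) {u : Update C} (hu : u.Legal V)
    (hn : {g | (u.act V).objs g ≠ none}.ncard ≤ G * n) :
    vc (u.act V).objs n (main G) ⟨feedReg ρ u, mem, S⟩ (fun a w => ∃ len m₀ j K,
      Good (u.act V) E G n a (m + 1) (W + w) len m₀ j K) := by
  have hV' := hV.act hu
  have hr2 : ρ 2 = E := hg.r2
  have hr3 : ρ 3 = m₀ - 2 * E * j := hg.r3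
  have hr4 : ρ 4 = len := hg.r4
  have f2 : feedReg ρ u 2 = E := by cases u <;> simp [feedReg, hr2]
  have f3 : feedReg ρ u 3 = m₀ - 2 * E * j := by cases u <;> simp [feedReg, hr3]
  have f4 : feedReg ρ u 4 = len := by cases u <;> simp [feedReg, hr4]
  unfold main
  refine vc_const (vc_const (vc_const ?_))
  refine vc_add (E + 3) (by simp [f2]) ?_
  refine vc_seq ?_
  have rest : ∀ (ρ₁ : ℕ → ℕ) (mem₁ : ℕ → ℕ → ℕ) (S₁ : ℕ → Store C) (len₁ w₁ : ℕ),
      ρ₁ 2 = E → ρ₁ 3 = m₀ - 2 * E * j → ρ₁ 5 = 0 → ρ₁ 6 = 1 → ρ₁ 7 = E + 3 → ρ₁ 4 = len₁ →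
      len₁ ≤ len + 2 → w₁ ≤ 11 * G + 70 → Calm (u.act V) E G n mem₁ S₁ len₁ 0 →
      (matchedItems V (mem 0)).ncard ≤ (matchedItems (u.act V) (mem₁ 0)).ncard + 1 →
      vc (u.act V).objs n (.seq (.sub 3 3 2) (.seq (.sub 3 3 2) (.ite 5 3 .skip (rebuild G))))
        ⟨ρ₁, mem₁, S₁⟩ (fun a w => ∃ len m₀ j K,
          Good (u.act V) E G n a (m + 1) (W + (w₁ + w)) len m₀ j K) := by
    intro ρ₁ mem₁ S₁ len₁ w₁ q2 q3 q5 q6 q7 q4 hlen hw hc hncard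
    have hopt : OptLe (u.act V) (K + 1) := by
      cases u with
      | insert s h x => exact hg.opt.update h _
      | delete h => exact hg.opt.update h _
    have hoptle : E * (K + 1) ≤ (E + 1) * m₀ + E * (j + 1) := by
      have := hg.opt_le
      rw [mul_add, mul_add]; omega
    have h1 := hg.len_le
    have h2 := hg.le_ncard
    have h3 := hg.j_le
    have hwork := hg.work
    dsimp only at h2
    have hsub : m₀ - 2 * E * j - E - E = m₀ - 2 * E * (j + 1) := by
      rw [mul_add]; omega
    refine vc_sub (m₀ - 2 * E * j - E) (by rw [q3, q2]) ?_
    refine vc_sub (m₀ - 2 * E * (j + 1)) (by simp [q2, hsub]) ?_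
    refine vc_ite 0 (m₀ - 2 * E * (j + 1)) (by simp [q5]) (by simp) (fun hpos => ?_)
      (fun hpos => ?_)
    · simp only [vc]
      refine ⟨len₁, m₀, j + 1, K + 1, hc, by simp [q2], by simp, by simp [q4], .inr (by omega),
        by omega, hopt, hoptle, ?_, by omega, ?_⟩
      · dsimp only; omega
      · rw [show m + 1 - (j + 1) = m - j by omega]
        rw [mul_add]
        have : updateCost G = 11 * G + 100 := rfl
        omega
    · refine vc_rebuild hV' hE hopt hc (by simp [q2]) (by simp [q5]) (by simp [q6]) (by simp [q7])
        (by simp [q4]) ?_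
      intro ρ₂ mem₂ S₂ len₂ w₃ t2 t3 t4 hw₃ hc₂ hcard hopt₂
      refine ⟨len₂, len₂, 0, (E + 1) * len₂ / E, hc₂, t2, by simpa using t3, t4, .inl rfl,
        by omega, hopt₂, ?_, by simp [hcard], by omega, ?_⟩
      · simpa using Nat.mul_div_le ((E + 1) * len₂) E
      · have := rebuild_cost (G := G) (w := w₃ + 10) hE (show 0 < j + 1 by omega)
          (show m₀ ≤ 2 * E * (j + 1) by omega) hoptle (show len₁ ≤ m₀ + 2 * (j + 1) by omega)
          (by omega)
        have e : amortizedCost E G * (m + 1 - 0) = amortizedCost E G * (m - j) +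
            amortizedCost E G * (j + 1) := by
          rw [← mul_add]; congr 1; omega
        rw [e]
        have e' : updateCost G * (j + 1) = updateCost G * j + (11 * G + 100) := by
          rw [mul_add, mul_one]; rfl
        omega
  have conclude : ∀ (ρ₁ : ℕ → ℕ) (mem₁ : ℕ → ℕ → ℕ) (S₁ : ℕ → Store C) (len₁ w : ℕ),
      (∀ r < 10, r ≠ 4 → ρ₁ r = Function.update (Function.update (Function.update (Function.update
        (feedReg ρ u) 5 0) 6 1) 7 3) 7 (E + 3) r) → ρ₁ 4 = len₁ → len₁ ≤ len + 2 →
      w ≤ 11 * G + 60 → Calm (u.act V) E G n mem₁ S₁ len₁ 0 →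
      (matchedItems V (mem 0)).ncard ≤ (matchedItems (u.act V) (mem₁ 0)).ncard + 1 →
      vc (u.act V).objs n (.seq (.sub 3 3 2) (.seq (.sub 3 3 2) (.ite 5 3 .skip (rebuild G))))
        ⟨ρ₁, mem₁, S₁⟩ (fun a w' => ∃ len m₀ j K,
          Good (u.act V) E G n a (m + 1) (W + (1 + (1 + (1 + (1 + (1 + w + w')))))) len m₀ j K) := by
    intro ρ₁ mem₁ S₁ len₁ w hρ q4 hlen hw hc hncard
    have := rest ρ₁ mem₁ S₁ len₁ (w + 5) (by rw [hρ 2 (by omega) (by omega)]; simp [f2])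
      (by rw [hρ 3 (by omega) (by omega)]; simp [f3]) (by rw [hρ 5 (by omega) (by omega)]; simp)
      (by rw [hρ 6 (by omega) (by omega)]; simp) (by rw [hρ 7 (by omega) (by omega)]; simp)
      q4 hlen (by omega) hc hncard
    have e : ∀ w', 1 + (1 + (1 + (1 + (1 + w + w')))) = w + 5 + w' := by intro w'; omega
    simpa only [e] using this
  cases u with
  | insert s h x =>
    refine vc_ite 0 (if s then 2 else 1) (by simp) (by simp [feedReg]) (fun _ => ?_)
      (fun h => absurd h (by split_ifs <;> omega))
    refine vc_insertObj hV' hu.1 hg.calm (by simp [feedReg]) (by simp [feedReg]) (by simp)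
      (by simp) (by simp) (by simp [f4]) hE hG hn ?_
    intro ρ' mem' S' len' w hρ' h4' hlen' hw' hc' hm'
    exact conclude ρ' mem' S' len' w hρ' h4' hlen' (by omega) hc' hm'
  | delete h =>
    refine vc_ite 0 0 (by simp) (by simp [feedReg]) (fun h => absurd h (lt_irrefl _)) (fun _ => ?_)
    refine vc_deleteObj hV' hu hg.calm (by simp [feedReg]) (by simp)
      (by simp) (by simp) (by simp [f4]) hE ?_
    intro ρ' mem' S' len' w hρ' h4' hlen' hw' hc' hm'
    exact conclude ρ' mem' S' len' w hρ' h4' hlen' (by omega) hc' hm'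

end

/-! ### Serving a sequence of updates -/

section
variable {X : Type u} {C : Set (Set X)} {D : BlackBox.{u, v} C}

theorem setsAfter_append (us : List (Update C)) (w : Update C) :
    setsAfter (us ++ [w]) = w.act (setsAfter us) := by
  simp [setsAfter]

theorem LegalSeq.init {us : List (Update C)} {w : Update C} (h : LegalSeq (us ++ [w])) :
    LegalSeq us := fun vs w' hp => h vs w' (hp.trans (List.prefix_append _ _))

theorem LegalSeq.last {us : List (Update C)} {w : Update C} (h : LegalSeq (us ++ [w])) :
    w.Legal (setsAfter us) := h us w (List.prefix_refl _)

theorem LegalSeq.distinct {us : List (Update C)} (h : LegalSeq us) : Distinct (setsAfter us) := by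
  induction us using List.reverseRecOn with
  | nil => intro g g' _ hn; simp [setsAfter] at hn
  | append_singleton us w ih =>
    rw [setsAfter_append]
    exact (ih h.init).act h.last

theorem objs_act_subset (V : TwoSets C) (w : Update C) : ∃ h,
    {g | (w.act V).objs g ≠ none} ⊆ insert h {g | V.objs g ≠ none} := by
  cases w with
  | insert s h x | delete h =>
    refine ⟨h, fun g hg => ?_⟩
    by_cases hgh : g = h
    · exact .inl hgh
    · exact .inr (by simpa [Update.act, TwoSets.objs, hgh] using hg)

theorem objs_finite_ncard_le (us : List (Update C)) :
    {g | (setsAfter us).objs g ≠ none}.Finite ∧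
      {g | (setsAfter us).objs g ≠ none}.ncard ≤ us.length := by
  induction us using List.reverseRecOn with
  | nil => simp [setsAfter, TwoSets.objs]
  | append_singleton us w ih =>
    rw [setsAfter_append]
    obtain ⟨h, hh⟩ := objs_act_subset (setsAfter us) w
    refine ⟨(ih.1.insert h).subset hh, (Set.ncard_le_ncard hh (ih.1.insert h)).trans ?_⟩
    refine (Set.ncard_insert_le _ _).trans ?_
    simpa using ih.2

theorem ncard_objs_le (V : TwoSets C) :
    {g | V.objs g ≠ none}.ncard ≤ V.size false + V.size true := by
  have e : {g | V.objs g ≠ none} = {h | ∃ x, V h = some (false, x)} ∪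
      {h | ∃ x, V h = some (true, x)} := by
    ext g
    simp only [Set.mem_union, Set.mem_ofPred_eq, objs_ne_none]
    rw [Option.ne_none_iff_exists']
    constructor
    · rintro ⟨⟨s, x⟩, hx⟩
      cases s
      · exact .inl ⟨x, hx⟩
      · exact .inr ⟨x, hx⟩
    · rintro (⟨x, hx⟩ | ⟨x, hx⟩)
      · exact ⟨_, hx⟩
      · exact ⟨_, hx⟩
  rw [e]
  exact Set.ncard_union_le _ _

theorem Refines.feed {n : ℕ} {a : AState C} {σ : Config D} {T w : ℕ} (h : Refines n a σ T w)
    (u : Update C) : Refines n ⟨feedReg a.reg u, a.mem, a.st⟩ (σ.feed u) T w := by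
  obtain ⟨h1, h2, h3⟩ := h
  cases u <;> exact ⟨by simp [Config.feed, Config.setReg, feedReg, h1], h2, h3⟩

theorem good_initial (E G n : ℕ) : Good (C := C) (fun _ => none) E G n
    ⟨Function.update (fun _ => 0) 2 E, fun _ _ => 0, fun _ _ => none⟩ 0 0 0 0 0 0 := by
  have hadj : ∀ h g, ¬ (bipGraph (fun _ => none : TwoSets C)).Adj h g := by
    rintro h g ⟨s, x, y, h1, -⟩
    simp at h1
  refine ⟨⟨⟨?_, ?_, ?_, ?_, ?_, ?_⟩, ⟨?_, ?_, ?_, ?_, ?_, ?_, ?_⟩, ?_, ?_, ?_⟩, ?_, ?_, ?_, .inl rfl,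
    ?_, ?_, ?_, ?_, le_rfl, ?_⟩
  any_goals simp [TwoSets.objs, matchedItems]
  · intro h g hhg
    exact absurd hhg (hadj h g)
  · intro s hs
    rw [Nat.le_zero, Finset.card_eq_zero, Finset.eq_empty_iff_forall_notMem]
    intro e he
    exact hadj _ _ (hs.1 e he).1

/-- The number `n` occurs in the analysis only, not in the program, so one and the same run can be
analyzed for several `n`. -/
theorem exists_serves (hD : D.FindsIntersecting) {E G n : ℕ} (hE : 0 < E) (hG : 0 < G)
    (us : List (Update C)) (hl : LegalSeq us)
    (hn : ∀ vs, vs <+: us → {g | (setsAfter vs).objs g ≠ none}.ncard ≤ G * n) :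
    ∃ (σ : Config D) (t : ℕ) (a : AState C) (W len m₀ j K : ℕ), Serves (main G) E us σ t ∧
      Refines n a σ t W ∧ Good (setsAfter us) E G n a us.length W len m₀ j K := by
  induction us using List.reverseRecOn with
  | nil => exact ⟨_, _, _, 0, 0, 0, 0, 0, .nil, Refines.initial n E, good_initial E G n⟩
  | append_singleton us w ih =>
    obtain ⟨σ, t, a, W, len, m₀, j, K, hs, hr, hg⟩ := ih hl.init
      (fun vs hvs => hn vs (hvs.trans (List.prefix_append _ _)))
    have hsize := hn _ (List.prefix_refl _)
    rw [setsAfter_append] at hsize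
    have h := vc_main hl.init.distinct hE hG hg hl.last hsize
    obtain ⟨σ', t', a', w', he, hr', len', m₀', j', K', hg'⟩ :=
      vc_sound hD _ n _ _ _ h _ _ _ (hr.feed w)
    refine ⟨σ', t + t', a', W + w', len', m₀', j', K', .snoc w hs ?_, hr', ?_⟩
    · rw [setsAfter_append]; exact he
    · rw [setsAfter_append, List.length_append]; exact hg'

/-! ### From arrays of partners to subgraphs -/

/-- The matching that is described by the partners. -/
def mateSubgraph {V : TwoSets C} {mate side fam : ℕ → ℕ} {cur : ℕ}
    (hi : Inv V mate side fam cur) : (bipGraph V).Subgraph where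
  verts := {h | mate h ≠ 0}
  Adj h g := mate h = g + 1
  adj_sub h := hi.mate_adj _ _ h
  edge_vert := by
    intro h g hg
    simp [hg]
  symm := ⟨fun h g hg => hi.mate_symm h g hg⟩

theorem mateSubgraph_isMatching {V : TwoSets C} {mate side fam : ℕ → ℕ} {cur : ℕ}
    (hi : Inv V mate side fam cur) : (mateSubgraph hi).IsMatching := by
  intro h hh
  obtain ⟨g, hg⟩ := Nat.exists_eq_succ_of_ne_zero hh
  refine ⟨g, hg, fun g' hg' => ?_⟩
  have : mate h = g' + 1 := hg'
  omega

/-- Every edge has an orientation that ends in the second set; this translates matchings into the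
pairs of `IsPairing`. -/
theorem edgeSet_eq_image {V : TwoSets C} (N : (bipGraph V).Subgraph) :
    N.edgeSet = (fun e : ℕ × ℕ => s(e.1, e.2)) ''
      {e | N.Adj e.1 e.2 ∧ ∃ x, V e.2 = some (true, x)} := by
  ext e
  induction e using Sym2.ind with
  | _ a b =>
    simp only [SimpleGraph.Subgraph.mem_edgeSet, Set.mem_image, Set.mem_ofPred_eq, Prod.exists]
    constructor
    · intro h
      obtain ⟨s, x, y, hx, hy, -⟩ := N.adj_sub h
      cases s
      · exact ⟨a, b, ⟨h, y, hy⟩, rfl⟩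
      · exact ⟨b, a, ⟨h.symm, x, hx⟩, Sym2.eq_swap⟩
    · rintro ⟨a', b', ⟨h, -⟩, he⟩
      rw [← SimpleGraph.Subgraph.mem_edgeSet, ← he]
      exact h

theorem finite_pairs {V : TwoSets C} (hf : {g | V.objs g ≠ none}.Finite)
    (N : (bipGraph V).Subgraph) : {e : ℕ × ℕ | N.Adj e.1 e.2 ∧ ∃ x, V e.2 = some (true, x)}.Finite := by
  refine (hf.prod hf).subset ?_
  rintro ⟨a, b⟩ ⟨h, -⟩
  obtain ⟨s, x, y, hx, hy, -⟩ := N.adj_sub h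
  exact ⟨by simp [objs_of hx], by simp [objs_of hy]⟩

theorem OptLe.edgeSet_ncard_le {V : TwoSets C} {K : ℕ} (hK : OptLe V K)
    (hf : {g | V.objs g ≠ none}.Finite) {N : (bipGraph V).Subgraph} (hN : N.IsMatching) :
    N.edgeSet.ncard ≤ K := by
  rw [edgeSet_eq_image]
  refine (Set.ncard_image_le (finite_pairs hf N)).trans ?_
  rw [Set.ncard_eq_toFinset_card _ (finite_pairs hf N)]
  refine hK _ ⟨?_, ?_, ?_⟩
  · intro e he
    rw [Set.Finite.mem_toFinset] at he
    exact ⟨N.adj_sub he.1, he.2⟩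
  · intro e he e' he' hee
    rw [Set.Finite.mem_toFinset] at he he'
    refine Prod.ext hee ?_
    have h2 := he'.1
    rw [← hee] at h2
    exact hN.eq_of_adj_left he.1 h2
  · intro e he e' he' hee
    rw [Set.Finite.mem_toFinset] at he he'
    refine Prod.ext ?_ hee
    have h2 := he'.1
    rw [← hee] at h2
    exact hN.eq_of_adj_left he.1.symm h2.symm

/-- An edge contains only one item, so sending a matched item to its edge is injective. -/
theorem ncard_matchedItems_le_edgeSet {V : TwoSets C} {mate side fam : ℕ → ℕ} {cur : ℕ}
    (hi : Inv V mate side fam cur) (hf : {g | V.objs g ≠ none}.Finite) :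
    (matchedItems V mate).ncard ≤ (mateSubgraph hi).edgeSet.ncard := by
  have hfin : (mateSubgraph hi).edgeSet.Finite := by
    rw [edgeSet_eq_image]
    exact (finite_pairs hf _).image _
  refine Set.ncard_le_ncard_of_injOn (fun b => s(b, mate b - 1)) ?_ ?_ hfin
  · rintro b ⟨-, hb⟩
    rw [SimpleGraph.Subgraph.mem_edgeSet]
    change mate b = mate b - 1 + 1
    omega
  · rintro b ⟨⟨y, hy⟩, hb⟩ b' ⟨⟨y', hy'⟩, hb'⟩ h
    rcases Sym2.eq_iff.1 h with ⟨h1, -⟩ | ⟨h1, -⟩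
    · exact h1
    · obtain ⟨x, hx⟩ := bipGraph_adj_left
        (hi.mate_adj b' b (by omega)).symm hy'
      simp [hy] at hx

theorem Good.approx {V : TwoSets C} {E G n : ℕ} {a : AState C} {m W len m₀ j K : ℕ}
    (h : Good V E G n a m W len m₀ j K) (hE : 0 < E) {ε : ℝ} (hε : 1 ≤ ε * E) :
    (K : ℝ) ≤ (1 + 4 * ε) * (matchedItems V (a.mem 0)).ncard := by
  set s := (matchedItems V (a.mem 0)).ncard
  have h1 := h.opt_le
  have h2 : m₀ ≤ s + j := h.le_ncard
  have h3 : 2 * j ≤ m₀ := by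
    rcases h.budget with h3 | h3
    · omega
    · nlinarith
  have h4 : 2 * E * j ≤ m₀ := by
    rcases h.budget with h3 | h3
    · simp [h3]
    · exact h3.le
  have h5 : E * m₀ ≤ E * s + E * j := by nlinarith
  -- From 2j ≤ m₀ ≤ s + j follows j ≤ s, and then 2Ej ≤ s + j ≤ 2s. Hence (E + 1)(s + j) + Ej = Es +
  -- s + 2Ej + j ≤ Es + 4s.
  have h6 : E * K ≤ E * s + 4 * s := by nlinarith
  have h6' : (E * K : ℝ) ≤ E * s + 4 * s := by exact_mod_cast h6
  have hE' : (0 : ℝ) < E := by exact_mod_cast hE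
  have h7 : (4 * s : ℝ) ≤ 4 * s * (ε * E) := le_mul_of_one_le_right (by positivity) hε
  refine le_of_mul_le_mul_left ?_ hE'
  nlinarith

/-- The first update cannot be a deletion. The object obtained forces `n ≥ 1` and serves as a query
in `BlackBox.HasTime.one_le`. -/
theorem LegalSeq.exists_obj {us : List (Update C)} (hl : LegalSeq us) (hne : us ≠ []) :
    ∃ (s : Bool) (x : C) (h : ℕ), [Update.insert s h x] <+: us := by
  obtain ⟨w, us, rfl⟩ := List.exists_cons_of_ne_nil hne
  have hp : [w] <+: w :: us := ⟨us, rfl⟩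
  have := hl [] w hp
  cases w with
  | insert s h x => exact ⟨s, x, h, hp⟩
  | delete h => simp [Update.Legal, setsAfter] at this

/-- A single search in the empty structure takes at least one step. -/
theorem BlackBox.HasTime.one_le {τ : ℕ → ℝ} {A : ℝ} {n : ℕ}
    (hA : ∀ (q : D.State) (S : Store C) (m t : ℕ), D.Reach n q S m t → (t : ℝ) ≤ A * τ n * m)
    (x : C) : 1 ≤ A * τ n := by
  have h := hA _ _ _ _ (BlackBox.Reach.step (.find x) (BlackBox.Reach.start (D := D) (n := n))
    trivial (by simp [DSOp.act, Store.size]))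
  have h1 : (1 : ℝ) ≤ D.time D.start (.find x) := by exact_mod_cast D.time_pos _ _
  simp at h
  linarith

end
end DynMatching

/-! ### The theorem: choice of constants -/

theorem theorem5p2 {X : Type u} (C : Set (Set X)) (D : DynMatching.BlackBox.{u, v} C)
    (hD : D.FindsIntersecting) (τ₀ : ℕ → ℝ) (hτ₀ : D.HasTime τ₀) (c : ℕ) :
    ∃ (p : DynMatching.Prog) (K : ℝ) (k : ℕ), ∀ ε : ℝ, 0 < ε → ε ≤ 1 →
      ∀ us : List (DynMatching.Update C), DynMatching.LegalSeq us →
      ∃ (σ : DynMatching.Config D) (t : ℕ), DynMatching.Serves p ⌈1 / ε⌉₊ us σ t ∧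
        (∃ M : (DynMatching.bipGraph (DynMatching.setsAfter us)).Subgraph,
          M.IsMatching ∧ DynMatching.Lists (σ.mem 0) M ∧
          ∀ M' : (DynMatching.bipGraph (DynMatching.setsAfter us)).Subgraph, M'.IsMatching →
            (M'.edgeSet.ncard : ℝ) ≤ (1 + K * ε) * M.edgeSet.ncard) ∧
        ∀ n : ℕ, (∀ vs, vs <+: us → ∀ s, (DynMatching.setsAfter vs).size s ≤ c * n) →
          (t : ℝ) ≤ K * (1 / ε ^ 3) * Real.log (n + 2) ^ k * τ₀ n * us.length := by
  open DynMatching in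
  obtain ⟨A, hA0, hA⟩ := hτ₀
  -- `2 * c` parts of `n` objects hold both sets; one more keeps the number of parts positive for `c
  -- = 0`.
  set G := 2 * c + 1 with hG
  have hG0 : 0 < G := by omega
  set c₁ : ℝ := 131 * G + 2000 with hc₁
  have hc₁0 : 0 < c₁ := by positivity
  -- The 4 comes from `Good.approx`; 16 is 2 from `Refines.time_le` times 8 from E ≤ 2/ε. The
  -- exponent of the logarithm is 0.
  refine ⟨main G, 4 + 16 * A * c₁, 0, fun ε hε hε1 us hl => ?_⟩
  have hE : 0 < ⌈1 / ε⌉₊ := Nat.ceil_pos.2 (by positivity)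
  have hεE : 1 ≤ ε * ⌈1 / ε⌉₊ := by
    have := mul_le_mul_of_nonneg_left (Nat.le_ceil (1 / ε)) hε.le
    rwa [mul_one_div_cancel hε.ne'] at this
  have hE2 : (⌈1 / ε⌉₊ : ℝ) ≤ 2 / ε := by
    have h1 := (Nat.ceil_lt_add_one (show 0 ≤ 1 / ε by positivity)).le
    have h2 : 1 ≤ 1 / ε := by rwa [le_div_iff₀ hε, one_mul]
    have h3 : 2 / ε = 1 / ε + 1 / ε := by ring
    linarith
  set E := ⌈1 / ε⌉₊
  have hfin := (objs_finite_ncard_le us).1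
  -- Termination and the quality of the matching need no assumption on the sizes, so the trivial
  -- size bound `us.length` is used here.
  obtain ⟨σ, t, a, W, len, m₀, j, K, hs, hr, hg⟩ := exists_serves (D := D) (n := us.length) hD hE
    hG0 us hl (fun vs hvs => ((objs_finite_ncard_le vs).2.trans hvs.length_le).trans
      (Nat.le_mul_of_pos_left _ hG0))
  refine ⟨σ, t, hs, ⟨mateSubgraph hg.calm.inv, mateSubgraph_isMatching _, ?_, ?_⟩, ?_⟩
  · intro h _ h'
    rw [hr.2.1]
    rfl
  · intro M' hM'
    have h1 : (M'.edgeSet.ncard : ℝ) ≤ K := by exact_mod_cast hg.opt.edgeSet_ncard_le hfin hM'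
    have h2 : ((matchedItems (setsAfter us) (a.mem 0)).ncard : ℝ) ≤
        (mateSubgraph hg.calm.inv).edgeSet.ncard := by
      exact_mod_cast ncard_matchedItems_le_edgeSet hg.calm.inv hfin
    have h3 : 0 ≤ 16 * A * c₁ := by positivity
    calc _ ≤ (K : ℝ) := h1
      _ ≤ _ := hg.approx hE hεE
      _ ≤ (1 + (4 + 16 * A * c₁) * ε) * (matchedItems (setsAfter us) (a.mem 0)).ncard := by
          gcongr
          linarith
      _ ≤ _ := by gcongr
  · intro n hn
    by_cases hus : us = []
    · subst hus
      obtain ⟨-, rfl⟩ := hs.det .nil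
      simp
    obtain ⟨s, x, h, hpre⟩ := hl.exists_obj hus
    have hn1 : 1 ≤ n := by
      by_contra hn0
      obtain rfl : n = 0 := by omega
      have h0 := hn _ hpre s
      have e : {g | ∃ y, setsAfter [Update.insert s h x] g = some (s, y)} = {h} := by
        ext g
        by_cases hgh : g = h <;> simp [setsAfter, Update.act, hgh]
      rw [TwoSets.size, e, Set.ncard_singleton] at h0
      omega
    -- For the time bound the run is analyzed again with the given `n`; by determinism it is the
    -- same run.
    obtain ⟨σ', t', a', W', len', m₀', j', K', hs', hr', hg'⟩ := exists_serves (D := D) (n := n) hD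
      hE hG0 us hl (fun vs hvs => by
        refine (ncard_objs_le _).trans ?_
        have h1 := hn vs hvs false
        have h2 := hn vs hvs true
        rw [hG, add_mul, mul_assoc]
        omega)
    obtain ⟨rfl, rfl⟩ := hs.det hs'
    have hAn := hA n hn1
    have h1 := BlackBox.HasTime.one_le hAn x
    have h2 := hr'.time_le hAn h1
    have h3 : W' ≤ (131 * G + 2000) * E ^ 3 * us.length := by
      have h4 := hg'.work
      have h5 : updateCost G ≤ amortizedCost E G := by
        unfold updateCost amortizedCost
        have := Nat.le_mul_of_pos_right (131 * G + 2000) (pow_pos hE 3)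
        omega
      calc W' ≤ _ := h4
        _ ≤ amortizedCost E G * (us.length - j') + amortizedCost E G * j' := by gcongr
        _ = amortizedCost E G * us.length := by
            rw [← mul_add, Nat.sub_add_cancel hg'.j_le]
        _ = _ := rfl
    have h4 : (W' : ℝ) ≤ c₁ * E ^ 3 * us.length := by
      rw [hc₁]
      exact_mod_cast h3
    have h5 : (E : ℝ) ^ 3 ≤ 8 * (1 / ε ^ 3) := by
      calc (E : ℝ) ^ 3 ≤ (2 / ε) ^ 3 := by gcongr
        _ = _ := by ring
    have hτ : 0 < τ₀ n := by
      by_contra hτ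
      have := mul_nonpos_of_nonneg_of_nonpos hA0.le (not_lt.1 hτ)
      linarith
    calc (t : ℝ) ≤ 2 * (A * τ₀ n) * W' := h2
      _ ≤ 2 * (A * τ₀ n) * (c₁ * (8 * (1 / ε ^ 3)) * us.length) := by
          gcongr
          exact h4.trans (by gcongr)
      _ = 16 * A * c₁ * (1 / ε ^ 3 * τ₀ n * us.length) := by ring
      _ ≤ (4 + 16 * A * c₁) * (1 / ε ^ 3 * τ₀ n * us.length) := by
          gcongr
          linarith
      _ = _ := by ring
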